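/- There is an absolute constant $C$ such that the following holds. Let $n\ge 1$, $d>n$, $K\ge1$ be integers. Let $H\in\mathbb R[x,y]$ be a polynomial of degree $n+1$ such that the forms $\omega_{ij}=x^{i-1}y^j\,dx$, $1\le i,j\le n$, are a basis over $\mathbb C[t]$ of the Petrov module of $H$ (the complex polynomial one-forms modulo the forms $f\,dH+dg$, with $t$ acting as multiplication by $H$), and such that the complex affine curve $\{H=0\}\subset\mathbb C^2$ is smooth. Let $\omega=P\,dx+Q\,dy$ with $P,Q\in\mathbb R[x,y]$ of degree at most $d$. Then there are rational functions $h_w\in\mathbb R(p)$, indexed by the non-empty words $w=\omega_{i_1j_1}\cdots\omega_{i_kj_k}$ of length $k\le K$ in the forms $\omega_{ij}$, with $\deg h_w\le 2^{CK}dn^6$ (the degree of a rational function being the sum of the degrees of numerator and denominator of its reduced form), such that the following is true. Let $\delta\subset\{H=0\}$ be a simple closed curve in $\mathbb R^2$ with initial point $(0,y_0)$ at which $\{H=0\}$ is transversal to the line $\sigma=\{x=0\}$. Let $\Delta(z,\varepsilon)=z+\varepsilon M_1(z)+\varepsilon^2M_2(z)+\cdots$ be the holonomy map along $\delta$ of the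 foliation $dH+\varepsilon\omega=0$ on $\sigma$, in the coordinate $z=y-y_0$, computed along a real analytic family $\gamma_{z,\varepsilon}$, $|z|,|\varepsilon|<r$, of leafwise paths that deforms $\delta=\gamma_{0,0}$, starts at $(0,y_0+z)$ and ends on $\sigma$. Assume that $M_K$ is the first of the functions $M_1,M_2,\dots$ that does not vanish identically near $z=0$. For small $z$ let $\delta_z=\gamma_{z,0}$ be the cycle of $dH=0$ close to $\delta$ with initial point $(0,p)$, $p=y_0+z$. Then for all $z$ sufficiently close to $0$ no $h_w$ has a pole at $p=y_0+z$, and $$M_K(z)=\sum_w h_w(p)\oint_{\delta_z}w .$$ Here $\oint_{\delta_z}\theta_1\cdots\theta_k=\int_0^1\left(\int_0^{s_1}\left(\cdots\left(\int_0^{s_{k-1}}\delta_z^*\theta_k\right)\cdots\right)\delta_z^*\theta_2\right)\delta_z^*\theta_1$ is the iterated integral, and $\delta_z$ is parameterized by $[0,1]$ from its initial point. -/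

import Mathlib

open Set Filter Topology

noncomputable section

namespace Melnikov

/-- Bivariate polynomials; variable `0` is `x`, variable `1` is `y`. -/
abbrev BiPoly (k : Type*) [CommRing k] : Type _ := MvPolynomial (Fin 2) k

/-- Polynomial one-forms `P dx + Q dy`, stored as the pair `(P, Q)`. -/
abbrev OneForm (k : Type*) [CommRing k] : Type _ := BiPoly k × BiPoly k

/-- The partial derivatives as a `k`-linear map, that is, the differential `g ↦ dg`. -/
def extD (k : Type*) [CommRing k] : BiPoly k →ₗ[k] OneForm k :=
  LinearMap.prod (MvPolynomial.pderiv (0 : Fin 2)).toLinearMap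
    (MvPolynomial.pderiv (1 : Fin 2)).toLinearMap

/-- The relatively exact polynomial one-forms `f dH + dg`. -/
def relExact {k : Type*} [CommRing k] (H : BiPoly k) : Submodule k (OneForm k) :=
  LinearMap.range ((LinearMap.toSpanSingleton (BiPoly k) (OneForm k) (extD k H)).restrictScalars k)
    ⊔ LinearMap.range (extD k)

theorem mem_relExact {k : Type*} [CommRing k] (H : BiPoly k) (θ : OneForm k) :
    θ ∈ relExact H ↔ ∃ f g : BiPoly k, f • extD k H + extD k g = θ := by
  simp [relExact, Submodule.mem_sup]

/-- Relatively exact forms are stable under multiplication by `H`. -/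
theorem relExact_stable {k : Type*} [CommRing k] (H : BiPoly k) :
    relExact H ∈ (Algebra.lsmul k k (OneForm k) H).invtSubmodule := by
  intro θ hθ
  obtain ⟨f, g, rfl⟩ := (mem_relExact H θ).1 hθ
  refine (mem_relExact H _).2 ⟨H * f - g, H * g, ?_⟩
  ext1 <;> simp [extD, Derivation.leibniz] <;> ring

/-- The Petrov module of `H`: polynomial one-forms modulo relatively exact ones, as a module over
`k[t]`, where `t` acts as multiplication by `H`. -/
abbrev PetrovModule {k : Type*} [CommRing k] (H : BiPoly k) : Type _ :=
  Module.AEval k (OneForm k) H ⧸ Module.AEval.mapSubmodule k (OneForm k) H ⟨relExact H, relExact_stable H⟩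

/-- The basic forms `x ^ (i - 1) * y ^ j dx`, `1 ≤ i, j ≤ n`; the indices are shifted by one. -/
def basicForm (k : Type*) [CommRing k] {n : ℕ} (w : Fin n × Fin n) : OneForm k :=
  (MvPolynomial.X 0 ^ (w.1 : ℕ) * MvPolynomial.X 1 ^ ((w.2 : ℕ) + 1), 0)

/-- The class of a form in the Petrov module. -/
def petrovClass {k : Type*} [CommRing k] (H : BiPoly k) (θ : OneForm k) : PetrovModule H :=
  Submodule.Quotient.mk (Module.AEval.of k (OneForm k) H θ)

/-- The `n ^ 2` basic forms are a basis of the Petrov module of `H` over `k[t]`. -/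
def IsPetrovBasis {k : Type*} [CommRing k] (n : ℕ) (H : BiPoly k) : Prop :=
  LinearIndependent (Polynomial k)
      (fun w : Fin n × Fin n => petrovClass H (basicForm k w)) ∧
    Submodule.span (Polynomial k)
      (Set.range fun w : Fin n × Fin n => petrovClass H (basicForm k w)) = ⊤

/-- The affine curve `{H = 0}` in `k ^ 2` has no singular point. -/
def IsSmoothCurve {k : Type*} [CommRing k] (H : BiPoly k) : Prop :=
  ∀ q : Fin 2 → k, MvPolynomial.eval q H = 0 →
    MvPolynomial.eval q (MvPolynomial.pderiv 0 H) ≠ 0 ∨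
      MvPolynomial.eval q (MvPolynomial.pderiv 1 H) ≠ 0

/-- Value of a polynomial at a point of the real plane. -/
def evalAt (q : ℝ × ℝ) (f : BiPoly ℝ) : ℝ := MvPolynomial.eval ![q.1, q.2] f

/-- The density of the pull-back `γ^* θ`: the value of `θ` on the velocity of `γ` at time `s`. -/
def pullback (γ : ℝ → ℝ × ℝ) (θ : OneForm ℝ) (s : ℝ) : ℝ :=
  evalAt (γ s) θ.1 * (deriv γ s).1 + evalAt (γ s) θ.2 * (deriv γ s).2

/-- `∫ θ₁ ⋯ θₖ` along `γ` restricted to `[0, s]`; `θ₁` is integrated last. -/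
def iteratedIntegralTo (γ : ℝ → ℝ × ℝ) : List (OneForm ℝ) → ℝ → ℝ
  | [], _ => 1
  | θ :: l, s => ∫ u in (0 : ℝ)..s, iteratedIntegralTo γ l u * pullback γ θ u

/-- The iterated integral `∫ θ₁ ⋯ θₖ` along the path `γ : [0, 1] → ℝ²`. -/
def iteratedIntegral (γ : ℝ → ℝ × ℝ) (l : List (OneForm ℝ)) : ℝ := iteratedIntegralTo γ l 1

/-- Non-empty words of length at most `K` in the `n ^ 2` basic forms. -/
abbrev Word (n K : ℕ) : Type := Σ k : Fin K, (Fin ((k : ℕ) + 1) → Fin n × Fin n)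

/-- The basic iterated integral of a word along `γ`. -/
def basicIntegral {n K : ℕ} (γ : ℝ → ℝ × ℝ) (w : Word n K) : ℝ :=
  iteratedIntegral γ (List.ofFn fun i => basicForm ℝ (w.2 i))

/-- `δ : [0, 1] → ℝ²` parameterizes a simple closed curve in `{H = 0}` with initial point
`(0, y₀)`, at which `{H = 0}` is transversal to the line `x = 0`. -/
structure IsCycle (H : BiPoly ℝ) (y₀ : ℝ) (δ : ℝ → ℝ × ℝ) : Prop where
  start : δ 0 = (0, y₀)
  closed : δ 1 = δ 0
  simple : InjOn δ (Ico 0 1)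
  level : ∀ s ∈ Icc (0 : ℝ) 1, evalAt (δ s) H = 0
  transversal : evalAt (0, y₀) (MvPolynomial.pderiv 1 H) ≠ 0

/-- `γ z ε`, for `|z| < r` and `|ε| < r`, is a real analytic family of paths deforming `δ`:
the path `γ z ε` lies on the leaf of the foliation `dH + ε ω = 0` through `(0, y₀ + z)`, starts
at this point, and ends on the line `x = 0`. -/
structure IsLeafFamily (H : BiPoly ℝ) (ω : OneForm ℝ) (y₀ : ℝ) (δ : ℝ → ℝ × ℝ) (r : ℝ)
    (γ : ℝ → ℝ → ℝ → ℝ × ℝ) : Prop where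
  pos : 0 < r
  analytic : AnalyticOnNhd ℝ (fun q : ℝ × ℝ × ℝ => γ q.1 q.2.1 q.2.2)
    {q | |q.1| < r ∧ |q.2.1| < r ∧ q.2.2 ∈ Icc (0 : ℝ) 1}
  central : ∀ s ∈ Icc (0 : ℝ) 1, γ 0 0 s = δ s
  leaf : ∀ z ε s, |z| < r → |ε| < r → s ∈ Icc (0 : ℝ) 1 →
    pullback (γ z ε) (extD ℝ H) s + ε * pullback (γ z ε) ω s = 0
  start : ∀ z ε, |z| < r → |ε| < r → γ z ε 0 = (0, y₀ + z)
  finish : ∀ z ε, |z| < r → |ε| < r → (γ z ε 1).1 = 0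

/-- The holonomy map `Δ(z, ε)` of the cycle, in the coordinate `z = y - y₀` on the line `x = 0`:
it sends the initial point of the leafwise path `γ z ε` to its endpoint. -/
def holonomy (y₀ : ℝ) (γ : ℝ → ℝ → ℝ → ℝ × ℝ) (z ε : ℝ) : ℝ := (γ z ε 1).2 - y₀

/-- The `k`-th Melnikov function: the coefficient of `ε ^ k` in the Taylor expansion of
`Δ(z, ε)` in powers of `ε`. -/
def melnikov (Δ : ℝ → ℝ → ℝ) (k : ℕ) (z : ℝ) : ℝ :=
  iteratedDeriv k (fun ε => Δ z ε) 0 / (k.factorial : ℝ)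

/-- `M_K` is the first Melnikov function that does not vanish identically near `z = 0`. -/
def IsFirstNonzero (Δ : ℝ → ℝ → ℝ) (K : ℕ) : Prop :=
  1 ≤ K ∧ (∀ j, 1 ≤ j → j < K → ∀ᶠ z in 𝓝 (0 : ℝ), melnikov Δ j z = 0) ∧
    ¬ ∀ᶠ z in 𝓝 (0 : ℝ), melnikov Δ K z = 0

/-- The degree of a rational function: the sum of the degrees of numerator and denominator,
which is smallest for the reduced fraction. -/
def ratDegree (h : RatFunc ℝ) : ℕ := h.num.natDegree + h.denom.natDegree

end Melnikov

end

/-!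
# The first nonvanishing Melnikov function and iterated integrals

The proof is a degree-controlled version of Françoise's algorithm. Instead of dividing the form `ω`
only when its period vanishes, every step is carried out with functions on paths in the level curves
of `H`, so no vanishing of intermediate periods is used.

*The algorithm.* Consider paths in level curves of `H` that start on the line `x = 0`, at `(0, p)`.
For functions `R` of such a path and of a point moving on it, one can speak of the differential of
`R`, including its component along `dH` that measures the change of the level. Starting with
`u₀ = 1`, one integrates, `F_{k+1} = ∫ u_k ω`, and lets `u_{k+1}` be the derivative of `F_{k+1}` with
respect to the level: `dF_{k+1} = u_k ω + u_{k+1} dH`. Along a leaf of `dH + ε ω = 0` the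
differentials of the terms of `H + ε F_1 + ⋯ + ε^K F_K` telescope, so this function is constant along
the leaf up to `O(ε^(K+1))` (`leaf_estimate`). Comparing the coefficients of `ε^K` at the two ends of
the leaf gives `H_y(0, p) M_K = -F_K` as soon as `M_1, …, M_{K-1}` vanish (`first_coefficient_eq`,
`melnikov_eq`). To make sense of the leaf as a moving point on paths in level curves, the analytic
family of leafwise paths is re-parametrized by the value of `H` (`exists_levelChart`). The resulting
closed paths depend on `ε`, but the integrals over them do not (`IsLevelChart.period_eq`).

*All functions are combinations of iterated integrals.* The functions `u_k`, `F_k` are linear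
combinations of `p^a q^b x^c y^e ∫ w` (`combSpace`), where `∫ w` is the iterated integral of the word
`w` in the basic forms, and `q` is the reciprocal of `D(H(0, p)) H_y(0, p)` for a certain polynomial
`D`. This class is closed under both operations.

* Integration (`exists_primitive_of_mem`) rests on Petrov's division
  `θ = ∑ p_i(H) ω_i + f dH + dg`: the `ω_i` produce longer words, and `dg` is integrated by parts.
* Differentiation with respect to the level (`exists_derivative_of_primitive`) rests on an identity
  `D(H) = a H_x + b H_y`, which expresses the area form as `D(H)⁻¹ dH ∧ (a dy - b dx)`; the derivative
  of an integral is then again an integral along the level curve.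

On a closed path starting and ending at `(0, p)`, the function `F_K` becomes a combination of integrals
of nonempty words with coefficients that are rational in `p`, with denominator a power of
`D(H(0, p)) H_y(0, p)`. Since `D(0) ≠ 0` and `{H = 0}` is transversal to `x = 0`, there are no poles
near the initial point of the cycle.

*The degrees.* Petrov's division is needed without loss of degree
(`PetrovSplitting.exists_division`). Applying the exterior derivative, it says that the polynomials of
degree less than `m` are sums of the `d(p_i(H) ω_i)` and of Poisson brackets `{f, H}` of degree less
than `m`. By the independence half of the Petrov basis property the two spaces intersect trivially,
and a count of dimensions shows that they fill everything; the count uses that the kernel of the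
bracket is `ℝ[H]`, which holds because `H_x` and `H_y` have no common factor
(`PetrovSplitting.isRelPrime`). The same kind of count shows that the `n ^ 2` monomials `x^i y^j`,
`i, j < n`, are a basis of the Milnor algebra, with control of degrees. The polynomial `D` is the
characteristic polynomial of the multiplication by `H` in the Milnor algebra, and `D(0) ≠ 0` since
`{H = 0}` is smooth (`PetrovSplitting.exists_discriminant`). Each of the `K` steps raises the degrees
by at most `d + O(n^3 k^2)`, and clearing the denominators, of degree `O(n^3)`, gives
`2^(C K) d n^6` (`degree_estimate`).
-/

noncomputable section

namespace Melnikov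

open MvPolynomial

/-! ### Descent of the hypotheses from complex to real coefficients -/

theorem exists_real_imag_mv {σ : Type*} (p : MvPolynomial σ ℂ) :
    ∃ a b : MvPolynomial σ ℝ,
      p = map (algebraMap ℝ ℂ) a + C Complex.I * map (algebraMap ℝ ℂ) b := by
  induction p using MvPolynomial.induction_on with
  | C c =>
    refine ⟨C c.re, C c.im, ?_⟩
    rw [map_C, map_C, ← C_mul, ← C_add]
    congr 1
    simpa [mul_comm] using (Complex.re_add_im c).symm
  | add p q hp hq =>
    obtain ⟨a, b, rfl⟩ := hp
    obtain ⟨a', b', rfl⟩ := hq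
    exact ⟨a + a', b + b', by simp only [map_add]; ring⟩
  | mul_X p i hp =>
    obtain ⟨a, b, rfl⟩ := hp
    exact ⟨a * X i, b * X i, by simp only [map_mul, map_X]; ring⟩

theorem exists_real_imag_poly (p : Polynomial ℂ) :
    ∃ a b : Polynomial ℝ, p = a.map (algebraMap ℝ ℂ) +
      Polynomial.C Complex.I * b.map (algebraMap ℝ ℂ) := by
  induction p using Polynomial.induction_on' with
  | add p q hp hq =>
    obtain ⟨a, b, rfl⟩ := hp
    obtain ⟨a', b', rfl⟩ := hq
    exact ⟨a + a', b + b', by simp only [Polynomial.map_add]; ring⟩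
  | monomial n c =>
    refine ⟨Polynomial.monomial n c.re, Polynomial.monomial n c.im, ?_⟩
    rw [Polynomial.map_monomial, Polynomial.map_monomial, Polynomial.C_mul_monomial,
      ← map_add]
    congr 1
    simpa [mul_comm] using (Complex.re_add_im c).symm

theorem real_part_unique {σ : Type*} {a b a' b' : MvPolynomial σ ℝ}
    (h : map (algebraMap ℝ ℂ) a + C Complex.I * map (algebraMap ℝ ℂ) b =
      map (algebraMap ℝ ℂ) a' + C Complex.I * map (algebraMap ℝ ℂ) b') : a = a' := by
  ext m
  have := congrArg (fun p => (coeff m p).re) h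
  simpa [coeff_C_mul, coeff_map] using this

theorem aeval_map_complex (H : BiPoly ℝ) (a : Polynomial ℝ) :
    Polynomial.aeval (map (algebraMap ℝ ℂ) H) (a.map (algebraMap ℝ ℂ)) =
      map (algebraMap ℝ ℂ) (Polynomial.aeval H a) := by
  rw [Polynomial.aeval_map_algebraMap]
  induction a using Polynomial.induction_on' with
  | add p q hp hq => simp only [map_add, hp, hq]
  | monomial n c =>
    simp only [Polynomial.aeval_monomial, map_mul, map_pow]
    congr 1
    rw [MvPolynomial.algebraMap_eq, map_C]
    rfl

/-- The polynomial combination `∑ p_w(H) ω_w` of the basic forms. -/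
def basicComb {k : Type*} [CommRing k] {n : ℕ} (H : BiPoly k)
    (p : Fin n × Fin n → Polynomial k) : BiPoly k :=
  ∑ w, Polynomial.aeval H (p w) * (X 0 ^ (w.1 : ℕ) * X 1 ^ ((w.2 : ℕ) + 1))

theorem petrovClass_basicComb {k : Type*} [CommRing k] {n : ℕ} (H : BiPoly k)
    (p : Fin n × Fin n → Polynomial k) :
    ∑ w, p w • petrovClass H (basicForm k w) = petrovClass H (basicComb H p, 0) := by
  have h : ∀ w, p w • petrovClass H (basicForm k w) =
      petrovClass H (Polynomial.aeval H (p w) * (X 0 ^ (w.1 : ℕ) * X 1 ^ ((w.2 : ℕ) + 1)), 0) := by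
    intro w
    unfold petrovClass
    rw [← Submodule.Quotient.mk_smul, ← Module.AEval.of_aeval_smul]
    congr 2
    ext1 <;> simp [basicForm]
  rw [Finset.sum_congr rfl fun w _ => h w]
  unfold petrovClass basicComb
  rw [← Submodule.mkQ_apply]
  simp_rw [← Submodule.mkQ_apply]
  rw [← map_sum, ← map_sum]
  congr 2
  ext1 <;> simp [Prod.fst_sum, Prod.snd_sum]

theorem petrovClass_eq_iff {k : Type*} [CommRing k] (H : BiPoly k) (θ θ' : OneForm k) :
    petrovClass H θ = petrovClass H θ' ↔ θ - θ' ∈ relExact H := by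
  unfold petrovClass
  rw [Submodule.Quotient.eq, ← map_sub, Module.AEval.mem_mapSubmodule_apply]
  simp

/-- The two halves of the Petrov basis property, in terms of polynomial identities. -/
structure PetrovSplitting {k : Type*} [CommRing k] (n : ℕ) (H : BiPoly k) : Prop where
  indep : ∀ p : Fin n × Fin n → Polynomial k,
    (∃ f g : BiPoly k, (basicComb H p, (0 : BiPoly k)) = f • extD k H + extD k g) → p = 0
  span : ∀ θ : OneForm k, ∃ (p : Fin n × Fin n → Polynomial k) (f g : BiPoly k),
    θ = (basicComb H p, 0) + f • extD k H + extD k g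

theorem IsPetrovBasis.splitting {k : Type*} [CommRing k] {n : ℕ} {H : BiPoly k}
    (h : IsPetrovBasis n H) : PetrovSplitting n H := by
  obtain ⟨h1, h2⟩ := h
  constructor
  · rintro p ⟨f, g, hfg⟩
    have h0 : ∑ w, p w • petrovClass H (basicForm k w) = 0 := by
      rw [petrovClass_basicComb]
      have : (0 : PetrovModule H) = petrovClass H 0 := by simp [petrovClass]
      rw [this, petrovClass_eq_iff, sub_zero, mem_relExact]
      exact ⟨f, g, hfg.symm⟩
    funext w
    exact Fintype.linearIndependent_iff.1 h1 p h0 w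
  · intro θ
    have : petrovClass H θ ∈ (⊤ : Submodule (Polynomial k) (PetrovModule H)) := trivial
    rw [← h2, Submodule.mem_span_range_iff_exists_fun] at this
    obtain ⟨p, hp⟩ := this
    rw [petrovClass_basicComb, eq_comm, petrovClass_eq_iff, mem_relExact] at hp
    obtain ⟨f, g, hfg⟩ := hp
    exact ⟨p, f, g, by rw [add_assoc, hfg]; abel⟩

theorem map_basicComb {n : ℕ} (H : BiPoly ℝ) (p : Fin n × Fin n → Polynomial ℝ) :
    map (algebraMap ℝ ℂ) (basicComb H p) =
      basicComb (map (algebraMap ℝ ℂ) H) fun w => (p w).map (algebraMap ℝ ℂ) := by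
  simp only [basicComb, map_sum, map_mul, map_pow, map_X, aeval_map_complex]

theorem PetrovSplitting.descend {n : ℕ} {H : BiPoly ℝ}
    (h : PetrovSplitting n (map (algebraMap ℝ ℂ) H)) : PetrovSplitting n H := by
  constructor
  · rintro p ⟨f, g, hfg⟩
    have := h.indep (fun w => (p w).map (algebraMap ℝ ℂ))
      ⟨map (algebraMap ℝ ℂ) f, map (algebraMap ℝ ℂ) g, by
        rw [← map_basicComb]
        have h1 := congrArg (fun θ : OneForm ℝ => map (algebraMap ℝ ℂ) θ.1) hfg
        have h2 := congrArg (fun θ : OneForm ℝ => map (algebraMap ℝ ℂ) θ.2) hfg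
        ext1
        · simpa [extD, pderiv_map] using h1
        · simpa [extD, pderiv_map] using h2⟩
    funext w
    have hw := congrFun this w
    simpa [Polynomial.map_eq_zero] using hw
  · intro θ
    obtain ⟨p, f, g, hp⟩ := h.span (map (algebraMap ℝ ℂ) θ.1, map (algebraMap ℝ ℂ) θ.2)
    choose a b hab using fun w => exists_real_imag_poly (p w)
    obtain ⟨f₁, f₂, rfl⟩ := exists_real_imag_mv f
    obtain ⟨g₁, g₂, rfl⟩ := exists_real_imag_mv g
    have hsum : basicComb (map (algebraMap ℝ ℂ) H) p = map (algebraMap ℝ ℂ) (basicComb H a) +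
        C Complex.I * map (algebraMap ℝ ℂ) (basicComb H b) := by
      rw [map_basicComb, map_basicComb]
      simp only [basicComb, Finset.mul_sum, ← Finset.sum_add_distrib]
      refine Finset.sum_congr rfl fun w _ => ?_
      rw [hab w, map_add, map_mul, Polynomial.aeval_C]
      simp only [MvPolynomial.algebraMap_eq]
      ring
    rw [hsum] at hp
    refine ⟨a, f₁, g₁, ?_⟩
    have h1 := congrArg Prod.fst hp
    have h2 := congrArg Prod.snd hp
    ext1
    · refine real_part_unique (b := 0) (b' := basicComb H b + f₂ * pderiv 0 H + pderiv 0 g₂) ?_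
      simp [extD, ← pderiv_map] at h1 ⊢
      rw [h1]; ring
    · refine real_part_unique (b := 0) (b' := f₂ * pderiv 1 H + pderiv 1 g₂) ?_
      simp [extD, ← pderiv_map] at h2 ⊢
      rw [h2]; ring

/-- By the Nullstellensatz, a smooth affine curve has no common zeros of `H`, `H_x`, `H_y`, which
gives a Bézout identity; its real part is a Bézout identity over `ℝ`. -/
theorem IsSmoothCurve.exists_bezout {H : BiPoly ℝ}
    (h : IsSmoothCurve (map (algebraMap ℝ ℂ) H)) :
    ∃ u a b : BiPoly ℝ, u * H + a * pderiv 0 H + b * pderiv 1 H = 1 := by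
  set Hc := map (algebraMap ℝ ℂ) H with hHc
  have htop : Ideal.span {Hc, pderiv 0 Hc, pderiv 1 Hc} = ⊤ := by
    by_contra hne
    obtain ⟨M, hM, hle⟩ := Ideal.exists_le_maximal _ hne
    obtain ⟨q, rfl⟩ := (isMaximal_iff_eq_vanishingIdeal_singleton (K := ℂ)).1 hM
    have hmem : ∀ f ∈ ({Hc, pderiv 0 Hc, pderiv 1 Hc} : Set (BiPoly ℂ)), eval q f = 0 := by
      intro f hf
      simpa [aeval_eq_eval] using hle (Ideal.subset_span hf)
    rcases h q (hmem _ (by simp)) with h0 | h0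
    · exact h0 (hmem _ (by simp))
    · exact h0 (hmem _ (by simp))
  have h1 : (1 : BiPoly ℂ) ∈ Ideal.span {Hc, pderiv 0 Hc, pderiv 1 Hc} := htop ▸ trivial
  obtain ⟨u, z, hz, h1⟩ := Ideal.mem_span_insert.1 h1
  obtain ⟨a, b, rfl⟩ := Ideal.mem_span_pair.1 hz
  obtain ⟨u, u', rfl⟩ := exists_real_imag_mv u
  obtain ⟨a, a', rfl⟩ := exists_real_imag_mv a
  obtain ⟨b, b', rfl⟩ := exists_real_imag_mv b
  refine ⟨u, a, b, ?_⟩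
  refine real_part_unique (b' := 0) (b := u' * H + a' * pderiv 0 H + b' * pderiv 1 H) ?_
  simp [← pderiv_map, ← hHc]
  rw [h1]; ring

/-! ### Bivariate polynomials of bounded degree -/

/-- Real bivariate polynomials all of whose monomials have total degree less than `m`. Using a strict
bound makes `degLT 0` the zero space, so that truncated subtraction gives the right spaces. -/
def degLT (m : ℕ) : Submodule ℝ (BiPoly ℝ) := restrictSupport ℝ {s | s 0 + s 1 < m}

theorem finsupp_sum_fin_two (s : Fin 2 →₀ ℕ) : (s.sum fun _ e => e) = s 0 + s 1 := by
  rw [Finsupp.sum_fintype _ _ fun _ => rfl, Fin.sum_univ_two]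

theorem mem_degLT_support {m : ℕ} {f : BiPoly ℝ} :
    f ∈ degLT m ↔ ∀ s ∈ f.support, s 0 + s 1 < m := Iff.rfl

theorem mem_degLT {m : ℕ} {f : BiPoly ℝ} : f ∈ degLT m ↔ f = 0 ∨ f.totalDegree < m := by
  rw [mem_degLT_support]
  rcases eq_or_ne f 0 with rfl | hf
  · simp
  · rw [or_iff_right hf, totalDegree]
    have hpos : f.support.Nonempty := support_nonempty.2 hf
    constructor
    · intro h
      obtain ⟨s, hs, hs'⟩ := Finset.exists_mem_eq_sup f.support hpos fun s => s.sum fun _ e => e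
      rw [hs', finsupp_sum_fin_two]
      exact h s hs
    · intro h s hs
      rw [← finsupp_sum_fin_two]
      exact (Finset.le_sup (f := fun s : Fin 2 →₀ ℕ => s.sum fun _ e => e) hs).trans_lt h

theorem mem_degLT_succ {m : ℕ} {f : BiPoly ℝ} : f ∈ degLT (m + 1) ↔ f.totalDegree ≤ m := by
  rw [mem_degLT, Nat.lt_succ_iff]
  constructor
  · rintro (rfl | h)
    · simp
    · exact h
  · exact Or.inr

@[simp] theorem mem_degLT_zero {f : BiPoly ℝ} : f ∈ degLT 0 ↔ f = 0 := by
  simp [mem_degLT]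

theorem degLT_mono {a b : ℕ} (h : a ≤ b) : degLT a ≤ degLT b := by
  intro f hf
  rw [mem_degLT_support] at hf ⊢
  exact fun s hs => (hf s hs).trans_le h

theorem exists_mem_degLT (f : BiPoly ℝ) : ∃ m, f ∈ degLT m :=
  ⟨f.totalDegree + 1, mem_degLT_succ.2 le_rfl⟩

theorem mul_mem_degLT {a b : ℕ} {f g : BiPoly ℝ} (hf : f ∈ degLT a) (hg : g.totalDegree ≤ b) :
    f * g ∈ degLT (a + b) := by
  rcases mem_degLT.1 hf with rfl | hf
  · simp
  · exact mem_degLT.2 (Or.inr ((totalDegree_mul f g).trans_lt (by omega)))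

theorem mul_mem_degLT' {a b : ℕ} {f g : BiPoly ℝ} (hf : f.totalDegree ≤ a) (hg : g ∈ degLT b) :
    f * g ∈ degLT (a + b) := by
  rw [mul_comm, add_comm]
  exact mul_mem_degLT hg hf

theorem pderiv_mem_degLT {m : ℕ} {f : BiPoly ℝ} (i : Fin 2) (hf : f ∈ degLT m) :
    pderiv i f ∈ degLT (m - 1) := by
  rw [mem_degLT_support] at hf ⊢
  intro s hs
  rw [mem_support_iff, coeff_pderiv] at hs
  have h := hf (s + Finsupp.single i 1) (mem_support_iff.2 (left_ne_zero_of_mul hs))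
  fin_cases i <;> simp at h <;> omega

theorem totalDegree_pderiv_le (i : Fin 2) (f : BiPoly ℝ) :
    (pderiv i f).totalDegree ≤ f.totalDegree - 1 := by
  have h := pderiv_mem_degLT i (mem_degLT_succ.2 (le_refl f.totalDegree))
  rcases mem_degLT.1 h with h | h
  · simp [h]
  · omega

theorem totalDegree_pderiv_lt {i : Fin 2} {f : BiPoly ℝ} (h : pderiv i f ≠ 0) :
    (pderiv i f).totalDegree < f.totalDegree := by
  have h' := pderiv_mem_degLT i (mem_degLT_succ.2 (le_refl f.totalDegree))
  rcases mem_degLT.1 h' with h' | h'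
  · exact absurd h' h
  · omega

theorem eq_C_of_pderiv_eq_zero {f : BiPoly ℝ} (h0 : pderiv 0 f = 0) (h1 : pderiv 1 f = 0) :
    f = C (coeff 0 f) := by
  have key : ∀ (i : Fin 2), pderiv i f = 0 → ∀ s : Fin 2 →₀ ℕ, s i ≠ 0 → coeff s f = 0 := by
    intro i hi s hs
    have h := coeff_pderiv (i := i) f (s - Finsupp.single i 1)
    have e : s - Finsupp.single i 1 + Finsupp.single i 1 = s :=
      tsub_add_cancel_of_le (by simpa [Nat.one_le_iff_ne_zero] using hs)
    rw [hi, coeff_zero, e] at h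
    refine (mul_eq_zero.1 h.symm).resolve_right ?_
    positivity
  ext s
  rw [coeff_C]
  split_ifs with hs
  · rw [← hs]
  · have : s 0 ≠ 0 ∨ s 1 ≠ 0 := by
      by_contra! hc
      apply hs
      ext i
      fin_cases i
      · exact hc.1.symm
      · exact hc.2.symm
    rcases this with h | h
    · exact key 0 h0 s h
    · exact key 1 h1 s h

theorem pderiv_comm (i j : Fin 2) (f : BiPoly ℝ) :
    pderiv i (pderiv j f) = pderiv j (pderiv i f) := by
  ext s
  simp only [coeff_pderiv, add_right_comm s]
  rcases eq_or_ne i j with rfl | h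
  · rfl
  · simp [h, h.symm]
    ring

/-! ### Antiderivatives and the Poincaré lemma -/

/-- The antiderivative in the `i`-th variable without terms constant in that variable. -/
def antideriv (i : Fin 2) : BiPoly ℝ →ₗ[ℝ] BiPoly ℝ :=
  (basisMonomials (Fin 2) ℝ).constr ℝ fun s =>
    monomial (s + Finsupp.single i 1) ((s i + 1 : ℝ)⁻¹)

theorem antideriv_monomial (i : Fin 2) (s : Fin 2 →₀ ℕ) :
    antideriv i (monomial s 1) = monomial (s + Finsupp.single i 1) ((s i + 1 : ℝ)⁻¹) := by
  have := (basisMonomials (Fin 2) ℝ).constr_basis ℝ (fun s =>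
    (monomial (s + Finsupp.single i 1) ((s i + 1 : ℝ)⁻¹) : BiPoly ℝ)) s
  simpa [antideriv] using this

theorem pderiv_antideriv (i : Fin 2) (f : BiPoly ℝ) : pderiv i (antideriv i f) = f := by
  have : (pderiv i).toLinearMap ∘ₗ antideriv i = LinearMap.id := by
    refine (basisMonomials (Fin 2) ℝ).ext fun s => ?_
    simp only [coe_basisMonomials, LinearMap.comp_apply, antideriv_monomial]
    simp only [Derivation.coeFn_coe, LinearMap.id_apply]
    rw [pderiv_monomial]
    simp
    congr 1
    have : (s i + 1 : ℝ) ≠ 0 := by positivity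
    field_simp
  exact LinearMap.congr_fun this f

theorem pderiv_antideriv_comm {i j : Fin 2} (h : i ≠ j) (f : BiPoly ℝ) :
    pderiv j (antideriv i f) = antideriv i (pderiv j f) := by
  have : (pderiv j).toLinearMap ∘ₗ antideriv i = antideriv i ∘ₗ (pderiv j).toLinearMap := by
    refine (basisMonomials (Fin 2) ℝ).ext fun s => ?_
    simp only [coe_basisMonomials, LinearMap.comp_apply, antideriv_monomial]
    simp only [Derivation.coeFn_coe]
    rw [pderiv_monomial, pderiv_monomial]
    have e : (monomial (s - Finsupp.single j 1) (1 * (s j : ℝ)) : BiPoly ℝ) =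
        (s j : ℝ) • monomial (s - Finsupp.single j 1) 1 := by
      rw [smul_monomial, smul_eq_mul, mul_comm]
    have e2 : (s + Finsupp.single i 1 : Fin 2 →₀ ℕ) j = s j := by simp [h]
    have e3 : (s - Finsupp.single j 1 : Fin 2 →₀ ℕ) i = s i := by simp [h.symm]
    rw [e, map_smul, antideriv_monomial, smul_monomial, e2, e3, smul_eq_mul, mul_comm]
    rcases Nat.eq_zero_or_pos (s j) with hs | hs
    · rw [hs, Nat.cast_zero, zero_mul, monomial_zero, monomial_zero]
    · have e1 : s + Finsupp.single i 1 - Finsupp.single j 1 =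
          s - Finsupp.single j 1 + Finsupp.single i 1 := by
        ext k
        rw [Finsupp.tsub_apply, Finsupp.add_apply, Finsupp.add_apply, Finsupp.tsub_apply]
        rcases eq_or_ne k j with rfl | hk
        · rw [Finsupp.single_eq_same]
          omega
        · rw [Finsupp.single_eq_of_ne hk]
          omega
      rw [e1]
  exact LinearMap.congr_fun this f

theorem antideriv_mem_degLT (i : Fin 2) {m : ℕ} {f : BiPoly ℝ} (hf : f ∈ degLT m) :
    antideriv i f ∈ degLT (m + 1) := by
  have : degLT m ≤ (degLT (m + 1)).comap (antideriv i) := by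
    rw [degLT, restrictSupport_eq_span, Submodule.span_le]
    rintro _ ⟨s, hs, rfl⟩
    simp only [SetLike.mem_coe, Submodule.mem_comap, antideriv_monomial]
    refine (monomial_mem_restrictSupport ℝ).2 (Or.inl ?_)
    simp only [Set.mem_ofPred_eq] at hs ⊢
    fin_cases i <;> simp <;> omega
  exact this hf

/-- The coefficient `Q_x - P_y` of the exterior derivative of `P dx + Q dy`. -/
def curl (θ : OneForm ℝ) : BiPoly ℝ := pderiv 0 θ.2 - pderiv 1 θ.1

/-- Closed polynomial one-forms are exact, with the expected degree of the primitive. -/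
theorem exists_primitive {m : ℕ} {P Q : BiPoly ℝ} (hP : P ∈ degLT m) (hQ : Q ∈ degLT m)
    (h : pderiv 0 Q = pderiv 1 P) :
    ∃ g ∈ degLT (m + 1), pderiv 0 g = P ∧ pderiv 1 g = Q := by
  have h01 : (0 : Fin 2) ≠ 1 := by decide
  refine ⟨antideriv 0 P + antideriv 1 (Q - pderiv 1 (antideriv 0 P)),
    add_mem (antideriv_mem_degLT 0 hP) (antideriv_mem_degLT 1 (sub_mem hQ ?_)), ?_, ?_⟩
  · exact pderiv_mem_degLT 1 (antideriv_mem_degLT 0 hP)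
  · rw [map_add, pderiv_antideriv, pderiv_antideriv_comm h01.symm, map_sub, pderiv_comm 0 1,
      pderiv_antideriv, h, sub_self, map_zero, add_zero]
  · rw [map_add, pderiv_antideriv]
    ring

/-! ### The kernel of the Poisson bracket with `H` -/

theorem aeval_ne_zero_and_totalDegree {n : ℕ} {H : BiPoly ℝ} (hH : H.totalDegree = n + 1) :
    ∀ (N : ℕ) (q : Polynomial ℝ), q.natDegree = N → q ≠ 0 →
      Polynomial.aeval H q ≠ 0 ∧ (Polynomial.aeval H q).totalDegree = N * (n + 1) := by
  have hH0 : H ≠ 0 := by rintro rfl; simp at hH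
  intro N
  induction N with
  | zero =>
    intro q hq hq0
    obtain ⟨c, rfl⟩ : ∃ c, q = Polynomial.C c := ⟨_, Polynomial.eq_C_of_natDegree_eq_zero hq⟩
    have hc : c ≠ 0 := by rintro rfl; simp at hq0
    rw [Polynomial.aeval_C, MvPolynomial.algebraMap_eq]
    simpa using hc
  | succ N ih =>
    intro q hq _
    have hd : q.divX.natDegree = N := by rw [Polynomial.natDegree_divX_eq_natDegree_tsub_one]; omega
    have hd0 : q.divX ≠ 0 := by
      intro h
      rw [Polynomial.divX_eq_zero_iff] at h
      rw [h, Polynomial.natDegree_C] at hq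
      omega
    obtain ⟨h1, h2⟩ := ih q.divX hd hd0
    have e : Polynomial.aeval H q = Polynomial.aeval H q.divX * H + C (q.coeff 0) := by
      conv_lhs => rw [← Polynomial.divX_mul_X_add q]
      rw [map_add, map_mul, Polynomial.aeval_X, Polynomial.aeval_C, MvPolynomial.algebraMap_eq]
    have h3 : (Polynomial.aeval H q.divX * H).totalDegree = (N + 1) * (n + 1) := by
      rw [totalDegree_mul_of_isDomain h1 hH0, h2, hH]; ring
    have h4 : (Polynomial.aeval H q).totalDegree = (N + 1) * (n + 1) := by
      rw [e, totalDegree_add_eq_left_of_totalDegree_lt, h3]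
      rw [h3, totalDegree_C]
      positivity
    refine ⟨fun h => ?_, h4⟩
    rw [h, totalDegree_zero] at h4
    have : 0 < (N + 1) * (n + 1) := by positivity
    omega

theorem aeval_injective {n : ℕ} {H : BiPoly ℝ} (hH : H.totalDegree = n + 1) {q : Polynomial ℝ}
    (h : Polynomial.aeval H q = 0) : q = 0 := by
  by_contra hq
  exact (aeval_ne_zero_and_totalDegree hH _ q rfl hq).1 h

theorem totalDegree_aeval {n : ℕ} {H : BiPoly ℝ} (hH : H.totalDegree = n + 1) (q : Polynomial ℝ) :
    (Polynomial.aeval H q).totalDegree = q.natDegree * (n + 1) := by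
  rcases eq_or_ne q 0 with rfl | hq
  · simp
  · exact (aeval_ne_zero_and_totalDegree hH _ q rfl hq).2

theorem pderiv_aeval (i : Fin 2) (H : BiPoly ℝ) (q : Polynomial ℝ) :
    pderiv i (Polynomial.aeval H q) = Polynomial.aeval H q.derivative * pderiv i H := by
  rw [Derivation.map_aeval, smul_eq_mul]

theorem exists_derivative_eq (q : Polynomial ℝ) : ∃ r : Polynomial ℝ, r.derivative = q := by
  induction q using Polynomial.induction_on' with
  | add p q hp hq =>
    obtain ⟨a, rfl⟩ := hp
    obtain ⟨b, rfl⟩ := hq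
    exact ⟨a + b, by simp⟩
  | monomial k c =>
    refine ⟨Polynomial.monomial (k + 1) (c / (k + 1)), ?_⟩
    rw [Polynomial.derivative_monomial]
    simp
    have : (k + 1 : ℝ) ≠ 0 := by positivity
    congr 1
    field_simp

theorem pderiv_ne_zero {n : ℕ} {H : BiPoly ℝ} (hH : H.totalDegree = n + 1) :
    ¬(pderiv 0 H = 0 ∧ pderiv 1 H = 0) := by
  rintro ⟨h0, h1⟩
  rw [eq_C_of_pderiv_eq_zero h0 h1, totalDegree_C] at hH
  omega

/-- If `df` is proportional to `dH` and the partial derivatives of `H` have no common factor, the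
factor of proportionality is a polynomial. -/
theorem exists_factor_of_jacobian_eq_zero {n : ℕ} {H : BiPoly ℝ} (hH : H.totalDegree = n + 1)
    (hco : IsRelPrime (pderiv 0 H) (pderiv 1 H)) {f : BiPoly ℝ}
    (hf : pderiv 0 H * pderiv 1 f = pderiv 1 H * pderiv 0 f) :
    ∃ φ, pderiv 0 f = φ * pderiv 0 H ∧ pderiv 1 f = φ * pderiv 1 H := by
  by_cases h0 : pderiv 0 H = 0
  · have h1 : pderiv 1 H ≠ 0 := fun h1 => pderiv_ne_zero hH ⟨h0, h1⟩
    obtain ⟨φ, hφ⟩ := hco.symm.dvd_of_dvd_mul_left (Dvd.intro _ hf.symm)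
    refine ⟨φ, mul_left_cancel₀ h1 ?_, by rw [hφ]; ring⟩
    rw [← hf, hφ]; ring
  · obtain ⟨φ, hφ⟩ := hco.dvd_of_dvd_mul_left (Dvd.intro _ hf)
    refine ⟨φ, by rw [hφ]; ring, mul_left_cancel₀ h0 ?_⟩
    rw [hf, hφ]; ring

/-- A polynomial `f` with `df ∧ dH = 0` is a polynomial in `H`, if the partial derivatives of `H`
have no common factor: then `df = φ dH`, the factor `φ` has smaller degree than `f`, and
`dφ ∧ dH = 0`, so induction applies to `φ`. -/
theorem exists_aeval_of_jacobian_eq_zero {n : ℕ} {H : BiPoly ℝ} (hH : H.totalDegree = n + 1)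
    (hco : IsRelPrime (pderiv 0 H) (pderiv 1 H)) (f : BiPoly ℝ)
    (hf : pderiv 0 H * pderiv 1 f = pderiv 1 H * pderiv 0 f) :
    ∃ q : Polynomial ℝ, f = Polynomial.aeval H q := by
  induction hN : f.totalDegree using Nat.strong_induction_on generalizing f with
  | _ N ih =>
    subst hN
    obtain ⟨φ, h0, h1⟩ := exists_factor_of_jacobian_eq_zero hH hco hf
    have hlift : ∀ q : Polynomial ℝ, φ = Polynomial.aeval H q →
        ∃ q : Polynomial ℝ, f = Polynomial.aeval H q := by
      rintro q rfl
      obtain ⟨r, rfl⟩ := exists_derivative_eq q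
      have hc := eq_C_of_pderiv_eq_zero (f := f - Polynomial.aeval H r)
        (by rw [map_sub, pderiv_aeval, h0, sub_self]) (by rw [map_sub, pderiv_aeval, h1, sub_self])
      refine ⟨r + Polynomial.C (coeff 0 (f - Polynomial.aeval H r)), ?_⟩
      rw [map_add, Polynomial.aeval_C, MvPolynomial.algebraMap_eq, ← hc]
      ring
    by_cases hφ : φ = 0
    · exact hlift 0 (by simpa using hφ)
    · have hdeg : φ.totalDegree < f.totalDegree := by
        have aux : ∀ i, pderiv i f = φ * pderiv i H → pderiv i H ≠ 0 →
            φ.totalDegree < f.totalDegree := by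
          intro i hi hne
          have hfi : pderiv i f ≠ 0 := hi ▸ mul_ne_zero hφ hne
          have := totalDegree_pderiv_lt hfi
          rw [hi, totalDegree_mul_of_isDomain hφ hne] at this
          omega
        by_cases hx : pderiv 0 H = 0
        · exact aux 1 h1 fun hy => pderiv_ne_zero hH ⟨hx, hy⟩
        · exact aux 0 h0 hx
      obtain ⟨q, hq⟩ := ih _ hdeg φ (by
        have h2 := pderiv_comm 0 1 f
        rw [h0, h1, pderiv_mul, pderiv_mul, pderiv_comm 0 1] at h2
        linear_combination -h2) rfl
      exact hlift q hq

/-! ### The partial derivatives of `H` have no common factor -/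

theorem curl_basicComb {n : ℕ} (H : BiPoly ℝ) (p : Fin n × Fin n → Polynomial ℝ) :
    curl (basicComb H p, 0) = -∑ w, (Polynomial.aeval H (p w) *
        (C ((w.2 : ℝ) + 1) * (X 0 ^ (w.1 : ℕ) * X 1 ^ (w.2 : ℕ))) +
      Polynomial.aeval H (p w).derivative * pderiv 1 H *
        (X 0 ^ (w.1 : ℕ) * X 1 ^ ((w.2 : ℕ) + 1))) := by
  simp only [curl, basicComb, map_zero, zero_sub, map_sum]
  congr 1
  refine Finset.sum_congr rfl fun w _ => ?_
  rw [pderiv_mul, pderiv_aeval, pderiv_mul, pderiv_pow, pderiv_pow, pderiv_X_self,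
    pderiv_X_of_ne (by decide : (0 : Fin 2) ≠ 1)]
  simp
  ring

theorem curl_smul_extD_add (H f g : BiPoly ℝ) :
    curl (f • extD ℝ H + extD ℝ g) = pderiv 0 f * pderiv 1 H - pderiv 1 f * pderiv 0 H := by
  simp only [curl, extD, Prod.snd_add, Prod.fst_add, Prod.smul_snd, Prod.smul_fst,
    LinearMap.prod_apply, Function.prod_apply, Derivation.coeFn_coe, smul_eq_mul, map_add,
    pderiv_mul]
  rw [pderiv_comm 0 1 H, pderiv_comm 0 1 g]
  ring

/-- Every polynomial is the curl of a combination of basic forms, up to a Poisson bracket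
with `H`. -/
theorem PetrovSplitting.exists_curl {n : ℕ} {H : BiPoly ℝ} (h : PetrovSplitting n H)
    (g : BiPoly ℝ) : ∃ (p : Fin n × Fin n → Polynomial ℝ) (f : BiPoly ℝ),
      g = curl (basicComb H p, 0) + (pderiv 0 f * pderiv 1 H - pderiv 1 f * pderiv 0 H) := by
  obtain ⟨p, f, g', hp⟩ := h.span (0, antideriv 0 g)
  refine ⟨p, f, ?_⟩
  have h1 : curl (0, antideriv 0 g) = g := by simp [curl, pderiv_antideriv]
  have hadd : ∀ θ θ' : OneForm ℝ, curl (θ + θ') = curl θ + curl θ' := by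
    intro θ θ'; simp [curl]; ring
  rw [← h1, hp, add_assoc, hadd, curl_smul_extD_add]

/-- A derivation `δ : ℝ[x, y] → B` into a domain, which vanishes on `ℝ[H]` and factors through
`π : ℝ[x, y] → B`, kills every element whose image in `B` is integral over `ℝ[π H]`: applied to a
monic relation `p(x) = 0` of minimal degree it gives `p'(x) δ x = 0` with `p'(x) ≠ 0`. -/
theorem eq_zero_of_isIntegralElem {B : Type*} [CommRing B] [IsDomain B] [Algebra ℝ B]
    (π : BiPoly ℝ →ₐ[ℝ] B) (δ : BiPoly ℝ → B) (hadd : ∀ a b, δ (a + b) = δ a + δ b)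
    (hmul : ∀ a b, δ (a * b) = π a * δ b + π b * δ a)
    (hker : ∀ a, π a = 0 → δ a = 0) {H : BiPoly ℝ}
    (hH : ∀ q : Polynomial ℝ, δ (Polynomial.aeval H q) = 0) (x : BiPoly ℝ)
    (hx : ((Polynomial.aeval (π H) : Polynomial ℝ →ₐ[ℝ] B) : Polynomial ℝ →+* B).IsIntegralElem
      (π x)) : δ x = 0 := by
  classical
  set φ : Polynomial ℝ →+* B := ((Polynomial.aeval (π H) : Polynomial ℝ →ₐ[ℝ] B) :
    Polynomial ℝ →+* B) with hφ
  set ψ : Polynomial ℝ →+* BiPoly ℝ := ((Polynomial.aeval H : Polynomial ℝ →ₐ[ℝ] BiPoly ℝ) :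
    Polynomial ℝ →+* BiPoly ℝ) with hψ
  have hπψ : ∀ q, π (ψ q) = φ q := by
    intro q
    simp only [hψ, hφ, RingHom.coe_coe]
    rw [← Polynomial.aeval_algHom_apply]
  have hπ : ∀ p : Polynomial (Polynomial ℝ), π (p.eval₂ ψ x) = p.eval₂ φ (π x) := by
    intro p
    have : (π : BiPoly ℝ →+* B).comp ψ = φ := RingHom.ext hπψ
    rw [← this]
    exact Polynomial.hom_eval₂ p ψ (π : BiPoly ℝ →+* B) x
  have hchain : ∀ p : Polynomial (Polynomial ℝ),
      δ (p.eval₂ ψ x) = p.derivative.eval₂ φ (π x) * δ x := by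
    intro p
    induction p using Polynomial.induction_on' with
    | add p q hp hq =>
      rw [Polynomial.eval₂_add, hadd, hp, hq, Polynomial.derivative_add, Polynomial.eval₂_add]
      ring
    | monomial k c =>
      have hpow : ∀ k : ℕ, δ (x ^ k) = k * π x ^ (k - 1) * δ x := by
        intro k
        induction k with
        | zero =>
          have := hmul 1 1
          simp only [mul_one, map_one, one_mul] at this
          have h1 : δ 1 = 0 := by linear_combination -this
          simp [h1]
        | succ k ih =>
          rw [pow_succ, hmul, ih]
          rcases k with _ | k
          · simp
          · simp only [Nat.add_sub_cancel, map_pow, Nat.cast_add, Nat.cast_one]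
            ring
      have hc : δ (ψ c) = 0 := hH c
      rw [Polynomial.eval₂_monomial, hmul, hc, hpow, Polynomial.derivative_monomial,
        Polynomial.eval₂_monomial, hπψ, map_mul, map_natCast]
      ring
  have hex : ∃ N, ∃ p : Polynomial (Polynomial ℝ), p.Monic ∧ p.eval₂ φ (π x) = 0 ∧
      p.natDegree = N := by
    obtain ⟨p, hp, hp0⟩ := hx
    exact ⟨_, p, hp, hp0, rfl⟩
  obtain ⟨p, hp, hp0, hpN⟩ := Nat.find_spec hex
  have hpos : 0 < p.natDegree := by
    rcases Nat.eq_zero_or_pos p.natDegree with h | h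
    · rw [hp.natDegree_eq_zero.1 h] at hp0
      simp at hp0
    · exact h
  have hder : p.derivative.eval₂ φ (π x) ≠ 0 := by
    -- otherwise the normalized derivative would be a relation of smaller degree
    intro h0
    set c : ℝ := ((p.natDegree : ℝ))⁻¹ with hc
    have hne : (p.natDegree : ℝ) ≠ 0 := by positivity
    have hdeg : p.derivative.natDegree = p.natDegree - 1 :=
      Polynomial.natDegree_eq_of_degree_eq_some (Polynomial.degree_derivative hpos.ne')
    refine Nat.find_min hex (m := p.natDegree - 1) (by omega)
      ⟨Polynomial.C (Polynomial.C c) * p.derivative, ?_, ?_, ?_⟩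
    · rw [Polynomial.Monic, Polynomial.leadingCoeff_mul, Polynomial.leadingCoeff_C,
        Polynomial.leadingCoeff, hdeg, Polynomial.coeff_derivative,
        Nat.sub_add_cancel hpos, hp.coeff_natDegree, one_mul, ← Nat.cast_succ,
        Nat.succ_eq_add_one, Nat.sub_add_cancel hpos, ← Polynomial.C_eq_natCast,
        ← Polynomial.C_mul, hc, inv_mul_cancel₀ hne, Polynomial.C_1]
    · rw [Polynomial.eval₂_mul, h0, mul_zero]
    · rw [Polynomial.natDegree_C_mul, hdeg]
      rw [Polynomial.C_ne_zero]
      exact inv_ne_zero hne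
  have h1 : δ (p.eval₂ ψ x) = 0 := hker _ (by rw [hπ, hp0])
  rw [hchain] at h1
  exact (mul_eq_zero.1 h1).resolve_left hder

/-- On a common component `v = 0` of `H_x = 0` and `H_y = 0`, the function `H` is a constant of the
Hamiltonian derivation of `v`. Since the coordinate ring of the component is finite over `ℝ[H]` by
the spanning half of the Petrov property, that derivation vanishes, which is absurd. -/
theorem PetrovSplitting.isRelPrime {n : ℕ} {H : BiPoly ℝ} (h : PetrovSplitting n H)
    (hH : H.totalDegree = n + 1) : IsRelPrime (pderiv 0 H) (pderiv 1 H) := by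
  refine WfDvdMonoid.isRelPrime_of_no_irreducible_factors (pderiv_ne_zero hH) ?_
  intro v hv hv0 hv1
  have hvp : Prime v := hv.prime
  set I : Ideal (BiPoly ℝ) := Ideal.span {v} with hI
  have : I.IsPrime := (Ideal.span_singleton_prime hvp.ne_zero).2 hvp
  set π : BiPoly ℝ →ₐ[ℝ] BiPoly ℝ ⧸ I := Ideal.Quotient.mkₐ ℝ I with hπ
  have hπ0 : ∀ a, π a = 0 ↔ v ∣ a := by
    intro a
    rw [hπ, Ideal.Quotient.mkₐ_eq_mk, Ideal.Quotient.eq_zero_iff_mem, hI,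
      Ideal.mem_span_singleton]
  have hint : ((Polynomial.aeval (π H) : Polynomial ℝ →ₐ[ℝ] BiPoly ℝ ⧸ I) :
      Polynomial ℝ →+* BiPoly ℝ ⧸ I).IsIntegral := by
    refine RingHom.IsIntegral.of_finite ?_
    let _ := ((Polynomial.aeval (π H) : Polynomial ℝ →ₐ[ℝ] BiPoly ℝ ⧸ I) :
      Polynomial ℝ →+* BiPoly ℝ ⧸ I).toAlgebra
    refine Module.Finite.of_surjective (M := Fin n × Fin n → Polynomial ℝ)
      (Fintype.linearCombination (Polynomial ℝ) fun w : Fin n × Fin n =>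
        π (-(C ((w.2 : ℝ) + 1) * (X 0 ^ (w.1 : ℕ) * X 1 ^ (w.2 : ℕ))))) ?_
    intro b
    obtain ⟨g, rfl⟩ := Ideal.Quotient.mkₐ_surjective ℝ I b
    obtain ⟨p, f, hpf⟩ := h.exists_curl g
    refine ⟨p, ?_⟩
    rw [Fintype.linearCombination_apply]
    have hs : ∀ w, p w • π (-(C ((w.2 : ℝ) + 1) * (X 0 ^ (w.1 : ℕ) * X 1 ^ (w.2 : ℕ)))) =
        π (-(Polynomial.aeval H (p w) *
          (C ((w.2 : ℝ) + 1) * (X 0 ^ (w.1 : ℕ) * X 1 ^ (w.2 : ℕ))))) := by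
      intro w
      rw [Algebra.smul_def, RingHom.algebraMap_toAlgebra, RingHom.coe_coe,
        Polynomial.aeval_algHom_apply, ← map_mul]
      congr 1
      ring
    rw [Finset.sum_congr rfl fun w _ => hs w, ← map_sum, ← sub_eq_zero]
    change π _ - π g = 0
    rw [← map_sub, hπ0, hpf, curl_basicComb, Finset.sum_neg_distrib, Finset.sum_add_distrib]
    obtain ⟨a, ha⟩ := hv0
    obtain ⟨b, hb⟩ := hv1
    have hsum : ∑ w : Fin n × Fin n, Polynomial.aeval H (p w).derivative * pderiv 1 H *
        (X 0 ^ (w.1 : ℕ) * X 1 ^ ((w.2 : ℕ) + 1)) =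
        pderiv 1 H * ∑ w : Fin n × Fin n, Polynomial.aeval H (p w).derivative *
        (X 0 ^ (w.1 : ℕ) * X 1 ^ ((w.2 : ℕ) + 1)) := by
      rw [Finset.mul_sum]
      exact Finset.sum_congr rfl fun w _ => by ring
    rw [hsum, ha, hb]
    refine ⟨b * (∑ w : Fin n × Fin n, Polynomial.aeval H (p w).derivative *
        (X 0 ^ (w.1 : ℕ) * X 1 ^ ((w.2 : ℕ) + 1))) - pderiv 0 f * b + pderiv 1 f * a, ?_⟩
    ring
  have key := eq_zero_of_isIntegralElem π
    (fun a => π (pderiv 1 v * pderiv 0 a - pderiv 0 v * pderiv 1 a))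
    (fun a b => by rw [← map_add]; congr 1; simp only [map_add]; ring)
    (fun a b => by
      rw [← map_mul, ← map_mul, ← map_add]; congr 1; simp only [pderiv_mul]; ring)
    (fun a ha => by
      obtain ⟨c, rfl⟩ := (hπ0 a).1 ha
      rw [hπ0]
      refine ⟨pderiv 1 v * pderiv 0 c - pderiv 0 v * pderiv 1 c, ?_⟩
      simp only [pderiv_mul]; ring)
    (H := H) (fun q => by
      rw [hπ0, pderiv_aeval, pderiv_aeval]
      obtain ⟨a, ha⟩ := hv0
      obtain ⟨b, hb⟩ := hv1
      rw [ha, hb]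
      exact ⟨Polynomial.aeval H q.derivative * (pderiv 1 v * a - pderiv 0 v * b), by ring⟩)
  have hsmall : ∀ i, v ∣ pderiv i v → pderiv i v = 0 := by
    intro i hi
    by_contra hne
    exact absurd (totalDegree_le_of_dvd_of_isDomain hi hne) (not_le.2 (totalDegree_pderiv_lt hne))
  have hy : pderiv 1 v = 0 := hsmall 1 <| (hπ0 _).1 <| by
    simpa [pderiv_X_of_ne] using key (X 0) (hint _)
  have hx : pderiv 0 v = 0 := hsmall 0 <| (hπ0 _).1 <| by
    simpa [pderiv_X_of_ne] using key (X 1) (hint _)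
  have hvC := eq_C_of_pderiv_eq_zero hx hy
  refine hv.not_isUnit ?_
  rw [hvC]
  refine (IsUnit.mk0 _ ?_).map C
  intro h0
  rw [h0, C_0] at hvC
  exact hvp.ne_zero hvC

/-! ### Dimension counts -/

theorem mul_mem_degLT_sub {m b : ℕ} {f g : BiPoly ℝ} (hf : f ∈ degLT (m - b))
    (hg : g.totalDegree ≤ b) : f * g ∈ degLT m := by
  rcases mem_degLT.1 hf with rfl | hf
  · simp
  · exact mem_degLT.2 (Or.inr ((totalDegree_mul f g).trans_lt (by omega)))

/-- Triangular numbers, the dimensions of the spaces `degLT m`. -/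
def tri (m : ℕ) : ℕ := ∑ i ∈ Finset.range m, (i + 1)

theorem tri_zero : tri 0 = 0 := rfl

theorem tri_succ (m : ℕ) : tri (m + 1) = tri m + (m + 1) := Finset.sum_range_succ _ _

theorem two_mul_tri (m : ℕ) : 2 * tri m = m * (m + 1) := by
  induction m with
  | zero => rfl
  | succ m ih => rw [tri_succ]; linarith

instance finite_degLT_index (m : ℕ) : Finite ({s | s 0 + s 1 < m} : Set (Fin 2 →₀ ℕ)) := by
  refine Finite.of_injective
    (fun s : ({s | s 0 + s 1 < m} : Set (Fin 2 →₀ ℕ)) =>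
      ((⟨s.1 0, by have := s.2; simp only [Set.mem_ofPred_eq] at this; omega⟩,
        ⟨s.1 1, by have := s.2; simp only [Set.mem_ofPred_eq] at this; omega⟩) : Fin m × Fin m)) ?_
  rintro ⟨s, hs⟩ ⟨t, ht⟩ h
  simp only [Prod.mk.injEq, Fin.mk.injEq] at h
  ext i
  fin_cases i
  · exact h.1
  · exact h.2

instance (m : ℕ) : Module.Finite ℝ (degLT m) :=
  Module.Finite.of_basis (basisRestrictSupport ℝ {s : Fin 2 →₀ ℕ | s 0 + s 1 < m})

theorem finrank_degLT (m : ℕ) : Module.finrank ℝ (degLT m) = tri m := by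
  have h1 : Module.finrank ℝ (degLT m) =
      Nat.card ({s | s 0 + s 1 < m} : Set (Fin 2 →₀ ℕ)) :=
    Module.finrank_eq_nat_card_basis (basisRestrictSupport ℝ {s : Fin 2 →₀ ℕ | s 0 + s 1 < m})
  let e : ({s | s 0 + s 1 < m} : Set (Fin 2 →₀ ℕ)) ≃ Σ k : Fin m, Fin ((k : ℕ) + 1) :=
    { toFun := fun s => ⟨⟨s.1 0 + s.1 1, s.2⟩, ⟨s.1 0, Nat.lt_succ_of_le (Nat.le_add_right _ _)⟩⟩
      invFun := fun x => ⟨Finsupp.equivFunOnFinite.symm ![(x.2 : ℕ), (x.1 : ℕ) - x.2], by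
        have := x.2.2; have := x.1.2
        simp only [Set.mem_ofPred_eq, Finsupp.equivFunOnFinite_symm_apply_apply,
          Matrix.cons_val_zero, Matrix.cons_val_one]
        omega⟩
      left_inv := by
        rintro ⟨s, hs⟩
        ext i
        fin_cases i <;> simp
      right_inv := by
        rintro ⟨⟨k, hk⟩, ⟨i, hi⟩⟩
        simp only at hi
        have : i + (k - i) = k := by omega
        refine Sigma.ext (Fin.ext ?_) ((Fin.heq_ext_iff ?_).2 ?_) <;> simp [this] }
  rw [h1, Nat.card_congr e, Nat.card_eq_fintype_card, Fintype.card_sigma]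
  simp only [Fintype.card_fin]
  exact Fin.sum_univ_eq_sum_range (fun i => i + 1) m

theorem sum_range_sub_succ (g : ℕ → ℕ) (n m : ℕ) :
    ∑ i ∈ Finset.range n, g (m + 1 - i) + g (m + 1 - n) =
      ∑ i ∈ Finset.range n, g (m - i) + g (m + 1) := by
  rw [← Finset.sum_range_succ (fun i => g (m + 1 - i)), Finset.sum_range_succ']
  simp

/-- Hermite's identity for the ceilings `⌈(u - j) / (n + 1)⌉`, `0 ≤ j < n`. -/
theorem sum_range_ceil (n u : ℕ) :
    ∑ j ∈ Finset.range n, (u - j + n) / (n + 1) + u / (n + 1) = u := by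
  have hlast : ∀ u, (u - n + n) / (n + 1) = u / (n + 1) := by
    intro u
    rcases le_total n u with h | h
    · rw [Nat.sub_add_cancel h]
    · rw [Nat.sub_eq_zero_of_le h, zero_add, Nat.div_eq_of_lt (by omega : n < n + 1),
        Nat.div_eq_of_lt (by omega : u < n + 1)]
  rw [← hlast u, ← Finset.sum_range_succ (fun j => (u - j + n) / (n + 1))]
  induction u with
  | zero =>
    refine Finset.sum_eq_zero fun j _ => ?_
    rw [Nat.zero_sub, zero_add]
    exact Nat.div_eq_of_lt (by omega)
  | succ u ih =>
    have h := sum_range_sub_succ (fun v => (v + n) / (n + 1)) (n + 1) u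
    simp only [ih] at h
    have h1 : (u + 1 + n) / (n + 1) = u / (n + 1) + 1 := by
      rw [add_assoc, add_comm 1 n]; exact Nat.add_div_right u (by omega)
    have h2 : u + 1 - (n + 1) = u - n := by omega
    rw [h1, h2, hlast] at h
    omega

/-- The identity between the dimensions in `PetrovSplitting.exists_curl_of_mem_degLT`: those of
`coeffSpace n m`, `degLT (m + 1 - n)`, `degLT m` and of the kernel of the bracket. -/
theorem sum_ceil_add_tri (n m : ℕ) :
    ∑ w : Fin n × Fin n, (m - w.1 - w.2 + n) / (n + 1) + tri (m + 1 - n) =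
      tri m + (m + 1 - n + n) / (n + 1) := by
  set ψ : ℕ → ℕ := fun u => ∑ j ∈ Finset.range n, (u - j + n) / (n + 1) with hψ
  have hsum : ∀ m, ∑ w : Fin n × Fin n, (m - w.1 - w.2 + n) / (n + 1) =
      ∑ i ∈ Finset.range n, ψ (m - i) := by
    intro m
    rw [Fintype.sum_prod_type, ← Fin.sum_univ_eq_sum_range (fun i => ψ (m - i))]
    refine Finset.sum_congr rfl fun i _ => ?_
    exact Fin.sum_univ_eq_sum_range (fun j => (m - i - j + n) / (n + 1)) n
  have hψ' : ∀ u, ψ u + u / (n + 1) = u := sum_range_ceil n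
  rw [hsum]
  induction m with
  | zero =>
    have h0 : ∑ i ∈ Finset.range n, ψ (0 - i) = 0 := by
      refine Finset.sum_eq_zero fun i _ => ?_
      have := hψ' 0
      rw [Nat.zero_div] at this
      rw [Nat.zero_sub]
      omega
    rw [h0, tri_zero]
    rcases n with _ | n
    · simp [tri_succ, tri_zero]
    · have : (n + 1) / (n + 1 + 1) = 0 := Nat.div_eq_of_lt (by omega)
      simp [tri_zero, this]
  | succ m ih =>
    have h1 := sum_range_sub_succ ψ n m
    have h2 := hψ' (m + 1)
    have h3 := hψ' (m + 1 - n)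
    rw [tri_succ]
    rcases lt_or_ge (m + 1) n with h | h
    · have e1 : m + 1 - n = 0 := by omega
      have e2 : m + 1 + 1 - n = 0 := by omega
      have e3 : (m + 1) / (n + 1) = 0 := Nat.div_eq_of_lt (by omega)
      rw [e1] at ih h1 h3
      rw [Nat.zero_div] at h3
      rw [e2]
      omega
    · obtain ⟨v, hv⟩ := Nat.exists_eq_add_of_le h
      have e1 : m + 1 - n = v := by omega
      have e2 : m + 1 + 1 - n = v + 1 := by omega
      have e3 : (v + 1 + n) / (n + 1) = v / (n + 1) + 1 := by
        rw [add_assoc, add_comm 1 n]; exact Nat.add_div_right v (by omega)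
      have e4 : (m + 1) / (n + 1) = (v + n) / (n + 1) := by rw [hv, add_comm]
      rw [e1] at ih h1 h3
      rw [e2, tri_succ, e3]
      rw [e4] at h2
      omega

/-! ### Petrov's division with the sharp degree bound -/

/-- The Poisson bracket `f_x H_y - f_y H_x`, the curl of `f dH`. -/
def bracket (H : BiPoly ℝ) : BiPoly ℝ →ₗ[ℝ] BiPoly ℝ where
  toFun f := pderiv 0 f * pderiv 1 H - pderiv 1 f * pderiv 0 H
  map_add' f g := by simp only [map_add]; ring
  map_smul' c f := by simp only [Derivation.map_smul, RingHom.id_apply, smul_sub, smul_mul_assoc]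

theorem bracket_apply (H f : BiPoly ℝ) :
    bracket H f = pderiv 0 f * pderiv 1 H - pderiv 1 f * pderiv 0 H := rfl

/-- The map `p ↦ d(∑ p_w(H) ω_w)`, as a linear map. -/
def curlComb (n : ℕ) (H : BiPoly ℝ) : (Fin n × Fin n → Polynomial ℝ) →ₗ[ℝ] BiPoly ℝ where
  toFun p := curl (basicComb H p, 0)
  map_add' p q := by
    simp only [curl, basicComb, Pi.add_apply, map_add, add_mul, Finset.sum_add_distrib, map_zero]
    ring
  map_smul' c p := by
    simp only [curl, basicComb, Pi.smul_apply, map_smul, RingHom.id_apply, smul_mul_assoc,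
      ← Finset.smul_sum, map_zero, zero_sub, Derivation.map_smul, smul_neg]

theorem curlComb_apply {n : ℕ} (H : BiPoly ℝ) (p : Fin n × Fin n → Polynomial ℝ) :
    curlComb n H p = curl (basicComb H p, 0) := rfl

/-- Families of coefficients `p_w` such that every term of `d(p_w(H) ω_w)` has degree less
than `m`. -/
abbrev coeffSpace (n m : ℕ) : Submodule ℝ (Fin n × Fin n → Polynomial ℝ) :=
  Submodule.pi univ fun w => Polynomial.degreeLT ℝ ((m - w.1 - w.2 + n) / (n + 1))

theorem mem_coeffSpace {n m : ℕ} {p : Fin n × Fin n → Polynomial ℝ} :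
    p ∈ coeffSpace n m ↔ ∀ w, p w = 0 ∨ (p w).natDegree * (n + 1) + w.1 + w.2 < m := by
  simp only [Submodule.mem_pi, mem_univ, true_imp_iff, Polynomial.mem_degreeLT]
  refine forall_congr' fun w => ?_
  rcases eq_or_ne (p w) 0 with h | h
  · simp [h]
  · rw [or_iff_right h, ← Polynomial.natDegree_lt_iff_degree_lt h, Nat.lt_iff_add_one_le,
      Nat.le_div_iff_mul_le (by omega)]
    rw [add_mul, one_mul]
    omega

/-- The independence half of the Petrov property, after taking exterior derivatives. -/
theorem PetrovSplitting.eq_zero_of_curlComb {n : ℕ} {H : BiPoly ℝ} (h : PetrovSplitting n H)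
    {p : Fin n × Fin n → Polynomial ℝ} {f : BiPoly ℝ} (hpf : curlComb n H p = bracket H f) :
    p = 0 := by
  obtain ⟨N, hP⟩ := exists_mem_degLT (basicComb H p - f * pderiv 0 H)
  obtain ⟨N', hQ⟩ := exists_mem_degLT (-(f * pderiv 1 H))
  obtain ⟨g, -, hg0, hg1⟩ := exists_primitive (degLT_mono (le_max_left N N') hP)
    (degLT_mono (le_max_right N N') hQ) (by
      rw [curlComb_apply, bracket_apply, curl] at hpf
      simp only [map_zero, zero_sub] at hpf
      rw [map_neg, map_sub, pderiv_mul, pderiv_mul, pderiv_comm 0 1 H]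
      linear_combination hpf)
  refine h.indep p ⟨f, g, ?_⟩
  ext1
  · simp [extD, hg0]
  · simp [extD, hg1]

theorem totalDegree_basicMonomial {n : ℕ} (w : Fin n × Fin n) :
    (X 0 ^ (w.1 : ℕ) * X 1 ^ (w.2 : ℕ) : BiPoly ℝ).totalDegree ≤ w.1 + w.2 := by
  refine (totalDegree_mul _ _).trans ?_
  rw [totalDegree_X_pow, totalDegree_X_pow]

theorem totalDegree_basicMonomial_succ {n : ℕ} (w : Fin n × Fin n) :
    (X 0 ^ (w.1 : ℕ) * X 1 ^ ((w.2 : ℕ) + 1) : BiPoly ℝ).totalDegree ≤ w.1 + w.2 + 1 := by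
  refine (totalDegree_mul _ _).trans ?_
  rw [totalDegree_X_pow, totalDegree_X_pow, add_assoc]

theorem basicComb_mem_degLT {n m : ℕ} {H : BiPoly ℝ} (hH : H.totalDegree = n + 1)
    {p : Fin n × Fin n → Polynomial ℝ} (hp : p ∈ coeffSpace n m) :
    basicComb H p ∈ degLT (m + 1) := by
  refine sum_mem fun w _ => ?_
  rcases mem_coeffSpace.1 hp w with h | h
  · simp [h]
  · refine mem_degLT.2 (Or.inr ?_)
    refine (totalDegree_mul _ _).trans_lt ?_
    rw [totalDegree_aeval hH]
    have := totalDegree_basicMonomial_succ w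
    omega

theorem curl_mem_degLT {m : ℕ} {θ : OneForm ℝ} (h1 : θ.1 ∈ degLT (m + 1))
    (h2 : θ.2 ∈ degLT (m + 1)) : curl θ ∈ degLT m :=
  sub_mem (pderiv_mem_degLT 0 h2) (pderiv_mem_degLT 1 h1)

theorem totalDegree_pderiv_le' {n : ℕ} {H : BiPoly ℝ} (hH : H.totalDegree = n + 1) (i : Fin 2) :
    (pderiv i H).totalDegree ≤ n := by
  have := totalDegree_pderiv_le i H
  omega

theorem bracket_mem_degLT {n m : ℕ} {H : BiPoly ℝ} (hH : H.totalDegree = n + 1) {f : BiPoly ℝ}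
    (hf : f ∈ degLT (m + 1 - n)) : bracket H f ∈ degLT m := by
  have h : ∀ i, pderiv i f ∈ degLT (m - n) := fun i => by
    have := pderiv_mem_degLT i hf
    rwa [show m + 1 - n - 1 = m - n by omega] at this
  exact sub_mem (mul_mem_degLT_sub (h 0) (totalDegree_pderiv_le' hH 1))
    (mul_mem_degLT_sub (h 1) (totalDegree_pderiv_le' hH 0))

theorem finrank_coeffSpace (n m : ℕ) : Module.finrank ℝ (coeffSpace n m) =
    ∑ w : Fin n × Fin n, (m - w.1 - w.2 + n) / (n + 1) := by
  let e : coeffSpace n m ≃ₗ[ℝ]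
      (∀ w : Fin n × Fin n, Polynomial.degreeLT ℝ ((m - w.1 - w.2 + n) / (n + 1))) :=
    { toFun := fun p w => ⟨p.1 w, p.2 w trivial⟩
      invFun := fun p => ⟨fun w => p w, fun w _ => (p w).2⟩
      map_add' := fun _ _ => rfl
      map_smul' := fun _ _ => rfl
      left_inv := fun _ => rfl
      right_inv := fun _ => rfl }
  rw [e.finrank_eq, Module.finrank_pi_fintype]
  refine Finset.sum_congr rfl fun w _ => ?_
  rw [(Polynomial.degreeLTEquiv ℝ _).finrank_eq, Module.finrank_fin_fun]

instance (n m : ℕ) : Module.Finite ℝ (coeffSpace n m) := by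
  let e : coeffSpace n m →ₗ[ℝ]
      (∀ w : Fin n × Fin n, Polynomial.degreeLT ℝ ((m - w.1 - w.2 + n) / (n + 1))) :=
    { toFun := fun p w => ⟨p.1 w, p.2 w trivial⟩
      map_add' := fun _ _ => rfl
      map_smul' := fun _ _ => rfl }
  have : ∀ N, Module.Finite ℝ (Polynomial.degreeLT ℝ N) := fun N =>
    Module.Finite.equiv (Polynomial.degreeLTEquiv ℝ N).symm
  refine Module.Finite.of_injective e ?_
  intro p q hpq
  ext1
  funext w
  exact congrArg Subtype.val (congrFun hpq w)

/-- The kernel of the bracket on polynomials of bounded degree consists of polynomials in `H`. -/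
theorem finrank_ker_bracket_le {n : ℕ} {H : BiPoly ℝ} (hH : H.totalDegree = n + 1)
    (hco : IsRelPrime (pderiv 0 H) (pderiv 1 H)) (u : ℕ) :
    Module.finrank ℝ (LinearMap.ker ((bracket H).domRestrict (degLT u))) ≤
      (u + n) / (n + 1) := by
  set N := (u + n) / (n + 1) with hN
  have : Module.Finite ℝ (Polynomial.degreeLT ℝ N) :=
    Module.Finite.equiv (Polynomial.degreeLTEquiv ℝ N).symm
  have hle : (LinearMap.ker ((bracket H).domRestrict (degLT u))).map (degLT u).subtype ≤
      (Polynomial.degreeLT ℝ N).map (Polynomial.aeval H).toLinearMap := by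
    rintro _ ⟨⟨f, hf⟩, hker, rfl⟩
    have hker' : bracket H f = 0 := hker
    rw [bracket_apply] at hker'
    obtain ⟨q, rfl⟩ := exists_aeval_of_jacobian_eq_zero hH hco f (by linear_combination -hker')
    refine ⟨q, ?_, rfl⟩
    rcases eq_or_ne q 0 with rfl | hq
    · exact zero_mem _
    · rw [SetLike.mem_coe, Polynomial.mem_degreeLT, ← Polynomial.natDegree_lt_iff_degree_lt hq,
        hN, Nat.lt_iff_add_one_le, Nat.le_div_iff_mul_le (by omega), add_mul, one_mul]
      rcases mem_degLT.1 hf with h | h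
      · exact absurd (aeval_injective hH h) hq
      · rw [totalDegree_aeval hH] at h
        omega
  calc Module.finrank ℝ (LinearMap.ker ((bracket H).domRestrict (degLT u)))
      = Module.finrank ℝ
          ((LinearMap.ker ((bracket H).domRestrict (degLT u))).map (degLT u).subtype) :=
        (Submodule.equivMapOfInjective _ (degLT u).injective_subtype _).finrank_eq
    _ ≤ Module.finrank ℝ ((Polynomial.degreeLT ℝ N).map (Polynomial.aeval H).toLinearMap) :=
        Submodule.finrank_mono hle
    _ ≤ Module.finrank ℝ (Polynomial.degreeLT ℝ N) := Submodule.finrank_map_le _ _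
    _ = N := by rw [(Polynomial.degreeLTEquiv ℝ N).finrank_eq, Module.finrank_fin_fun]

/-- The polynomials of degree less than `m` are curls of combinations of basic forms up to brackets
with `H`, without loss of degree: the two spaces on the right intersect trivially by the
independence half of the Petrov property, and their dimensions add up to that of `degLT m`. -/
theorem PetrovSplitting.exists_curl_of_mem_degLT {n m : ℕ} {H : BiPoly ℝ}
    (h : PetrovSplitting n H) (hH : H.totalDegree = n + 1) {g : BiPoly ℝ} (hg : g ∈ degLT m) :
    ∃ p ∈ coeffSpace n m, ∃ f ∈ degLT (m + 1 - n), g = curlComb n H p + bracket H f := by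
  set W := (coeffSpace n m).map (curlComb n H) with hW
  set J := (degLT (m + 1 - n)).map (bracket H) with hJ
  have hinj : Function.Injective (curlComb n H) := by
    rw [← LinearMap.ker_eq_bot, LinearMap.ker_eq_bot']
    intro p hp
    exact h.eq_zero_of_curlComb (f := 0) (by rw [hp, map_zero])
  have hWr : Module.finrank ℝ W = ∑ w : Fin n × Fin n, (m - w.1 - w.2 + n) / (n + 1) := by
    rw [← finrank_coeffSpace]
    exact (Submodule.equivMapOfInjective _ hinj _).finrank_eq.symm
  have hJr : tri (m + 1 - n) ≤ Module.finrank ℝ J + (m + 1 - n + n) / (n + 1) := by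
    have h1 := LinearMap.finrank_range_add_finrank_ker
      ((bracket H).domRestrict (degLT (m + 1 - n)))
    rw [finrank_degLT, LinearMap.range_domRestrict] at h1
    have h2 := finrank_ker_bracket_le hH (h.isRelPrime hH) (m + 1 - n)
    rw [← hJ] at h1
    omega
  have hdisj : W ⊓ J = ⊥ := by
    rw [eq_bot_iff]
    rintro _ ⟨⟨p, -, rfl⟩, ⟨f, -, hf⟩⟩
    rw [Submodule.mem_bot, h.eq_zero_of_curlComb hf.symm, map_zero]
  have hle : W ⊔ J ≤ degLT m := by
    refine sup_le ?_ ?_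
    · rintro _ ⟨p, hp, rfl⟩
      exact curl_mem_degLT (basicComb_mem_degLT hH hp) (zero_mem _)
    · rintro _ ⟨f, hf, rfl⟩
      exact bracket_mem_degLT hH hf
  have hsup := Submodule.finrank_sup_add_finrank_inf_eq W J
  rw [hdisj, finrank_bot, add_zero, hWr] at hsup
  have hcount := sum_ceil_add_tri n m
  have heq : W ⊔ J = degLT m :=
    Submodule.eq_of_le_of_finrank_le hle (by rw [finrank_degLT]; omega)
  rw [← heq] at hg
  obtain ⟨_, ⟨p, hp, rfl⟩, _, ⟨f, hf, rfl⟩, hsum⟩ := Submodule.mem_sup.1 hg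
  exact ⟨p, hp, f, hf, hsum.symm⟩

/-- Division of a one-form by the basic forms, modulo relatively exact forms, with degree bounds. -/
theorem PetrovSplitting.exists_division {n M : ℕ} {H : BiPoly ℝ} (h : PetrovSplitting n H)
    (hH : H.totalDegree = n + 1) {θ : OneForm ℝ} (h1 : θ.1.totalDegree ≤ M)
    (h2 : θ.2.totalDegree ≤ M) :
    ∃ (p : Fin n × Fin n → Polynomial ℝ) (f g : BiPoly ℝ),
      (∀ w, (p w).natDegree * (n + 1) ≤ M) ∧ g.totalDegree ≤ M + 1 ∧
        θ.1 = basicComb H p + f * pderiv 0 H + pderiv 0 g ∧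
        θ.2 = f * pderiv 1 H + pderiv 1 g := by
  rw [← mem_degLT_succ] at h1 h2
  obtain ⟨p, hp, f, hf, hpf⟩ := h.exists_curl_of_mem_degLT hH (curl_mem_degLT h1 h2)
  have hf' : ∀ i, f * pderiv i H ∈ degLT (M + 1) :=
    fun i => mul_mem_degLT_sub hf (totalDegree_pderiv_le' hH i)
  obtain ⟨g, hg, hg0, hg1⟩ := exists_primitive
    (sub_mem (sub_mem h1 (basicComb_mem_degLT hH hp)) (hf' 0)) (sub_mem h2 (hf' 1)) (by
      rw [curlComb_apply, bracket_apply, curl, curl] at hpf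
      simp only [map_zero, zero_sub] at hpf
      simp only [map_sub, pderiv_mul]
      rw [pderiv_comm 0 1 H]
      linear_combination hpf)
  refine ⟨p, f, g, fun w => ?_, mem_degLT_succ.1 hg, by rw [hg0]; ring, by rw [hg1]; ring⟩
  rcases mem_coeffSpace.1 hp w with h | h
  · simp [h]
  · omega

/-! ### The Milnor algebra and the discriminant -/

/-- The combination `∑ c_w x^i y^j` of the `n ^ 2` monomials that span the Milnor algebra. -/
def monComb (n : ℕ) : (Fin n × Fin n → ℝ) →ₗ[ℝ] BiPoly ℝ :=
  Fintype.linearCombination ℝ fun w : Fin n × Fin n => X 0 ^ (w.1 : ℕ) * X 1 ^ (w.2 : ℕ)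

theorem monComb_apply {n : ℕ} (c : Fin n × Fin n → ℝ) :
    monComb n c = ∑ w, C (c w) * (X 0 ^ (w.1 : ℕ) * X 1 ^ (w.2 : ℕ)) := by
  simp only [monComb, Fintype.linearCombination_apply, smul_eq_C_mul]

theorem euler_monomial_sum (f : BiPoly ℝ) (s : Fin 2 →₀ ℕ) (i : Fin 2) :
    coeff s (X i * pderiv i f) = s i * coeff s f := by
  induction f using MvPolynomial.induction_on' with
  | monomial t c =>
    rw [X_mul_pderiv_monomial, coeff_smul, coeff_monomial]
    split_ifs with h
    · simp [h]
    · simp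
  | add p q hp hq => rw [map_add, mul_add, coeff_add, hp, hq, coeff_add, mul_add]

/-- Euler's identity up to terms of lower degree. -/
theorem totalDegree_euler_le {n : ℕ} {H : BiPoly ℝ} (hH : H.totalDegree = n + 1) :
    (C ((n : ℝ) + 1) * H - X 0 * pderiv 0 H - X 1 * pderiv 1 H).totalDegree ≤ n := by
  rw [← mem_degLT_succ, mem_degLT_support]
  intro s hs
  rw [mem_support_iff, coeff_sub, coeff_sub, coeff_C_mul, euler_monomial_sum,
    euler_monomial_sum] at hs
  have hs' : ((n : ℝ) + 1 - s 0 - s 1) * coeff s H ≠ 0 := by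
    intro h; apply hs; linear_combination h
  have hmem := mem_degLT_support.1 (mem_degLT_succ.2 hH.le) s
    (mem_support_iff.2 (right_ne_zero_of_mul hs'))
  refine lt_of_le_of_ne (by omega) fun he => left_ne_zero_of_mul hs' ?_
  have : (s 0 : ℝ) + s 1 = n + 1 := by exact_mod_cast he
  linear_combination -this

theorem aeval_eq_divX (H : BiPoly ℝ) (q : Polynomial ℝ) :
    Polynomial.aeval H q = Polynomial.aeval H q.divX * H + C (q.coeff 0) := by
  conv_lhs => rw [← Polynomial.divX_mul_X_add q]
  rw [map_add, map_mul, Polynomial.aeval_X, Polynomial.aeval_C, MvPolynomial.algebraMap_eq]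

/-- The monomials `x^i y^j`, `i, j < n`, span the Milnor algebra, with degree bounds. The exterior
derivative of the Petrov division of `g` gives such a representation once each factor `H` in
`p_w(H)` is replaced by `x H_x + y H_y` plus terms of lower degree, by Euler's identity. -/
theorem PetrovSplitting.exists_monComb {n : ℕ} {H : BiPoly ℝ} (h : PetrovSplitting n H)
    (hH : H.totalDegree = n + 1) : ∀ (m : ℕ) (g : BiPoly ℝ), g ∈ degLT m →
      ∃ c, ∃ a ∈ degLT (m - n), ∃ b ∈ degLT (m - n),
        g = monComb n c + a * pderiv 0 H + b * pderiv 1 H := by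
  intro m
  induction m with
  | zero =>
    intro g hg
    rw [mem_degLT_zero] at hg
    exact ⟨0, 0, zero_mem _, 0, zero_mem _, by simp [hg]⟩
  | succ m ih =>
    intro g hg
    obtain ⟨p, hp, f, hf, hpf⟩ := h.exists_curl_of_mem_degLT hH hg
    have hp' := mem_coeffSpace.1 hp
    set N : ℝ := (n : ℝ) + 1 with hN
    have hN0 : N ≠ 0 := by positivity
    set L := C N * H - X 0 * pderiv 0 H - X 1 * pderiv 1 H with hL
    -- the coefficient of `H` in the term of index `w`
    set A : Fin n × Fin n → BiPoly ℝ := fun w => C (((w.2 : ℝ) + 1) / N) *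
      (Polynomial.aeval H (p w).divX * (X 0 ^ (w.1 : ℕ) * X 1 ^ (w.2 : ℕ))) with hA
    set B : Fin n × Fin n → BiPoly ℝ := fun w => Polynomial.aeval H (p w).derivative *
      (X 0 ^ (w.1 : ℕ) * X 1 ^ ((w.2 : ℕ) + 1)) with hB
    have hAm : ∀ w, A w ∈ degLT (m - n) := by
      intro w
      rcases eq_or_ne (p w).divX 0 with h0 | h0
      · simp [hA, h0]
      · rw [hA, ← zero_add (m - n)]
        refine mul_mem_degLT' (by rw [totalDegree_C]) ?_
        rcases hp' w with h1 | h1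
        · simp [h1]
        · refine mem_degLT.2 (Or.inr ((totalDegree_mul _ _).trans_lt ?_))
          rw [totalDegree_aeval hH, Polynomial.natDegree_divX_eq_natDegree_tsub_one]
          have h2 := totalDegree_basicMonomial w
          have h3 : (p w).natDegree ≠ 0 := by
            intro h3
            apply h0
            rw [Polynomial.divX_eq_zero_iff]
            exact Polynomial.eq_C_of_natDegree_eq_zero h3
          obtain ⟨k, hk⟩ := Nat.exists_eq_succ_of_ne_zero h3
          rw [hk, Nat.succ_mul] at h1
          rw [hk, Nat.succ_sub_one]
          omega
    have hBm : ∀ w, B w ∈ degLT (m + 1 - n) := by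
      intro w
      rcases eq_or_ne (p w).derivative 0 with h0 | h0
      · simp [hB, h0]
      · rcases hp' w with h1 | h1
        · simp [hB, h1]
        · refine mem_degLT.2 (Or.inr ((totalDegree_mul _ _).trans_lt ?_))
          have h2 := totalDegree_basicMonomial_succ w
          have h3 : (p w).natDegree ≠ 0 := fun h3 => h0 (by
            rw [Polynomial.eq_C_of_natDegree_eq_zero h3, Polynomial.derivative_C])
          have h4 := Polynomial.natDegree_derivative_lt h3
          obtain ⟨k, hk⟩ := Nat.exists_eq_succ_of_ne_zero h3
          rw [hk, Nat.succ_mul] at h1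
          rw [totalDegree_aeval hH]
          have h5 : (p w).derivative.natDegree * (n + 1) ≤ k * (n + 1) :=
            Nat.mul_le_mul_right _ (by omega)
          omega
    have hlow : (∑ w, A w) * L ∈ degLT m :=
      mul_mem_degLT_sub (sum_mem fun w _ => hAm w) (totalDegree_euler_le hH)
    obtain ⟨c, a, ha, b, hb, hrec⟩ := ih _ hlow
    have hsub : m - n ≤ m + 1 - n := by omega
    have hX : ∀ i, X i * ∑ w, A w ∈ degLT (m + 1 - n) := by
      intro i
      rcases le_or_gt n m with hnm | hnm
      · rw [show m + 1 - n = 1 + (m - n) by omega]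
        exact mul_mem_degLT' (totalDegree_X i).le (sum_mem fun w _ => hAm w)
      · have hz : ∑ w, A w = 0 := by
          have hz : ∑ w, A w ∈ degLT (m - n) := sum_mem fun w _ => hAm w
          rwa [Nat.sub_eq_zero_of_le hnm.le, mem_degLT_zero] at hz
        rw [hz, mul_zero]
        exact zero_mem _
    have hder : ∀ i, pderiv i f ∈ degLT (m + 1 - n) := fun i => by
      have := pderiv_mem_degLT i hf
      rwa [show m + 1 + 1 - n - 1 = m + 1 - n by omega] at this
    refine ⟨-c - fun w => ((w.2 : ℝ) + 1) * (p w).coeff 0,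
      -a - X 0 * (∑ w, A w) - pderiv 1 f,
      sub_mem (sub_mem (neg_mem (degLT_mono hsub ha)) (hX 0)) (hder 1),
      -b - X 1 * (∑ w, A w) - (∑ w, B w) + pderiv 0 f,
      add_mem (sub_mem (sub_mem (neg_mem (degLT_mono hsub hb)) (hX 1))
        (sum_mem fun w _ => hBm w)) (hder 0), ?_⟩
    have hterm : ∑ w, (Polynomial.aeval H (p w) *
        (C ((w.2 : ℝ) + 1) * (X 0 ^ (w.1 : ℕ) * X 1 ^ (w.2 : ℕ))) +
        Polynomial.aeval H (p w).derivative * pderiv 1 H *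
        (X 0 ^ (w.1 : ℕ) * X 1 ^ ((w.2 : ℕ) + 1))) =
        monComb n (fun w => ((w.2 : ℝ) + 1) * (p w).coeff 0) + (∑ w, A w) * (C N * H) +
          (∑ w, B w) * pderiv 1 H := by
      rw [monComb_apply, Finset.sum_mul, Finset.sum_mul, ← Finset.sum_add_distrib,
        ← Finset.sum_add_distrib]
      refine Finset.sum_congr rfl fun w _ => ?_
      have hc : (C ((w.2 : ℝ) + 1) : BiPoly ℝ) = C (((w.2 : ℝ) + 1) / N) * C N := by
        rw [← C_mul, div_mul_cancel₀ _ hN0]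
      rw [aeval_eq_divX H (p w), hA, hB, C_mul]
      simp only
      linear_combination Polynomial.aeval H (p w).divX * H *
        (X 0 ^ (w.1 : ℕ) * X 1 ^ (w.2 : ℕ)) * hc
    rw [hpf, curlComb_apply, curl_basicComb, hterm, bracket_apply, map_sub, map_neg]
    have hH' : C N * H = L + X 0 * pderiv 0 H + X 1 * pderiv 1 H := by rw [hL]; ring
    rw [hH']
    linear_combination -hrec

/-- Linear independence of the monomials `x^i y^j`, `i, j < n`, in the Milnor algebra: the
syzygies between `H_x` and `H_y` are the trivial ones, so the dimension of the Milnor algebra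
is `n ^ 2`. -/
theorem PetrovSplitting.monComb_eq_zero {n : ℕ} {H : BiPoly ℝ} (h : PetrovSplitting n H)
    (hH : H.totalDegree = n + 1) {c : Fin n × Fin n → ℝ} {a b : BiPoly ℝ}
    (habc : monComb n c + a * pderiv 0 H + b * pderiv 1 H = 0) : c = 0 := by
  obtain ⟨N₁, ha⟩ := exists_mem_degLT a
  obtain ⟨N₂, hb⟩ := exists_mem_degLT b
  -- the degree bound is written as `r + 2 n` to avoid truncated subtraction
  set r := N₁ + N₂ with hr
  have ha' : a ∈ degLT (r + n) := degLT_mono (by omega) ha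
  have hb' : b ∈ degLT (r + n) := degLT_mono (by omega) hb
  let Φ : ((Fin n × Fin n → ℝ) × degLT (r + n) × degLT (r + n)) →ₗ[ℝ] BiPoly ℝ :=
    (monComb n).coprod
      (((LinearMap.mulRight ℝ (pderiv 0 H)).domRestrict _).coprod
        ((LinearMap.mulRight ℝ (pderiv 1 H)).domRestrict _))
  have hΦ : ∀ x, Φ x = monComb n x.1 + (x.2.1 : BiPoly ℝ) * pderiv 0 H +
      (x.2.2 : BiPoly ℝ) * pderiv 1 H := by
    intro x; simp [Φ, add_assoc]
  have hrange : degLT (r + 2 * n) ≤ LinearMap.range Φ := by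
    intro g hg
    obtain ⟨c, a, ha, b, hb, rfl⟩ := h.exists_monComb hH _ g hg
    rw [show r + 2 * n - n = r + n by omega] at ha hb
    exact ⟨(c, ⟨a, ha⟩, ⟨b, hb⟩), hΦ _⟩
  -- the trivial syzygies `(0, f H_y, -f H_x)`
  let ι : degLT r →ₗ[ℝ] ((Fin n × Fin n → ℝ) × degLT (r + n) × degLT (r + n)) :=
    { toFun := fun f => (0, ⟨(f : BiPoly ℝ) * pderiv 1 H,
          mul_mem_degLT f.2 (totalDegree_pderiv_le' hH 1)⟩,
        ⟨-((f : BiPoly ℝ) * pderiv 0 H),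
          neg_mem (mul_mem_degLT f.2 (totalDegree_pderiv_le' hH 0))⟩)
      map_add' := fun f g => by
        ext <;> simp [add_mul]
        ring
      map_smul' := fun t f => by
        ext <;> simp }
  have hι : Function.Injective ι := by
    rw [← LinearMap.ker_eq_bot, LinearMap.ker_eq_bot']
    intro f hf
    have h1 : (f : BiPoly ℝ) * pderiv 1 H = 0 := congrArg (fun x => (x.2.1 : BiPoly ℝ)) hf
    have h2 : -((f : BiPoly ℝ) * pderiv 0 H) = 0 := congrArg (fun x => (x.2.2 : BiPoly ℝ)) hf
    rw [neg_eq_zero] at h2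
    by_contra hne
    have hne' : (f : BiPoly ℝ) ≠ 0 := by simpa using hne
    exact pderiv_ne_zero hH ⟨(mul_eq_zero.1 h2).resolve_left hne',
      (mul_eq_zero.1 h1).resolve_left hne'⟩
  have hle : LinearMap.range ι ≤ LinearMap.ker Φ := by
    rintro _ ⟨f, rfl⟩
    rw [LinearMap.mem_ker, hΦ]
    simp only [ι, LinearMap.coe_mk, AddHom.coe_mk, map_zero]
    ring
  have hdim := LinearMap.finrank_range_add_finrank_ker Φ
  have hker : Module.finrank ℝ (LinearMap.ker Φ) ≤ Module.finrank ℝ (LinearMap.range ι) := by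
    have h1 : tri (r + 2 * n) ≤ Module.finrank ℝ (LinearMap.range Φ) := by
      rw [← finrank_degLT]; exact Submodule.finrank_mono hrange
    have h2 : Module.finrank ℝ (LinearMap.range ι) = tri r := by
      rw [LinearMap.finrank_range_of_inj hι, finrank_degLT]
    rw [Module.finrank_prod, Module.finrank_prod, finrank_degLT, Module.finrank_fintype_fun_eq_card,
      Fintype.card_prod, Fintype.card_fin] at hdim
    rw [h2]
    have t1 := two_mul_tri r
    have t2 := two_mul_tri (r + n)
    have t3 := two_mul_tri (r + 2 * n)
    nlinarith
  have heq := Submodule.eq_of_le_of_finrank_le hle hker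
  have hmem : ((c, ⟨a, ha'⟩, ⟨b, hb'⟩) :
      (Fin n × Fin n → ℝ) × degLT (r + n) × degLT (r + n)) ∈ LinearMap.range ι := by
    rw [heq, LinearMap.mem_ker, hΦ]
    exact habc
  obtain ⟨f, hf⟩ := hmem
  exact (congrArg Prod.fst hf).symm

/-- A polynomial `D` with `D(0) ≠ 0` such that `D(H)` lies in the ideal `(H_x, H_y)`: the
characteristic polynomial of the multiplication by `H` in the Milnor algebra. -/
theorem PetrovSplitting.exists_discriminant {n : ℕ} {H : BiPoly ℝ} (h : PetrovSplitting n H)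
    (hH : H.totalDegree = n + 1)
    (hsmooth : ∃ u a b : BiPoly ℝ, u * H + a * pderiv 0 H + b * pderiv 1 H = 1) :
    ∃ (D : Polynomial ℝ) (a b : BiPoly ℝ), D.natDegree ≤ n ^ 2 ∧ D.coeff 0 ≠ 0 ∧
      a.totalDegree ≤ n ^ 2 * (n + 1) ∧ b.totalDegree ≤ n ^ 2 * (n + 1) ∧
      Polynomial.aeval H D = a * pderiv 0 H + b * pderiv 1 H := by
  set I : Ideal (BiPoly ℝ) := Ideal.span {pderiv 0 H, pderiv 1 H} with hI
  set π : BiPoly ℝ →ₐ[ℝ] BiPoly ℝ ⧸ I := Ideal.Quotient.mkₐ ℝ I with hπ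
  have hπ0 : ∀ a, π a = 0 ↔ ∃ u v, u * pderiv 0 H + v * pderiv 1 H = a := by
    intro a
    rw [hπ, Ideal.Quotient.mkₐ_eq_mk, Ideal.Quotient.eq_zero_iff_mem, hI, Ideal.mem_span_pair]
  have hsurj : Function.Surjective (π.toLinearMap ∘ₗ monComb n) := by
    intro x
    obtain ⟨g, rfl⟩ := Ideal.Quotient.mkₐ_surjective ℝ I x
    obtain ⟨m, hm⟩ := exists_mem_degLT g
    obtain ⟨c, a, -, b, -, rfl⟩ := h.exists_monComb hH m g hm
    refine ⟨c, ?_⟩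
    rw [← sub_eq_zero]
    change π _ - π _ = 0
    rw [← map_sub, hπ0]
    exact ⟨-a, -b, by ring⟩
  have : Module.Finite ℝ (BiPoly ℝ ⧸ I) := Module.Finite.of_surjective _ hsurj
  have hfin : Module.finrank ℝ (BiPoly ℝ ⧸ I) ≤ n ^ 2 := by
    refine (LinearMap.finrank_le_finrank_of_surjective hsurj).trans ?_
    rw [Module.finrank_fintype_fun_eq_card, Fintype.card_prod, Fintype.card_fin, sq]
  set T : Module.End ℝ (BiPoly ℝ ⧸ I) := Algebra.lmul ℝ _ (π H) with hT
  set D := LinearMap.charpoly T with hD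
  have hDdeg : D.natDegree ≤ n ^ 2 := by rw [hD, LinearMap.charpoly_natDegree]; exact hfin
  -- `H` is invertible in the Milnor algebra, so the determinant `± D(0)` does not vanish
  have hD0 : D.coeff 0 ≠ 0 := by
    obtain ⟨u, a, b, hu⟩ := hsmooth
    have hunit : π u * π H = 1 := by
      rw [← map_mul, ← sub_eq_zero, ← map_one π, ← map_sub, hπ0]
      exact ⟨-a, -b, by linear_combination -hu⟩
    have hdet : IsUnit (LinearMap.det T) := by
      refine LinearMap.isUnit_det T (IsUnit.map (Algebra.lmul ℝ _) ?_)
      exact IsUnit.of_mul_eq_one_right _ hunit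
    intro h0
    rw [LinearMap.det_eq_sign_charpoly_coeff, ← hD, h0, mul_zero] at hdet
    exact not_isUnit_zero hdet
  have hDH : π (Polynomial.aeval H D) = 0 := by
    rw [← Polynomial.aeval_algHom_apply]
    have h1 : Polynomial.aeval T D = 0 := LinearMap.aeval_self_charpoly T
    rw [hT, Polynomial.aeval_algHom_apply] at h1
    have h2 := LinearMap.congr_fun h1 1
    simpa using h2
  obtain ⟨u, v, huv⟩ := (hπ0 _).1 hDH
  have hmem : Polynomial.aeval H D ∈ degLT (n ^ 2 * (n + 1) + 1) := by
    rw [mem_degLT_succ, totalDegree_aeval hH]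
    exact Nat.mul_le_mul_right _ hDdeg
  obtain ⟨c, a, ha, b, hb, hab⟩ := h.exists_monComb hH _ _ hmem
  have hc : c = 0 := h.monComb_eq_zero hH (a := a - u) (b := b - v) (by
    linear_combination -hab - huv)
  rw [hc, map_zero, zero_add] at hab
  refine ⟨D, a, b, hDdeg, hD0, ?_, ?_, hab⟩
  · exact mem_degLT_succ.1 (degLT_mono (Nat.sub_le _ _) ha)
  · exact mem_degLT_succ.1 (degLT_mono (Nat.sub_le _ _) hb)

/-! ### Integrals depending on a parameter -/

/-- The extension of a continuous function on a rectangle by projecting onto the rectangle is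
continuous. This lets the parametric integrals be handled by theorems on globally defined
functions. -/
theorem continuous_projIcc_comp {a b : ℝ} (hab : a ≤ b) {g : ℝ → ℝ → ℝ}
    (hg : ContinuousOn (fun q : ℝ × ℝ => g q.1 q.2) (Icc a b ×ˢ Icc 0 1)) :
    Continuous (Function.uncurry fun l s : ℝ =>
      g (projIcc a b hab l) (projIcc (0 : ℝ) 1 zero_le_one s)) := by
  have h : Continuous fun q : ℝ × ℝ =>
      (((projIcc a b hab q.1 : ℝ), (projIcc (0 : ℝ) 1 zero_le_one q.2 : ℝ)) : ℝ × ℝ) := by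
    fun_prop
  exact hg.comp_continuous h fun q => ⟨(projIcc a b hab q.1).2, (projIcc 0 1 zero_le_one q.2).2⟩

theorem integral_congr_projIcc {a b : ℝ} (hab : a ≤ b) {g : ℝ → ℝ → ℝ} {l s : ℝ}
    (hl : l ∈ Icc a b) (hs : s ∈ Icc (0 : ℝ) 1) :
    ∫ u in (0 : ℝ)..s, g l u =
      ∫ u in (0 : ℝ)..s, g (projIcc a b hab l) (projIcc (0 : ℝ) 1 zero_le_one u) := by
  refine intervalIntegral.integral_congr fun u hu => ?_
  rw [uIcc_of_le hs.1] at hu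
  simp only [projIcc_of_mem hab hl, projIcc_of_mem zero_le_one
    (⟨hu.1, hu.2.trans hs.2⟩ : u ∈ Icc (0 : ℝ) 1)]

theorem exists_Icc_subset_of_isOpen {U : Set ℝ} (hU : IsOpen U) {l : ℝ} (hl : l ∈ U) :
    ∃ a b, a < l ∧ l < b ∧ Icc a b ⊆ U := by
  obtain ⟨ρ, hρ, h⟩ := Metric.isOpen_iff.1 hU l hl
  refine ⟨l - ρ / 2, l + ρ / 2, by linarith, by linarith, fun x hx => h ?_⟩
  rw [Metric.mem_ball, Real.dist_eq, abs_lt]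
  constructor <;> linarith [hx.1, hx.2]

theorem continuousOn_parametric_integral {U : Set ℝ} (hU : IsOpen U) {g : ℝ → ℝ → ℝ}
    (hg : ContinuousOn (fun q : ℝ × ℝ => g q.1 q.2) (U ×ˢ Icc 0 1)) :
    ContinuousOn (fun q : ℝ × ℝ => ∫ u in (0 : ℝ)..q.2, g q.1 u) (U ×ˢ Icc 0 1) := by
  rintro ⟨l, s⟩ ⟨hl, hs⟩
  obtain ⟨a, b, ha, hb, hab⟩ := exists_Icc_subset_of_isOpen hU hl
  have hle : a ≤ b := (ha.trans hb).le
  have hc := continuous_projIcc_comp hle (hg.mono (prod_mono hab le_rfl))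
  have hc2 : Continuous fun q : ℝ × ℝ =>
      ∫ u in (0 : ℝ)..q.2, g (projIcc a b hle q.1) (projIcc (0 : ℝ) 1 zero_le_one u) :=
    intervalIntegral.continuous_parametric_intervalIntegral_of_continuous
      (f := fun (q : ℝ × ℝ) u => g (projIcc a b hle q.1) (projIcc (0 : ℝ) 1 zero_le_one u))
      (by
        have : Continuous fun z : (ℝ × ℝ) × ℝ => ((z.1.1, z.2) : ℝ × ℝ) := by fun_prop
        exact hc.comp this) continuous_snd
  refine (hc2.continuousWithinAt (s := U ×ˢ Icc 0 1) (x := (l, s))).congr_of_eventuallyEq ?_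
    (integral_congr_projIcc hle ⟨ha.le, hb.le⟩ hs)
  have h1 : ∀ᶠ q : ℝ × ℝ in 𝓝[U ×ˢ Icc 0 1] (l, s), q.1 ∈ Icc a b :=
    (continuous_fst.continuousAt.eventually (Icc_mem_nhds ha hb)).filter_mono nhdsWithin_le_nhds
  filter_upwards [h1, self_mem_nhdsWithin] with q hq hq'
  exact integral_congr_projIcc hle hq hq'.2

theorem hasDerivAt_integral_of_continuousOn {g : ℝ → ℝ} (hg : ContinuousOn g (Icc 0 1)) {s : ℝ}
    (hs : s ∈ Ioo (0 : ℝ) 1) : HasDerivAt (fun s => ∫ u in (0 : ℝ)..s, g u) (g s) s := by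
  have hc : Continuous fun u : ℝ => g (projIcc (0 : ℝ) 1 zero_le_one u) :=
    hg.comp_continuous (by fun_prop) fun u => (projIcc 0 1 zero_le_one u).2
  have h := intervalIntegral.integral_hasDerivAt_right (hc.intervalIntegrable 0 s)
    hc.aestronglyMeasurable.stronglyMeasurableAtFilter hc.continuousAt
  rw [projIcc_of_mem zero_le_one (Ioo_subset_Icc_self hs)] at h
  refine h.congr_of_eventuallyEq ?_
  filter_upwards [isOpen_Ioo.mem_nhds hs] with t ht
  refine intervalIntegral.integral_congr fun u hu => ?_
  rw [uIcc_of_le ht.1.le] at hu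
  simp only [projIcc_of_mem zero_le_one (⟨hu.1, hu.2.trans ht.2.le⟩ : u ∈ Icc (0 : ℝ) 1)]

theorem hasDerivAt_parametric_integral {U : Set ℝ} (hU : IsOpen U) {g g' : ℝ → ℝ → ℝ}
    (hg : ContinuousOn (fun q : ℝ × ℝ => g q.1 q.2) (U ×ˢ Icc 0 1))
    (hg' : ContinuousOn (fun q : ℝ × ℝ => g' q.1 q.2) (U ×ˢ Icc 0 1))
    (hd : ∀ l ∈ U, ∀ s ∈ Icc (0 : ℝ) 1, HasDerivAt (fun l => g l s) (g' l s) l)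
    {l s : ℝ} (hl : l ∈ U) (hs : s ∈ Icc (0 : ℝ) 1) :
    HasDerivAt (fun l => ∫ u in (0 : ℝ)..s, g l u) (∫ u in (0 : ℝ)..s, g' l u) l := by
  obtain ⟨a, b, ha, hb, hab⟩ := exists_Icc_subset_of_isOpen hU hl
  have hK : IsCompact (Icc a b ×ˢ Icc (0 : ℝ) 1) := isCompact_Icc.prod isCompact_Icc
  obtain ⟨B, hB⟩ := hK.exists_bound_of_continuousOn (hg'.mono (prod_mono hab le_rfl))
  have hsub : uIcc 0 s ⊆ Icc (0 : ℝ) 1 := by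
    rw [uIcc_of_le hs.1]; exact Icc_subset_Icc le_rfl hs.2
  have hsub' : uIoc 0 s ⊆ Icc (0 : ℝ) 1 := uIoc_subset_uIcc.trans hsub
  have hslice : ∀ {f : ℝ → ℝ → ℝ}, ContinuousOn (fun q : ℝ × ℝ => f q.1 q.2) (U ×ˢ Icc 0 1) →
      ∀ l ∈ U, ContinuousOn (f l) (Icc 0 1) := by
    intro f hf l hl
    exact hf.comp (f := fun s => (l, s)) (by fun_prop) fun s hs => ⟨hl, hs⟩
  have hmeas : ∀ {f : ℝ → ℝ}, ContinuousOn f (Icc 0 1) →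
      MeasureTheory.AEStronglyMeasurable f (MeasureTheory.volume.restrict (uIoc 0 s)) := by
    intro f hf
    exact (hf.mono hsub').aestronglyMeasurable measurableSet_uIoc
  refine (intervalIntegral.hasDerivAt_integral_of_dominated_loc_of_deriv_le
    (F := g) (F' := g') (bound := fun _ => B) (s := Ioo a b) (Ioo_mem_nhds ha hb) ?_ ?_ ?_ ?_ ?_ ?_).2
  · filter_upwards [Ioo_mem_nhds ha hb] with x hx
    exact hmeas (hslice hg x (hab (Ioo_subset_Icc_self hx)))
  · exact ((hslice hg l hl).mono hsub).intervalIntegrable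
  · exact hmeas (hslice hg' l hl)
  · filter_upwards with t ht x hx
    exact hB (x, t) ⟨Ioo_subset_Icc_self hx, hsub' ht⟩
  · exact intervalIntegrable_const
  · filter_upwards with t ht x hx
    exact hd x (hab (Ioo_subset_Icc_self hx)) t (hsub' ht)

/-! ### Smooth functions of two variables -/

/-- The first derivatives and the mixed second derivative of a `C²` function of two variables,
as functions of two real variables. -/
structure HasMixedDerivs (U : Set ℝ) (f fl fs fls : ℝ → ℝ → ℝ) : Prop where
  deriv_left : ∀ l ∈ U, ∀ s ∈ Icc (0 : ℝ) 1, HasDerivAt (fun l => f l s) (fl l s) l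
  deriv_right : ∀ l ∈ U, ∀ s ∈ Icc (0 : ℝ) 1, HasDerivAt (f l) (fs l s) s
  mixed_left : ∀ l ∈ U, ∀ s ∈ Icc (0 : ℝ) 1, HasDerivAt (fun l => fs l s) (fls l s) l
  mixed_right : ∀ l ∈ U, ∀ s ∈ Icc (0 : ℝ) 1, HasDerivAt (fl l) (fls l s) s
  cont_left : ContinuousOn (fun q : ℝ × ℝ => fl q.1 q.2) (U ×ˢ Icc 0 1)
  cont_right : ContinuousOn (fun q : ℝ × ℝ => fs q.1 q.2) (U ×ˢ Icc 0 1)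
  cont_mixed : ContinuousOn (fun q : ℝ × ℝ => fls q.1 q.2) (U ×ˢ Icc 0 1)

theorem hasMixedDerivs_of_contDiffAt {U : Set ℝ} {f : ℝ → ℝ → ℝ}
    (hf : ∀ l ∈ U, ∀ s ∈ Icc (0 : ℝ) 1, ContDiffAt ℝ 2 (fun q : ℝ × ℝ => f q.1 q.2) (l, s)) :
    HasMixedDerivs U f (fun l s => fderiv ℝ (fun q : ℝ × ℝ => f q.1 q.2) (l, s) (1, 0))
      (fun l s => fderiv ℝ (fun q : ℝ × ℝ => f q.1 q.2) (l, s) (0, 1))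
      (fun l s => fderiv ℝ (fderiv ℝ (fun q : ℝ × ℝ => f q.1 q.2)) (l, s) (1, 0) (0, 1)) := by
  set F : ℝ × ℝ → ℝ := fun q => f q.1 q.2 with hF
  have hl : ∀ (l s : ℝ), HasDerivAt (fun l => ((l, s) : ℝ × ℝ)) (1, 0) l := fun l s =>
    (hasDerivAt_id l).prodMk (hasDerivAt_const l s)
  have hs : ∀ (l s : ℝ), HasDerivAt (fun s => ((l, s) : ℝ × ℝ)) (0, 1) s := fun l s =>
    (hasDerivAt_const s l).prodMk (hasDerivAt_id s)
  have h1 : ∀ l ∈ U, ∀ s ∈ Icc (0 : ℝ) 1, HasFDerivAt F (fderiv ℝ F (l, s)) (l, s) :=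
    fun l hl s hs => ((hf l hl s hs).differentiableAt (by norm_num)).hasFDerivAt
  have hC1 : ∀ l ∈ U, ∀ s ∈ Icc (0 : ℝ) 1, ContDiffAt ℝ 1 (fderiv ℝ F) (l, s) :=
    fun l hl s hs => (hf l hl s hs).fderiv_right (m := 1) (by norm_num)
  have h2 : ∀ l ∈ U, ∀ s ∈ Icc (0 : ℝ) 1,
      HasFDerivAt (fderiv ℝ F) (fderiv ℝ (fderiv ℝ F) (l, s)) (l, s) :=
    fun l hl s hs => ((hC1 l hl s hs).differentiableAt (by norm_num)).hasFDerivAt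
  have hC0 : ∀ l ∈ U, ∀ s ∈ Icc (0 : ℝ) 1, ContDiffAt ℝ 0 (fderiv ℝ (fderiv ℝ F)) (l, s) :=
    fun l hl s hs => (hC1 l hl s hs).fderiv_right (m := 0) (by norm_num)
  have hsymm : ∀ l ∈ U, ∀ s ∈ Icc (0 : ℝ) 1, ∀ v w,
      fderiv ℝ (fderiv ℝ F) (l, s) v w = fderiv ℝ (fderiv ℝ F) (l, s) w v :=
    fun l hl s hs v w => ((hf l hl s hs).isSymmSndFDerivAt (by simp)).eq v w
  refine ⟨?_, ?_, ?_, ?_, ?_, ?_, ?_⟩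
  · intro l hlU s hsI
    exact (h1 l hlU s hsI).comp_hasDerivAt l (hl l s)
  · intro l hlU s hsI
    exact (h1 l hlU s hsI).comp_hasDerivAt s (hs l s)
  · intro l hlU s hsI
    exact (ContinuousLinearMap.apply ℝ ℝ ((0, 1) : ℝ × ℝ)).hasFDerivAt.comp_hasDerivAt l
      ((h2 l hlU s hsI).comp_hasDerivAt l (hl l s))
  · intro l hlU s hsI
    rw [hsymm l hlU s hsI]
    exact (ContinuousLinearMap.apply ℝ ℝ ((1, 0) : ℝ × ℝ)).hasFDerivAt.comp_hasDerivAt s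
      ((h2 l hlU s hsI).comp_hasDerivAt s (hs l s))
  · rintro ⟨l, s⟩ ⟨hlU, hsI⟩
    exact ((hC1 l hlU s hsI).continuousAt.clm_apply continuousAt_const).continuousWithinAt
  · rintro ⟨l, s⟩ ⟨hlU, hsI⟩
    exact ((hC1 l hlU s hsI).continuousAt.clm_apply continuousAt_const).continuousWithinAt
  · rintro ⟨l, s⟩ ⟨hlU, hsI⟩
    exact (((hC0 l hlU s hsI).continuousAt.clm_apply continuousAt_const).clm_apply
      continuousAt_const).continuousWithinAt

/-! ### Evaluation of polynomials along curves -/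

theorem evalAt_add (q : ℝ × ℝ) (f g : BiPoly ℝ) : evalAt q (f + g) = evalAt q f + evalAt q g :=
  map_add _ _ _

theorem evalAt_mul (q : ℝ × ℝ) (f g : BiPoly ℝ) : evalAt q (f * g) = evalAt q f * evalAt q g :=
  map_mul _ _ _

theorem evalAt_C (q : ℝ × ℝ) (c : ℝ) : evalAt q (C c) = c := eval_C c

theorem evalAt_zero (q : ℝ × ℝ) : evalAt q 0 = 0 := map_zero _

theorem evalAt_one (q : ℝ × ℝ) : evalAt q 1 = 1 := map_one _

theorem evalAt_X_zero (q : ℝ × ℝ) : evalAt q (X 0) = q.1 := by simp [evalAt]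

theorem evalAt_X_one (q : ℝ × ℝ) : evalAt q (X 1) = q.2 := by simp [evalAt]

theorem evalAt_aeval (q : ℝ × ℝ) (H : BiPoly ℝ) (r : Polynomial ℝ) :
    evalAt q (Polynomial.aeval H r) = r.eval (evalAt q H) := by
  unfold evalAt
  rw [← Polynomial.coe_aeval_eq_eval, ← coe_aeval_eq_eval, RingHom.coe_coe,
    ← Polynomial.aeval_algHom_apply]

theorem continuous_evalAt (f : BiPoly ℝ) : Continuous fun q => evalAt q f := by
  refine (MvPolynomial.continuous_eval f).comp (continuous_pi fun i => ?_)
  fin_cases i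
  · exact continuous_fst
  · exact continuous_snd

theorem hasDerivAt_evalAt (f : BiPoly ℝ) {c : ℝ → ℝ × ℝ} {a b t : ℝ}
    (h1 : HasDerivAt (fun t => (c t).1) a t) (h2 : HasDerivAt (fun t => (c t).2) b t) :
    HasDerivAt (fun t => evalAt (c t) f)
      (evalAt (c t) (pderiv 0 f) * a + evalAt (c t) (pderiv 1 f) * b) t := by
  induction f using MvPolynomial.induction_on with
  | C r =>
    simp only [evalAt_C, pderiv_C, evalAt_zero, zero_mul, add_zero]
    exact hasDerivAt_const t r
  | add p q hp hq =>
    simp only [evalAt_add, map_add]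
    exact (hp.add hq).congr_deriv (by ring)
  | mul_X p i hp =>
    fin_cases i
    · simp only [Fin.zero_eta, evalAt_mul, evalAt_X_zero, pderiv_mul, evalAt_add, pderiv_X_self,
        pderiv_X_of_ne (by decide : (0 : Fin 2) ≠ 1), evalAt_one, evalAt_zero]
      exact (hp.mul h1).congr_deriv (by ring)
    · simp only [Fin.mk_one, evalAt_mul, evalAt_X_one, pderiv_mul, evalAt_add, pderiv_X_self,
        pderiv_X_of_ne (by decide : (1 : Fin 2) ≠ 0), evalAt_one, evalAt_zero]
      exact (hp.mul h2).congr_deriv (by ring)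

/-- The restriction of a polynomial to the line `x = 0`. -/
def onLine (f : BiPoly ℝ) : Polynomial ℝ := aeval ![0, Polynomial.X] f

theorem eval_onLine (f : BiPoly ℝ) (p : ℝ) : (onLine f).eval p = evalAt (0, p) f := by
  unfold onLine evalAt
  rw [← Polynomial.coe_aeval_eq_eval, ← coe_aeval_eq_eval]
  have : (Polynomial.aeval p).comp (aeval ![0, Polynomial.X] : BiPoly ℝ →ₐ[ℝ] Polynomial ℝ) =
      aeval ![0, p] := by
    ext i
    fin_cases i <;> simp
  exact AlgHom.congr_fun this f

theorem natDegree_onLine_le (f : BiPoly ℝ) : (onLine f).natDegree ≤ f.totalDegree := by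
  unfold onLine
  rw [f.as_sum, map_sum, ← f.as_sum]
  refine Polynomial.natDegree_sum_le_of_forall_le _ _ fun s hs => ?_
  rw [aeval_monomial, Finsupp.prod_fintype _ _ (by simp), Fin.prod_univ_two]
  have h := (le_totalDegree hs)
  rw [finsupp_sum_fin_two] at h
  simp only [Matrix.cons_val_zero, Matrix.cons_val_one, Polynomial.algebraMap_eq]
  refine (Polynomial.natDegree_C_mul_le _ _).trans ?_
  rcases Nat.eq_zero_or_pos (s 0) with h0 | h0
  · rw [h0, pow_zero, one_mul, Polynomial.natDegree_X_pow]
    omega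
  · rw [zero_pow h0.ne', zero_mul]
    simp

/-! ### Families of paths in the level curves of `H` -/

/-- The polynomial `D(H(0, p)) H_y(0, p)`, whose zeros are the values of `p` to be avoided. -/
def disc (H : BiPoly ℝ) (D : Polynomial ℝ) : Polynomial ℝ :=
  D.comp (onLine H) * onLine (pderiv 1 H)

/-- A one-parameter family of paths `s ↦ path l s`, `0 ≤ s ≤ 1`, each of which lies in a level curve
of `H` and starts on the line `x = 0`, away from the zeros of `disc H D`. -/
structure LevelFamily (H : BiPoly ℝ) (D : Polynomial ℝ) where
  /-- The set of parameters. -/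
  dom : Set ℝ
  /-- The path with a given parameter. -/
  path : ℝ → ℝ → ℝ × ℝ
  isOpen_dom : IsOpen dom
  smooth : ∀ l ∈ dom, ∀ s ∈ Icc (0 : ℝ) 1,
    ContDiffAt ℝ 2 (fun q : ℝ × ℝ => path q.1 q.2) (l, s)
  start : ∀ l ∈ dom, (path l 0).1 = 0
  level : ∀ l ∈ dom, ∀ s ∈ Icc (0 : ℝ) 1, evalAt (path l s) H = evalAt (path l 0) H
  good : ∀ l ∈ dom, (disc H D).eval (path l 0).2 ≠ 0

namespace LevelFamily

variable {H : BiPoly ℝ} {D : Polynomial ℝ} (Φ : LevelFamily H D)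

/-- The first coordinate of the path. -/
def x (l s : ℝ) : ℝ := (Φ.path l s).1
/-- The second coordinate of the path. -/
def y (l s : ℝ) : ℝ := (Φ.path l s).2
/-- The initial point `(0, p)` of the path. -/
def p (l : ℝ) : ℝ := (Φ.path l 0).2
/-- Derivative of `x` in the parameter. -/
def xl (l s : ℝ) : ℝ := fderiv ℝ (fun q : ℝ × ℝ => Φ.x q.1 q.2) (l, s) (1, 0)
/-- Derivative of `y` in the parameter. -/
def yl (l s : ℝ) : ℝ := fderiv ℝ (fun q : ℝ × ℝ => Φ.y q.1 q.2) (l, s) (1, 0)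
/-- Derivative of `x` in the time. -/
def xs (l s : ℝ) : ℝ := fderiv ℝ (fun q : ℝ × ℝ => Φ.x q.1 q.2) (l, s) (0, 1)
/-- Derivative of `y` in the time. -/
def ys (l s : ℝ) : ℝ := fderiv ℝ (fun q : ℝ × ℝ => Φ.y q.1 q.2) (l, s) (0, 1)
/-- Mixed second derivative of `x`. -/
def xls (l s : ℝ) : ℝ :=
  fderiv ℝ (fderiv ℝ (fun q : ℝ × ℝ => Φ.x q.1 q.2)) (l, s) (1, 0) (0, 1)
/-- Mixed second derivative of `y`. -/
def yls (l s : ℝ) : ℝ :=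
  fderiv ℝ (fderiv ℝ (fun q : ℝ × ℝ => Φ.y q.1 q.2)) (l, s) (1, 0) (0, 1)
/-- The derivative of the level `H(0, p)` in the parameter. -/
def tl (l : ℝ) : ℝ := evalAt (0, Φ.p l) (pderiv 1 H) * Φ.yl l 0
/-- The value of a one-form on the velocity of the path. -/
def ds (θ : OneForm ℝ) (l s : ℝ) : ℝ :=
  evalAt (Φ.path l s) θ.1 * Φ.xs l s + evalAt (Φ.path l s) θ.2 * Φ.ys l s
/-- The value of a one-form on the derivative of the path in the parameter. -/
def dl (θ : OneForm ℝ) (l s : ℝ) : ℝ :=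
  evalAt (Φ.path l s) θ.1 * Φ.xl l s + evalAt (Φ.path l s) θ.2 * Φ.yl l s

theorem mixed_x : HasMixedDerivs Φ.dom Φ.x Φ.xl Φ.xs Φ.xls :=
  hasMixedDerivs_of_contDiffAt fun l hl s hs => (Φ.smooth l hl s hs).fst

theorem mixed_y : HasMixedDerivs Φ.dom Φ.y Φ.yl Φ.ys Φ.yls :=
  hasMixedDerivs_of_contDiffAt fun l hl s hs => (Φ.smooth l hl s hs).snd

theorem zero_mem : (0 : ℝ) ∈ Icc (0 : ℝ) 1 := ⟨le_rfl, zero_le_one⟩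

theorem path_zero {l : ℝ} (hl : l ∈ Φ.dom) : Φ.path l 0 = (0, Φ.p l) :=
  Prod.ext (Φ.start l hl) rfl

theorem pullback_eq {l s : ℝ} (hl : l ∈ Φ.dom) (hs : s ∈ Icc (0 : ℝ) 1) (θ : OneForm ℝ) :
    pullback (Φ.path l) θ s = Φ.ds θ l s := by
  have h : HasDerivAt (Φ.path l) (Φ.xs l s, Φ.ys l s) s :=
    (Φ.mixed_x.deriv_right l hl s hs).prodMk (Φ.mixed_y.deriv_right l hl s hs)
  rw [pullback, h.deriv, ds]

theorem level_eq {l s : ℝ} (hl : l ∈ Φ.dom) (hs : s ∈ Icc (0 : ℝ) 1) :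
    evalAt (Φ.path l s) H = evalAt (0, Φ.p l) H := by
  rw [Φ.level l hl s hs, Φ.path_zero hl]

theorem hasDerivAt_evalAt_right {l s : ℝ} (hl : l ∈ Φ.dom) (hs : s ∈ Icc (0 : ℝ) 1)
    (f : BiPoly ℝ) : HasDerivAt (fun s => evalAt (Φ.path l s) f)
      (evalAt (Φ.path l s) (pderiv 0 f) * Φ.xs l s +
        evalAt (Φ.path l s) (pderiv 1 f) * Φ.ys l s) s :=
  hasDerivAt_evalAt f (Φ.mixed_x.deriv_right l hl s hs) (Φ.mixed_y.deriv_right l hl s hs)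

theorem hasDerivAt_evalAt_left {l s : ℝ} (hl : l ∈ Φ.dom) (hs : s ∈ Icc (0 : ℝ) 1)
    (f : BiPoly ℝ) : HasDerivAt (fun l => evalAt (Φ.path l s) f)
      (evalAt (Φ.path l s) (pderiv 0 f) * Φ.xl l s +
        evalAt (Φ.path l s) (pderiv 1 f) * Φ.yl l s) l :=
  hasDerivAt_evalAt f (Φ.mixed_x.deriv_left l hl s hs) (Φ.mixed_y.deriv_left l hl s hs)

theorem hasDerivAt_p {l : ℝ} (hl : l ∈ Φ.dom) : HasDerivAt Φ.p (Φ.yl l 0) l :=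
  Φ.mixed_y.deriv_left l hl 0 zero_mem

theorem xl_zero {l : ℝ} (hl : l ∈ Φ.dom) : Φ.xl l 0 = 0 := by
  refine (Φ.mixed_x.deriv_left l hl 0 zero_mem).unique ?_
  refine (hasDerivAt_const l (0 : ℝ)).congr_of_eventuallyEq ?_
  filter_upwards [Φ.isOpen_dom.mem_nhds hl] with l' hl'
  exact Φ.start l' hl'

theorem ds_extD_eq_zero {l s : ℝ} (hl : l ∈ Φ.dom) (hs : s ∈ Ioo (0 : ℝ) 1) :
    evalAt (Φ.path l s) (pderiv 0 H) * Φ.xs l s +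
      evalAt (Φ.path l s) (pderiv 1 H) * Φ.ys l s = 0 := by
  refine (Φ.hasDerivAt_evalAt_right hl (Ioo_subset_Icc_self hs) H).unique ?_
  refine (hasDerivAt_const s (evalAt (Φ.path l 0) H)).congr_of_eventuallyEq ?_
  filter_upwards [isOpen_Ioo.mem_nhds hs] with t ht
  exact Φ.level l hl t (Ioo_subset_Icc_self ht)

theorem dl_extD_eq {l s : ℝ} (hl : l ∈ Φ.dom) (hs : s ∈ Icc (0 : ℝ) 1) :
    evalAt (Φ.path l s) (pderiv 0 H) * Φ.xl l s +
      evalAt (Φ.path l s) (pderiv 1 H) * Φ.yl l s = Φ.tl l := by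
  have h : evalAt (Φ.path l s) (pderiv 0 H) * Φ.xl l s +
      evalAt (Φ.path l s) (pderiv 1 H) * Φ.yl l s =
      evalAt (Φ.path l 0) (pderiv 0 H) * Φ.xl l 0 +
      evalAt (Φ.path l 0) (pderiv 1 H) * Φ.yl l 0 := by
    refine (Φ.hasDerivAt_evalAt_left hl hs H).unique ?_
    refine (Φ.hasDerivAt_evalAt_left hl zero_mem H).congr_of_eventuallyEq ?_
    filter_upwards [Φ.isOpen_dom.mem_nhds hl] with l' hl'
    exact Φ.level l' hl' s hs
  rw [h, Φ.xl_zero hl, Φ.path_zero hl, tl]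
  ring

/-- The reciprocal of `disc H D` at the initial point. -/
def q (l : ℝ) : ℝ := ((disc H D).eval (Φ.p l))⁻¹

theorem q_mul {l : ℝ} (hl : l ∈ Φ.dom) :
    Φ.q l * (D.eval (evalAt (0, Φ.p l) H) * evalAt (0, Φ.p l) (pderiv 1 H)) = 1 := by
  have h : (disc H D).eval (Φ.p l) ≠ 0 := Φ.good l hl
  have e : D.eval (evalAt (0, Φ.p l) H) * evalAt (0, Φ.p l) (pderiv 1 H) =
      (disc H D).eval (Φ.p l) := by
    rw [disc, Polynomial.eval_mul, Polynomial.eval_comp, eval_onLine, eval_onLine]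
  rw [e, q, inv_mul_cancel₀ h]

theorem yl_zero {l : ℝ} (hl : l ∈ Φ.dom) :
    Φ.yl l 0 = Φ.q l * D.eval (evalAt (0, Φ.p l) H) * Φ.tl l := by
  rw [tl]
  linear_combination (-Φ.yl l 0) * Φ.q_mul hl

end LevelFamily

/-! ### Functions defined simultaneously on all level families -/

/-- Functions of the parameter and the time, defined for all level families at once. -/
abbrev UFun (H : BiPoly ℝ) (D : Polynomial ℝ) : Type := LevelFamily H D → ℝ → ℝ → ℝ

section UFun

variable {H : BiPoly ℝ} {D : Polynomial ℝ} {n : ℕ}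

/-- A polynomial in the coordinates of the moving point. -/
def uEval (f : BiPoly ℝ) : UFun H D := fun Φ l s => evalAt (Φ.path l s) f

/-- A polynomial in the coordinate `p` of the initial point. -/
def uLine (r : Polynomial ℝ) : UFun H D := fun Φ l _ => r.eval (Φ.p l)

/-- The reciprocal of `disc H D` at the initial point. -/
def uQ : UFun H D := fun Φ l _ => Φ.q l

/-- The iterated integral of a word in the basic forms along the path up to the moving point. -/
def uWord (w : List (Fin n × Fin n)) : UFun H D :=
  fun Φ l s => iteratedIntegralTo (Φ.path l) (w.map (basicForm ℝ)) s

theorem uWord_nil : (uWord ([] : List (Fin n × Fin n)) : UFun H D) = 1 := rfl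

/-- The generators `p^a q^b x^c y^e ∫ w` of the spaces of combinations of iterated integrals. -/
def uGen (a b c e : ℕ) (w : List (Fin n × Fin n)) : UFun H D :=
  uLine (Polynomial.X ^ a) * uQ ^ b * uEval (X 0 ^ c * X 1 ^ e) * uWord w

/-- The span of the functions `p^a q^b x^c y^e ∫ w` with `a + b + c + e ≤ m` and words of length at
most `L`. -/
def combSpace (H : BiPoly ℝ) (D : Polynomial ℝ) (n m L : ℕ) : Submodule ℝ (UFun H D) :=
  Submodule.span ℝ {u | ∃ a b c e, ∃ w : List (Fin n × Fin n),
    a + b + c + e ≤ m ∧ w.length ≤ L ∧ u = uGen a b c e w}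

theorem uGen_mem {a b c e m L : ℕ} {w : List (Fin n × Fin n)} (h : a + b + c + e ≤ m)
    (hw : w.length ≤ L) : (uGen a b c e w : UFun H D) ∈ combSpace H D n m L :=
  Submodule.subset_span ⟨a, b, c, e, w, h, hw, rfl⟩

theorem combSpace_mono {m m' L L' : ℕ} (hm : m ≤ m') (hL : L ≤ L') :
    combSpace H D n m L ≤ combSpace H D n m' L' := by
  refine Submodule.span_mono ?_
  rintro _ ⟨a, b, c, e, w, h, hw, rfl⟩
  exact ⟨a, b, c, e, w, h.trans hm, hw.trans hL, rfl⟩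

/-- Multiplication by a fixed function, checked on generators. -/
theorem mul_mem_of_gen {m m' L L' : ℕ} {v : UFun H D}
    (h : ∀ a b c e, ∀ w : List (Fin n × Fin n), a + b + c + e ≤ m → w.length ≤ L →
      v * uGen a b c e w ∈ combSpace H D n m' L') {u : UFun H D}
    (hu : u ∈ combSpace H D n m L) : v * u ∈ combSpace H D n m' L' := by
  have : combSpace H D n m L ≤ (combSpace H D n m' L').comap (LinearMap.mulLeft ℝ v) := by
    rw [combSpace, Submodule.span_le]
    rintro _ ⟨a, b, c, e, w, hm, hw, rfl⟩
    exact h a b c e w hm hw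
  exact this hu

theorem uEval_one : (uEval 1 : UFun H D) = 1 := by
  funext Φ l s; exact evalAt_one _

theorem uLine_one : (uLine 1 : UFun H D) = 1 := by
  funext Φ l s; exact Polynomial.eval_one

theorem uEval_mul_mem {m L d : ℕ} {f : BiPoly ℝ} (hf : f.totalDegree ≤ d) {u : UFun H D}
    (hu : u ∈ combSpace H D n m L) : uEval f * u ∈ combSpace H D n (m + d) L := by
  refine mul_mem_of_gen (fun a b c e w hm hw => ?_) hu
  have hsum : (uEval f : UFun H D) * uGen a b c e w =
      ∑ s ∈ f.support, coeff s f • uGen a b (c + s 0) (e + s 1) w := by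
    funext Φ l t
    simp only [Finset.sum_apply, Pi.smul_apply, Pi.mul_apply, uGen, uEval, smul_eq_mul]
    conv_lhs => rw [evalAt, MvPolynomial.eval_eq']
    rw [Finset.sum_mul]
    refine Finset.sum_congr rfl fun s _ => ?_
    simp only [Fin.prod_univ_two, evalAt, map_mul, map_pow, eval_X]
    ring
  rw [hsum]
  refine sum_mem fun s hs => Submodule.smul_mem _ _ (uGen_mem ?_ hw)
  have := le_totalDegree hs
  rw [finsupp_sum_fin_two] at this
  omega

theorem uLine_mul_mem {m L d : ℕ} {r : Polynomial ℝ} (hr : r.natDegree ≤ d) {u : UFun H D}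
    (hu : u ∈ combSpace H D n m L) : uLine r * u ∈ combSpace H D n (m + d) L := by
  refine mul_mem_of_gen (fun a b c e w hm hw => ?_) hu
  have hsum : (uLine r : UFun H D) * uGen a b c e w =
      ∑ i ∈ Finset.range (r.natDegree + 1), r.coeff i • uGen (a + i) b c e w := by
    funext Φ l t
    simp only [Finset.sum_apply, Pi.smul_apply, Pi.mul_apply, uGen, uLine, smul_eq_mul]
    conv_lhs => rw [Polynomial.eval_eq_sum_range]
    rw [Finset.sum_mul]
    refine Finset.sum_congr rfl fun s _ => ?_
    simp only [Polynomial.eval_pow, Polynomial.eval_X]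
    ring
  rw [hsum]
  refine sum_mem fun i hi => Submodule.smul_mem _ _ (uGen_mem ?_ hw)
  have := Finset.mem_range.1 hi
  omega

theorem uQ_mul_mem {m L : ℕ} {u : UFun H D} (hu : u ∈ combSpace H D n m L) :
    uQ * u ∈ combSpace H D n (m + 1) L := by
  refine mul_mem_of_gen (fun a b c e w hm hw => ?_) hu
  have : (uQ : UFun H D) * uGen a b c e w = uGen a (b + 1) c e w := by
    rw [uGen, uGen, pow_succ]; ring
  rw [this]
  exact uGen_mem (by omega) hw

theorem uWord_mem {L : ℕ} {w : List (Fin n × Fin n)} (hw : w.length ≤ L) :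
    (uWord w : UFun H D) ∈ combSpace H D n 0 L := by
  have : (uWord w : UFun H D) = uGen 0 0 0 0 w := by
    simp [uGen, uLine_one, uEval_one]
  rw [this]
  exact uGen_mem (by omega) hw

theorem one_mem_combSpace (m L : ℕ) : (1 : UFun H D) ∈ combSpace H D n m L := by
  rw [← uWord_nil (n := n)]
  exact combSpace_mono (Nat.zero_le _) le_rfl (uWord_mem (by simp))

theorem uEval_mem {d L : ℕ} {f : BiPoly ℝ} (hf : f.totalDegree ≤ d) :
    (uEval f : UFun H D) ∈ combSpace H D n d L := by
  have := uEval_mul_mem (n := n) (L := L) hf (one_mem_combSpace (H := H) (D := D) 0 L)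
  rwa [zero_add, mul_one] at this

theorem uLine_mem {d L : ℕ} {r : Polynomial ℝ} (hr : r.natDegree ≤ d) :
    (uLine r : UFun H D) ∈ combSpace H D n d L := by
  have := uLine_mul_mem (n := n) (L := L) hr (one_mem_combSpace (H := H) (D := D) 0 L)
  rwa [zero_add, mul_one] at this

/-! ### Continuity and the derivative in time -/

theorem continuousOn_path (Φ : LevelFamily H D) :
    ContinuousOn (fun z : ℝ × ℝ => Φ.path z.1 z.2) (Φ.dom ×ˢ Icc 0 1) :=
  fun z hz => (Φ.smooth z.1 hz.1 z.2 hz.2).continuousAt.continuousWithinAt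

theorem continuousOn_uEval (f : BiPoly ℝ) (Φ : LevelFamily H D) :
    ContinuousOn (fun z : ℝ × ℝ => uEval f Φ z.1 z.2) (Φ.dom ×ˢ Icc 0 1) :=
  (continuous_evalAt f).comp_continuousOn (continuousOn_path Φ)

theorem continuousOn_ds (θ : OneForm ℝ) (Φ : LevelFamily H D) :
    ContinuousOn (fun z : ℝ × ℝ => Φ.ds θ z.1 z.2) (Φ.dom ×ˢ Icc 0 1) :=
  ((continuousOn_uEval θ.1 Φ).mul Φ.mixed_x.cont_right).add
    ((continuousOn_uEval θ.2 Φ).mul Φ.mixed_y.cont_right)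

theorem continuousOn_p (Φ : LevelFamily H D) :
    ContinuousOn (fun z : ℝ × ℝ => Φ.p z.1) (Φ.dom ×ˢ Icc 0 1) :=
  fun _ hz => ((Φ.hasDerivAt_p hz.1).continuousAt.comp continuousAt_fst).continuousWithinAt

theorem continuousOn_uLine (r : Polynomial ℝ) (Φ : LevelFamily H D) :
    ContinuousOn (fun z : ℝ × ℝ => uLine r Φ z.1 z.2) (Φ.dom ×ˢ Icc 0 1) :=
  r.continuous.comp_continuousOn (continuousOn_p Φ)

theorem continuousOn_uQ (Φ : LevelFamily H D) :
    ContinuousOn (fun z : ℝ × ℝ => uQ Φ z.1 z.2) (Φ.dom ×ˢ Icc 0 1) :=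
  (continuousOn_uLine (disc H D) Φ).inv₀ fun _ hz => Φ.good _ hz.1

theorem uWord_cons_eq (i : Fin n × Fin n) (w : List (Fin n × Fin n)) (Φ : LevelFamily H D)
    {l s : ℝ} (hl : l ∈ Φ.dom) (hs : s ∈ Icc (0 : ℝ) 1) :
    uWord (i :: w) Φ l s = ∫ u in (0 : ℝ)..s, uWord w Φ l u * Φ.ds (basicForm ℝ i) l u := by
  refine intervalIntegral.integral_congr fun u hu => ?_
  rw [uIcc_of_le hs.1] at hu
  rw [Φ.pullback_eq hl ⟨hu.1, hu.2.trans hs.2⟩]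
  rfl

theorem continuousOn_uWord (w : List (Fin n × Fin n)) (Φ : LevelFamily H D) :
    ContinuousOn (fun z : ℝ × ℝ => uWord w Φ z.1 z.2) (Φ.dom ×ˢ Icc 0 1) := by
  induction w with
  | nil => exact continuousOn_const
  | cons i w ih =>
    refine (continuousOn_parametric_integral Φ.isOpen_dom (g := fun l u => uWord w Φ l u *
      Φ.ds (basicForm ℝ i) l u) (ih.mul (continuousOn_ds _ Φ))).congr ?_
    rintro ⟨l, s⟩ ⟨hl, hs⟩
    exact uWord_cons_eq i w Φ hl hs

theorem continuousOn_of_mem {m L : ℕ} {u : UFun H D} (hu : u ∈ combSpace H D n m L)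
    (Φ : LevelFamily H D) :
    ContinuousOn (fun z : ℝ × ℝ => u Φ z.1 z.2) (Φ.dom ×ˢ Icc 0 1) := by
  induction hu using Submodule.span_induction with
  | mem u hu =>
    obtain ⟨a, b, c, e, w, -, -, rfl⟩ := hu
    exact (((continuousOn_uLine _ Φ).mul ((continuousOn_uQ Φ).pow b)).mul
      (continuousOn_uEval _ Φ)).mul (continuousOn_uWord w Φ)
  | zero => exact continuousOn_const
  | add u v _ _ hu hv => exact hu.add hv
  | smul c u _ hu => exact hu.const_smul c

theorem ContinuousOn.slice {f : ℝ → ℝ → ℝ} {U : Set ℝ}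
    (hf : ContinuousOn (fun z : ℝ × ℝ => f z.1 z.2) (U ×ˢ Icc 0 1)) {l : ℝ} (hl : l ∈ U) :
    ContinuousOn (f l) (Icc 0 1) :=
  hf.comp (f := fun s => (l, s)) (by fun_prop) fun _ hs => ⟨hl, hs⟩

theorem hasDerivAt_uWord_cons (i : Fin n × Fin n) (w : List (Fin n × Fin n))
    (Φ : LevelFamily H D) {l s : ℝ} (hl : l ∈ Φ.dom) (hs : s ∈ Ioo (0 : ℝ) 1) :
    HasDerivAt (uWord (i :: w) Φ l) (uWord w Φ l s * Φ.ds (basicForm ℝ i) l s) s := by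
  have h := hasDerivAt_integral_of_continuousOn
    (g := fun u => uWord w Φ l u * Φ.ds (basicForm ℝ i) l u)
    (ContinuousOn.slice (f := fun l u => uWord w Φ l u * Φ.ds (basicForm ℝ i) l u)
      ((continuousOn_uWord w Φ).mul (continuousOn_ds _ Φ)) hl) hs
  refine h.congr_of_eventuallyEq ?_
  filter_upwards [isOpen_Ioo.mem_nhds hs] with t ht
  exact uWord_cons_eq i w Φ hl (Ioo_subset_Icc_self ht)

theorem uWord_cons_zero (i : Fin n × Fin n) (w : List (Fin n × Fin n)) (Φ : LevelFamily H D)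
    (l : ℝ) : uWord (i :: w) Φ l 0 = 0 :=
  intervalIntegral.integral_same

end UFun

section Differential

variable {H : BiPoly ℝ} {D : Polynomial ℝ} {n : ℕ}

/-! ### Primitives along the level curves -/

/-- `G` is the integral of `u θ` along the paths, from their initial points. -/
structure IsPrimitive (G u : UFun H D) (θ : OneForm ℝ) : Prop where
  zero : ∀ (Φ : LevelFamily H D), ∀ l ∈ Φ.dom, G Φ l 0 = 0
  right : ∀ (Φ : LevelFamily H D), ∀ l ∈ Φ.dom, ∀ s ∈ Ioo (0 : ℝ) 1,
    HasDerivAt (G Φ l) (u Φ l s * Φ.ds θ l s) s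

theorem isPrimitive_uWord_cons (i : Fin n × Fin n) (w : List (Fin n × Fin n)) :
    IsPrimitive (uWord (i :: w) : UFun H D) (uWord w) (basicForm ℝ i) :=
  ⟨fun Φ l _ => uWord_cons_zero i w Φ l, fun Φ _ hl _ hs => hasDerivAt_uWord_cons i w Φ hl hs⟩

theorem LevelFamily.ds_eq_of_division (Φ : LevelFamily H D) {θ : OneForm ℝ}
    {p : Fin n × Fin n → Polynomial ℝ} {f g : BiPoly ℝ}
    (h1 : θ.1 = basicComb H p + f * pderiv 0 H + pderiv 0 g)
    (h2 : θ.2 = f * pderiv 1 H + pderiv 1 g) {l s : ℝ} (hl : l ∈ Φ.dom)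
    (hs : s ∈ Ioo (0 : ℝ) 1) :
    Φ.ds θ l s = ∑ i, (p i).eval (evalAt (0, Φ.p l) H) * Φ.ds (basicForm ℝ i) l s +
      (evalAt (Φ.path l s) (pderiv 0 g) * Φ.xs l s +
        evalAt (Φ.path l s) (pderiv 1 g) * Φ.ys l s) := by
  have hsum : evalAt (Φ.path l s) (basicComb H p) * Φ.xs l s =
      ∑ i, (p i).eval (evalAt (0, Φ.p l) H) * Φ.ds (basicForm ℝ i) l s := by
    rw [basicComb, evalAt, map_sum, Finset.sum_mul]
    refine Finset.sum_congr rfl fun i _ => ?_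
    change evalAt (Φ.path l s) _ * _ = _
    rw [evalAt_mul, evalAt_aeval, Φ.level_eq hl (Ioo_subset_Icc_self hs)]
    simp only [LevelFamily.ds, basicForm, evalAt_zero]
    ring
  rw [← hsum, LevelFamily.ds, h1, h2]
  simp only [evalAt_add, evalAt_mul]
  linear_combination evalAt (Φ.path l s) f * Φ.ds_extD_eq_zero hl hs

theorem natDegree_comp_onLine_le {m : ℕ} (hH : H.totalDegree = n + 1) {r : Polynomial ℝ}
    (hr : r.natDegree * (n + 1) ≤ m) : (r.comp (onLine H)).natDegree ≤ m := by
  refine (Polynomial.natDegree_comp_le).trans (le_trans ?_ hr)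
  exact Nat.mul_le_mul_left _ ((natDegree_onLine_le H).trans hH.le)

theorem totalDegree_mul_basicForm_le {m : ℕ} {g : BiPoly ℝ} (hg : g.totalDegree ≤ m + 1)
    (i : Fin n × Fin n) :
    (g * (X 0 ^ (i.1 : ℕ) * X 1 ^ ((i.2 : ℕ) + 1))).totalDegree ≤ m + 2 * n := by
  have h1 := totalDegree_mul g (X 0 ^ (i.1 : ℕ) * X 1 ^ ((i.2 : ℕ) + 1))
  have h2 := totalDegree_basicMonomial_succ i
  have := i.1.2
  have := i.2.2
  omega

/-- Integration of `(∫ w) θ`: the form `θ` is divided by the basic forms, `θ ≡ ∑ p_i(H) ω_i + dg`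
modulo `dH`; the first terms give longer words, and the term with `dg` is integrated by parts. -/
theorem exists_primitive_word (hP : PetrovSplitting n H) (hH : H.totalDegree = n + 1) :
    ∀ (w : List (Fin n × Fin n)) (M : ℕ) (θ : OneForm ℝ), θ.1.totalDegree ≤ M →
      θ.2.totalDegree ≤ M →
      ∃ G ∈ combSpace H D n (M + 2 * n * w.length + 1) (w.length + 1),
        IsPrimitive G (uWord w) θ := by
  intro w
  induction w with
  | nil =>
    intro M θ h1 h2
    obtain ⟨p, f, g, hp, hg, hθ1, hθ2⟩ := hP.exists_division hH h1 h2
    refine ⟨fun Φ l s => ∑ i, ((p i).comp (onLine H)).eval (Φ.p l) * uWord [i] Φ l s +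
      evalAt (Φ.path l s) g - (onLine g).eval (Φ.p l), ?_, ⟨?_, ?_⟩⟩
    · have : (fun Φ l s => ∑ i, ((p i).comp (onLine H)).eval (Φ.p l) * uWord [i] Φ l s +
          evalAt (Φ.path l s) g - (onLine g).eval (Φ.p l) : UFun H D) =
          ∑ i, uLine ((p i).comp (onLine H)) * uWord [i] + uEval g - uLine (onLine g) := by
        funext Φ l s
        simp only [Pi.sub_apply, Pi.add_apply, Finset.sum_apply, Pi.mul_apply]
        rfl
      rw [this]
      refine sub_mem (add_mem (sum_mem fun i _ => ?_) ?_) ?_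
      · refine combSpace_mono ?_ le_rfl
          (uLine_mul_mem (natDegree_comp_onLine_le hH (hp i)) (uWord_mem (by simp)))
        omega
      · exact combSpace_mono (by omega) le_rfl (uEval_mem hg)
      · exact combSpace_mono (by omega) le_rfl (uLine_mem ((natDegree_onLine_le g).trans hg))
    · intro Φ l hl
      simp only [uWord_cons_zero, mul_zero, Finset.sum_const_zero, Φ.path_zero hl, eval_onLine]
      ring
    · intro Φ l hl s hs
      rw [Φ.ds_eq_of_division hθ1 hθ2 hl hs]
      have hsum : HasDerivAt
          (fun s => ∑ i, ((p i).comp (onLine H)).eval (Φ.p l) * uWord [i] Φ l s)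
          (∑ i, ((p i).comp (onLine H)).eval (Φ.p l) *
            (uWord [] Φ l s * Φ.ds (basicForm ℝ i) l s)) s :=
        HasDerivAt.fun_sum fun i _ => (hasDerivAt_uWord_cons i [] Φ hl hs).const_mul _
      refine ((hsum.add (Φ.hasDerivAt_evalAt_right hl (Ioo_subset_Icc_self hs) g)).sub_const
        ((onLine g).eval (Φ.p l))).congr_deriv ?_
      simp only [Polynomial.eval_comp, eval_onLine, uWord_nil, Pi.one_apply, one_mul]
  | cons j w ih =>
    intro M θ h1 h2
    obtain ⟨p, f, g, hp, hg, hθ1, hθ2⟩ := hP.exists_division hH h1 h2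
    obtain ⟨G', hG', hG'1⟩ := ih (M + 2 * n)
      (g * (X 0 ^ (j.1 : ℕ) * X 1 ^ ((j.2 : ℕ) + 1)), 0)
      (totalDegree_mul_basicForm_le hg j) (by simp)
    refine ⟨fun Φ l s => ∑ i, ((p i).comp (onLine H)).eval (Φ.p l) * uWord (i :: j :: w) Φ l s +
      evalAt (Φ.path l s) g * uWord (j :: w) Φ l s - G' Φ l s, ?_, ⟨?_, ?_⟩⟩
    · have : (fun Φ l s => ∑ i, ((p i).comp (onLine H)).eval (Φ.p l) *
          uWord (i :: j :: w) Φ l s + evalAt (Φ.path l s) g * uWord (j :: w) Φ l s -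
          G' Φ l s : UFun H D) =
          ∑ i, uLine ((p i).comp (onLine H)) * uWord (i :: j :: w) +
            uEval g * uWord (j :: w) - G' := by
        funext Φ l s
        simp only [Pi.sub_apply, Pi.add_apply, Finset.sum_apply, Pi.mul_apply]
        rfl
      rw [this]
      simp only [List.length_cons, mul_add, mul_one]
      refine sub_mem (add_mem (sum_mem fun i _ => ?_) ?_) ?_
      · refine combSpace_mono ?_ le_rfl
          (uLine_mul_mem (natDegree_comp_onLine_le hH (hp i)) (uWord_mem (by simp)))
        omega
      · exact combSpace_mono (by omega) (Nat.le_succ _) (uEval_mul_mem hg (uWord_mem (by simp)))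
      · exact combSpace_mono (by omega) (by omega) hG'
    · intro Φ l hl
      simp only [uWord_cons_zero, mul_zero, Finset.sum_const_zero, hG'1.zero Φ l hl]
      ring
    · intro Φ l hl s hs
      rw [Φ.ds_eq_of_division hθ1 hθ2 hl hs]
      have hsum : HasDerivAt
          (fun s => ∑ i, ((p i).comp (onLine H)).eval (Φ.p l) * uWord (i :: j :: w) Φ l s)
          (∑ i, ((p i).comp (onLine H)).eval (Φ.p l) *
            (uWord (j :: w) Φ l s * Φ.ds (basicForm ℝ i) l s)) s :=
        HasDerivAt.fun_sum fun i _ => (hasDerivAt_uWord_cons i (j :: w) Φ hl hs).const_mul _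
      refine ((hsum.add ((Φ.hasDerivAt_evalAt_right hl (Ioo_subset_Icc_self hs) g).mul
        (hasDerivAt_uWord_cons j w Φ hl hs))).sub (hG'1.right Φ l hl s hs)).congr_deriv ?_
      simp only [Polynomial.eval_comp, eval_onLine, LevelFamily.ds, basicForm, evalAt_mul,
        evalAt_zero, mul_add, Finset.mul_sum]
      have hc : ∑ i, Polynomial.eval (evalAt (0, Φ.p l) H) (p i) *
          (uWord (j :: w) Φ l s * (evalAt (Φ.path l s) (X 0 ^ (i.1 : ℕ)) *
            evalAt (Φ.path l s) (X 1 ^ ((i.2 : ℕ) + 1)) * Φ.xs l s)) =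
          ∑ i, uWord (j :: w) Φ l s * (Polynomial.eval (evalAt (0, Φ.p l) H) (p i) *
            (evalAt (Φ.path l s) (X 0 ^ (i.1 : ℕ)) *
            evalAt (Φ.path l s) (X 1 ^ ((i.2 : ℕ) + 1)) * Φ.xs l s)) :=
        Finset.sum_congr rfl fun i _ => by ring
      simp only [zero_mul, mul_zero, add_zero]
      rw [hc]
      ring

theorem uQ_pow_mul_mem {m L : ℕ} (b : ℕ) {u : UFun H D} (hu : u ∈ combSpace H D n m L) :
    uQ ^ b * u ∈ combSpace H D n (m + b) L := by
  induction b with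
  | zero => simpa using hu
  | succ b ih =>
    have := uQ_mul_mem ih
    rwa [← mul_assoc, ← pow_succ'] at this

/-- Integration of `u θ` along the level curves, for a combination `u` of iterated integrals. -/
theorem exists_primitive_of_mem (hP : PetrovSplitting n H) (hH : H.totalDegree = n + 1)
    {m L e : ℕ} {u : UFun H D} (hu : u ∈ combSpace H D n m L) {θ : OneForm ℝ}
    (h1 : θ.1.totalDegree ≤ e) (h2 : θ.2.totalDegree ≤ e) :
    ∃ G ∈ combSpace H D n (m + e + 2 * n * L + 1) (L + 1), IsPrimitive G u θ := by
  induction hu using Submodule.span_induction with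
  | mem u hu =>
    obtain ⟨a, b, c, k, w, hm, hw, rfl⟩ := hu
    have hdeg : ∀ f : BiPoly ℝ, f.totalDegree ≤ e →
        (X 0 ^ c * X 1 ^ k * f).totalDegree ≤ c + k + e := by
      intro f hf
      have h3 := totalDegree_mul (X 0 ^ c * X 1 ^ k : BiPoly ℝ) f
      have h4 := totalDegree_mul (X 0 ^ c : BiPoly ℝ) (X 1 ^ k)
      rw [totalDegree_X_pow, totalDegree_X_pow] at h4
      omega
    obtain ⟨G, hG, hG1⟩ := exists_primitive_word (D := D) hP hH w (c + k + e)
      (X 0 ^ c * X 1 ^ k * θ.1, X 0 ^ c * X 1 ^ k * θ.2) (hdeg _ h1) (hdeg _ h2)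
    refine ⟨uLine (Polynomial.X ^ a) * (uQ ^ b * G), ?_, ⟨?_, ?_⟩⟩
    · refine combSpace_mono ?_ (Nat.succ_le_succ hw)
        (uLine_mul_mem (Polynomial.natDegree_X_pow_le a) (uQ_pow_mul_mem b hG))
      have := Nat.mul_le_mul_left (2 * n) hw
      omega
    · intro Φ l hl
      simp only [Pi.mul_apply, hG1.zero Φ l hl, mul_zero]
    · intro Φ l hl s hs
      refine (((hG1.right Φ l hl s hs).const_mul (Φ.q l ^ b)).const_mul
        ((Polynomial.X ^ a : Polynomial ℝ).eval (Φ.p l))).congr_deriv ?_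
      simp only [uGen, uLine, uQ, uEval, Pi.mul_apply, Pi.pow_apply, LevelFamily.ds, evalAt_mul]
      ring
  | zero =>
    refine ⟨0, Submodule.zero_mem _, ⟨fun Φ l hl => rfl, fun Φ l hl s hs => ?_⟩⟩
    exact (hasDerivAt_const s (0 : ℝ)).congr_deriv (by simp)
  | add u v _ _ hu hv =>
    obtain ⟨G, hG, hG1⟩ := hu
    obtain ⟨G', hG', hG'1⟩ := hv
    refine ⟨G + G', add_mem hG hG', ⟨fun Φ l hl => ?_, fun Φ l hl s hs => ?_⟩⟩
    · simp [hG1.zero Φ l hl, hG'1.zero Φ l hl]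
    · exact ((hG1.right Φ l hl s hs).add (hG'1.right Φ l hl s hs)).congr_deriv (by simp; ring)
  | smul c u _ hu =>
    obtain ⟨G, hG, hG1⟩ := hu
    refine ⟨c • G, Submodule.smul_mem _ _ hG, ⟨fun Φ l hl => ?_, fun Φ l hl s hs => ?_⟩⟩
    · simp [hG1.zero Φ l hl]
    · exact ((hG1.right Φ l hl s hs).const_mul c).congr_deriv (by simp; ring)

/-! ### Differentials -/

/-- The differential of `R` is `α dx + β dy + κ dH`, in the time and in the parameter. Along a path
`dH` vanishes; in the parameter it is the derivative `tl` of the level. -/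
structure HasDifferential (R α β κ : UFun H D) : Prop where
  right : ∀ (Φ : LevelFamily H D), ∀ l ∈ Φ.dom, ∀ s ∈ Ioo (0 : ℝ) 1,
    HasDerivAt (R Φ l) (α Φ l s * Φ.xs l s + β Φ l s * Φ.ys l s) s
  left : ∀ (Φ : LevelFamily H D), ∀ l ∈ Φ.dom, ∀ s ∈ Icc (0 : ℝ) 1,
    HasDerivAt (fun l => R Φ l s)
      (α Φ l s * Φ.xl l s + β Φ l s * Φ.yl l s + κ Φ l s * Φ.tl l) l

theorem HasDifferential.mul {R α β κ R' α' β' κ' : UFun H D} (h : HasDifferential R α β κ)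
    (h' : HasDifferential R' α' β' κ') :
    HasDifferential (R * R') (α * R' + R * α') (β * R' + R * β') (κ * R' + R * κ') := by
  constructor
  · intro Φ l hl s hs
    refine ((h.right Φ l hl s hs).mul (h'.right Φ l hl s hs)).congr_deriv ?_
    simp only [Pi.add_apply, Pi.mul_apply]; ring
  · intro Φ l hl s hs
    refine ((h.left Φ l hl s hs).mul (h'.left Φ l hl s hs)).congr_deriv ?_
    simp only [Pi.add_apply, Pi.mul_apply]; ring

theorem HasDifferential.add {R α β κ R' α' β' κ' : UFun H D} (h : HasDifferential R α β κ)
    (h' : HasDifferential R' α' β' κ') :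
    HasDifferential (R + R') (α + α') (β + β') (κ + κ') := by
  constructor
  · intro Φ l hl s hs
    refine ((h.right Φ l hl s hs).add (h'.right Φ l hl s hs)).congr_deriv ?_
    simp only [Pi.add_apply]; ring
  · intro Φ l hl s hs
    refine ((h.left Φ l hl s hs).add (h'.left Φ l hl s hs)).congr_deriv ?_
    simp only [Pi.add_apply]; ring

theorem HasDifferential.smul {R α β κ : UFun H D} (c : ℝ) (h : HasDifferential R α β κ) :
    HasDifferential (c • R) (c • α) (c • β) (c • κ) := by
  constructor
  · intro Φ l hl s hs
    refine ((h.right Φ l hl s hs).const_mul c).congr_deriv ?_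
    simp only [Pi.smul_apply, smul_eq_mul]; ring
  · intro Φ l hl s hs
    refine ((h.left Φ l hl s hs).const_mul c).congr_deriv ?_
    simp only [Pi.smul_apply, smul_eq_mul]; ring

theorem hasDifferential_const (c : ℝ) : HasDifferential (fun _ _ _ => c : UFun H D) 0 0 0 := by
  constructor
  · intro Φ l hl s hs
    exact (hasDerivAt_const s c).congr_deriv (by simp)
  · intro Φ l hl s hs
    exact (hasDerivAt_const l c).congr_deriv (by simp)

theorem hasDifferential_uEval (f : BiPoly ℝ) :
    HasDifferential (uEval f : UFun H D) (uEval (pderiv 0 f)) (uEval (pderiv 1 f)) 0 := by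
  constructor
  · intro Φ l hl s hs
    exact Φ.hasDerivAt_evalAt_right hl (Ioo_subset_Icc_self hs) f
  · intro Φ l hl s hs
    refine (Φ.hasDerivAt_evalAt_left hl hs f).congr_deriv ?_
    simp [uEval]

/-- The derivative of `p` with respect to the value of `H`, that is, `1 / H_y(0, p)`, written as
`D(H(0, p))` times the reciprocal of `disc H D`. -/
def uSlope (H : BiPoly ℝ) (D : Polynomial ℝ) : UFun H D := uQ * uLine (D.comp (onLine H))

theorem hasDerivAt_p' (Φ : LevelFamily H D) {l : ℝ} (hl : l ∈ Φ.dom) (s : ℝ) :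
    HasDerivAt Φ.p (uSlope H D Φ l s * Φ.tl l) l := by
  refine (Φ.hasDerivAt_p hl).congr_deriv ?_
  rw [Φ.yl_zero hl]
  simp only [uSlope, Pi.mul_apply, uQ, uLine, Polynomial.eval_comp, eval_onLine]

theorem hasDifferential_uLine (r : Polynomial ℝ) :
    HasDifferential (uLine r : UFun H D) 0 0 (uLine r.derivative * uSlope H D) := by
  constructor
  · intro Φ l hl s hs
    exact (hasDerivAt_const s _).congr_deriv (by simp)
  · intro Φ l hl s hs
    refine ((r.hasDerivAt (Φ.p l)).comp l (hasDerivAt_p' Φ hl s)).congr_deriv ?_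
    simp only [Pi.zero_apply, Pi.mul_apply, uLine]
    ring

theorem hasDifferential_uQ_pow (b : ℕ) :
    HasDifferential (uQ ^ b : UFun H D) 0 0
      ((-b : ℝ) • (uQ ^ (b + 1) * (uLine (disc H D).derivative * uSlope H D))) := by
  constructor
  · intro Φ l hl s hs
    refine (hasDerivAt_const s (Φ.q l ^ b)).congr_deriv ?_
    simp only [Pi.zero_apply]
    ring
  · intro Φ l hl s hs
    have h0 : (disc H D).eval (Φ.p l) ≠ 0 := Φ.good l hl
    refine (((((disc H D).hasDerivAt (Φ.p l)).comp l (hasDerivAt_p' Φ hl s)).inv h0).pow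
      b).congr_deriv ?_
    simp only [Pi.zero_apply, Pi.mul_apply, Pi.smul_apply, Pi.pow_apply, uLine, uQ,
      LevelFamily.q, Function.comp_apply, Pi.inv_apply, smul_eq_mul, div_eq_mul_inv, ← inv_pow]
    rcases b with _ | b
    · simp
    · rw [Nat.add_sub_cancel]
      ring

theorem hasDifferential_uWord_nil :
    HasDifferential (uWord ([] : List (Fin n × Fin n)) : UFun H D) 0 0 0 :=
  hasDifferential_const 1

end Differential

/-! ### Differentiation with respect to the level -/

section Closedness

variable {H : BiPoly ℝ} {D : Polynomial ℝ} {n : ℕ}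

theorem uSlope_mul_mem (hH : H.totalDegree = n + 1) (hD : D.natDegree ≤ n ^ 2) {m L : ℕ}
    {u : UFun H D} (hu : u ∈ combSpace H D n m L) :
    uSlope H D * u ∈ combSpace H D n (m + n ^ 2 * (n + 1) + 1) L := by
  rw [uSlope, mul_assoc]
  exact uQ_mul_mem (uLine_mul_mem
    (natDegree_comp_onLine_le hH (Nat.mul_le_mul_right _ hD)) hu)

theorem natDegree_disc_le (hH : H.totalDegree = n + 1) (hD : D.natDegree ≤ n ^ 2) :
    (disc H D).natDegree ≤ n ^ 2 * (n + 1) + n :=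
  Polynomial.natDegree_mul_le.trans (add_le_add
    (natDegree_comp_onLine_le hH (Nat.mul_le_mul_right _ hD))
    ((natDegree_onLine_le _).trans (totalDegree_pderiv_le' hH 1)))

/-- The restriction of a combination of iterated integrals to the initial points of the paths is a
polynomial in `p` and `q`. -/
theorem exists_init_of_mem {m L : ℕ} {u : UFun H D} (hu : u ∈ combSpace H D n m L) :
    ∃ u₀ ∈ combSpace H D n m 0, ∀ (Φ : LevelFamily H D), ∀ l ∈ Φ.dom, ∀ s,
      u₀ Φ l s = u Φ l 0 := by
  induction hu using Submodule.span_induction with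
  | mem u hu =>
    obtain ⟨a, b, c, e, w, hm, hw, rfl⟩ := hu
    rcases w with _ | ⟨i, w⟩
    · rcases c with _ | c
      · refine ⟨uGen (a + e) b 0 0 [], uGen_mem (by omega) (by simp), fun Φ l hl s => ?_⟩
        simp only [uGen, uLine, uQ, uEval, uWord_nil, Pi.mul_apply, Pi.pow_apply, Pi.one_apply,
          Φ.path_zero hl]
        simp [evalAt, pow_add]
        ring
      · refine ⟨0, Submodule.zero_mem _, fun Φ l hl s => ?_⟩
        simp only [uGen, uLine, uQ, uEval, uWord_nil, Pi.mul_apply, Pi.pow_apply, Pi.one_apply,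
          Φ.path_zero hl]
        simp [evalAt]
    · refine ⟨0, Submodule.zero_mem _, fun Φ l hl s => ?_⟩
      simp only [uGen, Pi.mul_apply, uWord_cons_zero, mul_zero, Pi.zero_apply]
  | zero => exact ⟨0, Submodule.zero_mem _, fun Φ l hl s => rfl⟩
  | add u v _ _ hu hv =>
    obtain ⟨u', hu', hu'1⟩ := hu
    obtain ⟨v', hv', hv'1⟩ := hv
    exact ⟨u' + v', add_mem hu' hv', fun Φ l hl s => by
      simp only [Pi.add_apply, hu'1 Φ l hl s, hv'1 Φ l hl s]⟩
  | smul c u _ hu =>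
    obtain ⟨u', hu', hu'1⟩ := hu
    exact ⟨c • u', Submodule.smul_mem _ _ hu', fun Φ l hl s => by
      simp only [Pi.smul_apply, hu'1 Φ l hl s]⟩

theorem IsPrimitive.eq_integral {m L m' L' : ℕ} {G u : UFun H D} {θ : OneForm ℝ}
    (h : IsPrimitive G u θ) (hG : G ∈ combSpace H D n m L) (hu : u ∈ combSpace H D n m' L')
    (Φ : LevelFamily H D) {l s : ℝ} (hl : l ∈ Φ.dom) (hs : s ∈ Icc (0 : ℝ) 1) :
    G Φ l s = ∫ t in (0 : ℝ)..s, u Φ l t * Φ.ds θ l t := by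
  have hsub : Icc 0 s ⊆ Icc (0 : ℝ) 1 := Icc_subset_Icc le_rfl hs.2
  have hc : ContinuousOn (fun t => u Φ l t * Φ.ds θ l t) (Icc 0 1) :=
    ContinuousOn.slice (f := fun l t => u Φ l t * Φ.ds θ l t)
      ((continuousOn_of_mem hu Φ).mul (continuousOn_ds θ Φ)) hl
  rw [intervalIntegral.integral_eq_sub_of_hasDerivAt_of_le hs.1
    ((ContinuousOn.slice (continuousOn_of_mem hG Φ) hl).mono hsub)
    (fun t ht => h.right Φ l hl t ⟨ht.1, ht.2.trans_le hs.2⟩)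
    ((hc.mono hsub).intervalIntegrable_of_Icc hs.1), h.zero Φ l hl, sub_zero]

/-- `D(H) = a H_x + b H_y`, with the degree bounds that hold for a polynomial `H` of degree `n + 1`
whose Milnor algebra has dimension `n ^ 2`. -/
structure IsDiscriminant (n : ℕ) (H : BiPoly ℝ) (D : Polynomial ℝ) (a b : BiPoly ℝ) : Prop where
  natDegree_le : D.natDegree ≤ n ^ 2
  degree_left : a.totalDegree ≤ n ^ 2 * (n + 1)
  degree_right : b.totalDegree ≤ n ^ 2 * (n + 1)
  eq : Polynomial.aeval H D = a * pderiv 0 H + b * pderiv 1 H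

/-- The Jacobian determinant of a level family, expressed by a one-form along the paths: since
`H_x x' + H_y y'` vanishes in the time and equals `tl` in the parameter, the identity
`D(H) = a H_x + b H_y` gives `D(H) dx ∧ dy = dH ∧ (a dy - b dx)`. -/
theorem LevelFamily.jacobian_eq {a b : BiPoly ℝ} (hD : IsDiscriminant n H D a b)
    (Φ : LevelFamily H D) {l s : ℝ} (hl : l ∈ Φ.dom) (hs : s ∈ Ioo (0 : ℝ) 1) :
    Φ.xl l s * Φ.ys l s - Φ.yl l s * Φ.xs l s =
      Φ.tl l * (Φ.q l * evalAt (0, Φ.p l) (pderiv 1 H) * Φ.ds (-b, a) l s) := by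
  have h1 := Φ.ds_extD_eq_zero hl hs
  have h2 := Φ.dl_extD_eq hl (Ioo_subset_Icc_self hs)
  have h3 := Φ.q_mul hl
  have h4 : D.eval (evalAt (0, Φ.p l) H) =
      evalAt (Φ.path l s) a * evalAt (Φ.path l s) (pderiv 0 H) +
        evalAt (Φ.path l s) b * evalAt (Φ.path l s) (pderiv 1 H) := by
    rw [← Φ.level_eq hl (Ioo_subset_Icc_self hs), ← evalAt_aeval, hD.eq, evalAt_add, evalAt_mul,
      evalAt_mul]
  have h5 : D.eval (evalAt (0, Φ.p l) H) * (Φ.xl l s * Φ.ys l s - Φ.yl l s * Φ.xs l s) =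
      Φ.tl l * Φ.ds (-b, a) l s := by
    have e : evalAt (Φ.path l s) (-b) = - evalAt (Φ.path l s) b := by simp [evalAt]
    rw [h4, LevelFamily.ds, e]
    linear_combination (evalAt (Φ.path l s) a * Φ.ys l s - evalAt (Φ.path l s) b * Φ.xs l s) * h2
      + (-evalAt (Φ.path l s) a * Φ.yl l s + evalAt (Φ.path l s) b * Φ.xl l s) * h1
  linear_combination (Φ.q l * evalAt (0, Φ.p l) (pderiv 1 H)) * h5 -
    (Φ.xl l s * Φ.ys l s - Φ.yl l s * Φ.xs l s) * h3

theorem continuousOn_tl (Φ : LevelFamily H D) : ContinuousOn Φ.tl Φ.dom := by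
  refine ContinuousOn.mul ?_ ?_
  · exact (continuous_evalAt _).comp_continuousOn (continuousOn_const.prodMk
      fun l hl => (Φ.hasDerivAt_p hl).continuousAt.continuousWithinAt)
  · exact Φ.mixed_y.cont_left.comp (f := fun l => (l, (0 : ℝ))) (by fun_prop)
      fun l hl => ⟨hl, LevelFamily.zero_mem⟩

/-- The Gelfand–Leray derivative of iterated integrals: the integral of `u θ`
over the paths is differentiated in the parameter, and its derivative is `u θ` evaluated on the
end of the path, plus a combination of iterated integrals times the derivative of the level. -/
theorem exists_derivative_of_primitive (hP : PetrovSplitting n H) (hH : H.totalDegree = n + 1)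
    (hn : 1 ≤ n) {a b : BiPoly ℝ} (hD : IsDiscriminant n H D a b) {m L e k : ℕ}
    (hk : 6 * n ^ 3 ≤ k) {u α β κ : UFun H D} (hu : u ∈ combSpace H D n m L)
    (hα : α ∈ combSpace H D n (m + 2 * n) L) (hβ : β ∈ combSpace H D n (m + 2 * n) L)
    (hκ : κ ∈ combSpace H D n (m + k) L) (hd : HasDifferential u α β κ) {θ : OneForm ℝ}
    (h1 : θ.1.totalDegree ≤ e) (h2 : θ.2.totalDegree ≤ e) :
    ∃ v ∈ combSpace H D n (m + e + k + 2 * n * L + 1) (L + 1),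
      ∀ (G : UFun H D) (m' L' : ℕ), G ∈ combSpace H D n m' L' → IsPrimitive G u θ →
      ∀ (Φ : LevelFamily H D), ∀ l ∈ Φ.dom, ∀ s ∈ Icc (0 : ℝ) 1,
        HasDerivAt (fun l => G Φ l s) (u Φ l s * Φ.dl θ l s + v Φ l s * Φ.tl l) l := by
  obtain ⟨v₁, hv₁, hv₁p⟩ := exists_primitive_of_mem hP hH hκ h1 h2
  obtain ⟨u₀, hu₀, hu₀v⟩ := exists_init_of_mem hu
  set ρ : UFun H D := uEval θ.2 * α - uEval θ.1 * β + uEval (pderiv 0 θ.2 - pderiv 1 θ.1) * u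
    with hρ
  have hρm : ρ ∈ combSpace H D n (m + 2 * n + e) L := by
    refine add_mem (sub_mem (uEval_mul_mem h2 hα) (uEval_mul_mem h1 hβ)) ?_
    refine combSpace_mono (by omega) le_rfl (uEval_mul_mem (d := e) ?_ hu)
    refine (totalDegree_sub _ _).trans (max_le ?_ ?_)
    · exact (totalDegree_pderiv_le 0 θ.2).trans (by omega)
    · exact (totalDegree_pderiv_le 1 θ.1).trans (by omega)
  obtain ⟨v₂, hv₂, hv₂p⟩ := exists_primitive_of_mem hP hH
    (uQ_mul_mem (uLine_mul_mem ((natDegree_onLine_le (pderiv 1 H)).trans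
      (totalDegree_pderiv_le' hH 1)) hρm)) (θ := (-b, a)) (e := n ^ 2 * (n + 1))
      (by simpa using hD.degree_right) hD.degree_left
  have hn3 : n ^ 2 * (n + 1) + 2 * n + n + 1 ≤ 6 * n ^ 3 := by
    have e1 : n ^ 3 = n * n ^ 2 := by ring
    have e2 : n ^ 2 = n * n := by ring
    have : n * 1 ≤ n * n := Nat.mul_le_mul_left n hn
    have : n ^ 2 * 1 ≤ n ^ 2 * n := Nat.mul_le_mul_left _ hn
    nlinarith
  set w : UFun H D := uSlope H D * (uLine (onLine θ.2) * u₀) with hw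
  have hwm : w ∈ combSpace H D n (m + e + n ^ 2 * (n + 1) + 1) 0 :=
    uSlope_mul_mem hH hD.natDegree_le (uLine_mul_mem ((natDegree_onLine_le _).trans h2) hu₀)
  refine ⟨v₁ + v₂ - w, sub_mem (add_mem ?_ ?_) ?_, ?_⟩
  · exact combSpace_mono (by omega) le_rfl hv₁
  · exact combSpace_mono (by omega) le_rfl hv₂
  · exact combSpace_mono (by omega) (by omega) hwm
  intro G m' L' hG hGp Φ l hl s hs
  have hx := Φ.mixed_x
  have hy := Φ.mixed_y
  -- the derivative of the density `u θ(∂_s)` in the parameter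
  set g' : ℝ → ℝ → ℝ := fun l t =>
    (α Φ l t * Φ.xl l t + β Φ l t * Φ.yl l t + κ Φ l t * Φ.tl l) * Φ.ds θ l t + u Φ l t *
      (((uEval (pderiv 0 θ.1) Φ l t * Φ.xl l t + uEval (pderiv 1 θ.1) Φ l t * Φ.yl l t) *
          Φ.xs l t + uEval θ.1 Φ l t * Φ.xls l t) +
        ((uEval (pderiv 0 θ.2) Φ l t * Φ.xl l t + uEval (pderiv 1 θ.2) Φ l t * Φ.yl l t) *
          Φ.ys l t + uEval θ.2 Φ l t * Φ.yls l t)) with hg'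
  have htl : ContinuousOn (fun z : ℝ × ℝ => Φ.tl z.1) (Φ.dom ×ˢ Icc 0 1) :=
    (continuousOn_tl Φ).comp continuousOn_fst fun z hz => hz.1
  have hg'c : ContinuousOn (fun z : ℝ × ℝ => g' z.1 z.2) (Φ.dom ×ˢ Icc 0 1) := by
    have c := fun (f : BiPoly ℝ) => continuousOn_uEval f Φ
    refine ContinuousOn.add (ContinuousOn.mul (ContinuousOn.add (ContinuousOn.add
      ((continuousOn_of_mem hα Φ).mul hx.cont_left) ((continuousOn_of_mem hβ Φ).mul hy.cont_left))
      ((continuousOn_of_mem hκ Φ).mul htl)) (continuousOn_ds θ Φ))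
      ((continuousOn_of_mem hu Φ).mul ?_)
    refine ContinuousOn.add (ContinuousOn.add (ContinuousOn.mul (ContinuousOn.add
      ((c _).mul hx.cont_left) ((c _).mul hy.cont_left)) hx.cont_right)
      ((c _).mul hx.cont_mixed)) (ContinuousOn.add (ContinuousOn.mul (ContinuousOn.add
      ((c _).mul hx.cont_left) ((c _).mul hy.cont_left)) hy.cont_right)
      ((c _).mul hy.cont_mixed))
  have hD1 : HasDerivAt (fun l => ∫ t in (0 : ℝ)..s, u Φ l t * Φ.ds θ l t)
      (∫ t in (0 : ℝ)..s, g' l t) l := by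
    refine hasDerivAt_parametric_integral Φ.isOpen_dom
      (g := fun l t => u Φ l t * Φ.ds θ l t) (g' := g')
      ((continuousOn_of_mem hu Φ).mul (continuousOn_ds θ Φ)) hg'c ?_ hl hs
    intro l hl t ht
    exact (hd.left Φ l hl t ht).mul
      (((Φ.hasDerivAt_evalAt_left hl ht θ.1).mul (hx.mixed_left l hl t ht)).add
        ((Φ.hasDerivAt_evalAt_left hl ht θ.2).mul (hy.mixed_left l hl t ht)))
  -- the same density, integrated in time by means of `jacobian_eq`
  set R : ℝ → ℝ := fun t => u Φ l t * Φ.dl θ l t + (v₁ Φ l t + v₂ Φ l t) * Φ.tl l with hR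
  have hsub : Icc 0 s ⊆ Icc (0 : ℝ) 1 := Icc_subset_Icc le_rfl hs.2
  have hsl := fun {f : ℝ → ℝ → ℝ}
    (hf : ContinuousOn (fun z : ℝ × ℝ => f z.1 z.2) (Φ.dom ×ˢ Icc 0 1)) =>
    (ContinuousOn.slice hf hl).mono hsub
  have hRc : ContinuousOn R (Icc 0 s) := by
    refine ((hsl (continuousOn_of_mem hu Φ)).mul (ContinuousOn.add
      ((hsl (continuousOn_uEval θ.1 Φ)).mul (hsl hx.cont_left))
      ((hsl (continuousOn_uEval θ.2 Φ)).mul (hsl hy.cont_left)))).add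
      (((hsl (continuousOn_of_mem hv₁ Φ)).add (hsl (continuousOn_of_mem hv₂ Φ))).mul
        continuousOn_const)
  have hRd : ∀ t ∈ Ioo 0 s, HasDerivAt R (g' l t) t := by
    intro t ht
    have ht1 : t ∈ Ioo (0 : ℝ) 1 := ⟨ht.1, ht.2.trans_le hs.2⟩
    have ht2 := Ioo_subset_Icc_self ht1
    refine (((hd.right Φ l hl t ht1).mul
      (((Φ.hasDerivAt_evalAt_right hl ht2 θ.1).mul (hx.mixed_right l hl t ht2)).add
        ((Φ.hasDerivAt_evalAt_right hl ht2 θ.2).mul (hy.mixed_right l hl t ht2)))).add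
      (((hv₁p.right Φ l hl t ht1).add (hv₂p.right Φ l hl t ht1)).mul_const (Φ.tl l))).congr_deriv ?_
    have hj := Φ.jacobian_eq hD hl ht1
    have hr : ρ Φ l t = evalAt (Φ.path l t) θ.2 * α Φ l t - evalAt (Φ.path l t) θ.1 * β Φ l t +
        (evalAt (Φ.path l t) (pderiv 0 θ.2) - evalAt (Φ.path l t) (pderiv 1 θ.1)) * u Φ l t := by
      simp only [hρ, Pi.add_apply, Pi.sub_apply, Pi.mul_apply, uEval]
      congr 2
      simp [evalAt]
    have hQ : uQ Φ l t * (uLine (onLine (pderiv 1 H)) Φ l t * ρ Φ l t) * Φ.ds (-b, a) l t *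
        Φ.tl l = ρ Φ l t * (Φ.xl l t * Φ.ys l t - Φ.yl l t * Φ.xs l t) := by
      rw [hj]
      simp only [uQ, uLine, eval_onLine]
      ring
    simp only [Pi.mul_apply]
    rw [add_mul (κ Φ l t * Φ.ds θ l t), hQ, hr]
    simp only [hg', uEval, LevelFamily.ds, Pi.add_apply, Pi.mul_apply]
    ring
  have hint : ∫ t in (0 : ℝ)..s, g' l t = R s - R 0 :=
    intervalIntegral.integral_eq_sub_of_hasDerivAt_of_le hs.1 hRc hRd
      ((hsl hg'c).intervalIntegrable_of_Icc hs.1)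
  rw [hint] at hD1
  refine (hD1.congr_of_eventuallyEq ?_).congr_deriv ?_
  · filter_upwards [Φ.isOpen_dom.mem_nhds hl] with l' hl'
    exact hGp.eq_integral hG hu Φ hl' hs
  · have hR0 : R 0 = w Φ l s * Φ.tl l := by
      simp only [hR, hw, hv₁p.zero Φ l hl, hv₂p.zero Φ l hl, LevelFamily.dl, Φ.xl_zero hl,
        Φ.yl_zero hl, Φ.path_zero hl, Pi.mul_apply, uSlope, uLine, uQ, hu₀v Φ l hl s,
        eval_onLine, Polynomial.eval_comp]
      ring
    rw [hR0]
    simp only [hR, Pi.add_apply, Pi.sub_apply]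
    ring

end Closedness

/-! ### The algorithm and its degrees -/

section Iteration

variable {H : BiPoly ℝ} {D : Polynomial ℝ} {n : ℕ}

/-- A bound for the growth of the degrees when iterated integrals of length `L` are
differentiated. -/
def diffBound (n L : ℕ) : ℕ := 10 * n ^ 3 * (L + 1) ^ 2

theorem le_diffBound (n L : ℕ) : 6 * n ^ 3 ≤ diffBound n L := by
  have : 1 ≤ (L + 1) ^ 2 := Nat.one_le_pow _ _ (Nat.succ_pos L)
  have := Nat.mul_le_mul_left (10 * n ^ 3) this
  rw [diffBound]
  omega

theorem le_cube {n : ℕ} (hn : 1 ≤ n) : n ≤ n ^ 3 ∧ n ^ 2 ≤ n ^ 3 ∧ 1 ≤ n ^ 3 ∧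
    n ^ 2 * (n + 1) ≤ 2 * n ^ 3 := by
  have e : n ^ 2 * (n + 1) = n ^ 3 + n ^ 2 := by ring
  have h1 : n ^ 1 ≤ n ^ 3 := Nat.pow_le_pow_right hn (by norm_num)
  rw [pow_one] at h1
  have h2 : n ^ 2 ≤ n ^ 3 := Nat.pow_le_pow_right hn (by norm_num)
  omega

theorem diffBound_succ (hn : 1 ≤ n) (L : ℕ) :
    diffBound n L + 2 * n * L + 2 * n + 1 ≤ diffBound n (L + 1) := by
  obtain ⟨h1, -, h2, -⟩ := le_cube hn
  have e : diffBound n (L + 1) = diffBound n L + 20 * (n ^ 3 * L) + 30 * n ^ 3 := by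
    simp only [diffBound]; ring
  have := Nat.mul_le_mul_right L h1
  rw [e, mul_assoc 2 n L]
  omega

theorem diffBound_mono {L L' : ℕ} (h : L ≤ L') : diffBound n L ≤ diffBound n L' :=
  Nat.mul_le_mul_left _ (Nat.pow_le_pow_left (by omega) 2)

/-- Iterated integrals of basic forms have differentials with coefficients of the same kind. -/
theorem exists_differential_uWord (hP : PetrovSplitting n H) (hH : H.totalDegree = n + 1)
    (hn : 1 ≤ n) {a b : BiPoly ℝ} (hD : IsDiscriminant n H D a b) (w : List (Fin n × Fin n)) :
    ∃ α ∈ combSpace H D n (2 * n) w.length, ∃ β ∈ combSpace H D n (2 * n) w.length,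
      ∃ κ ∈ combSpace H D n (diffBound n w.length) w.length,
        HasDifferential (uWord w) α β κ := by
  induction w with
  | nil =>
    exact ⟨0, Submodule.zero_mem _, 0, Submodule.zero_mem _, 0, Submodule.zero_mem _,
      hasDifferential_uWord_nil⟩
  | cons i w ih =>
    obtain ⟨α, hα, β, hβ, κ, hκ, hd⟩ := ih
    have hdeg : (basicForm ℝ i).1.totalDegree ≤ 2 * n := by
      have := totalDegree_basicMonomial_succ i
      have := i.1.2
      have := i.2.2
      simp only [basicForm]
      omega
    obtain ⟨v, hv, hv1⟩ := exists_derivative_of_primitive hP hH hn hD (m := 0) (L := w.length)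
      (le_diffBound n w.length) (uWord_mem le_rfl) (by simpa using hα) (by simpa using hβ)
      (by simpa using hκ) hd (θ := basicForm ℝ i) hdeg (by simp [basicForm])
    refine ⟨uEval (basicForm ℝ i).1 * uWord w, ?_, 0, Submodule.zero_mem _, v, ?_, ?_, ?_⟩
    · exact combSpace_mono (by omega) (Nat.le_succ _) (uEval_mul_mem hdeg (uWord_mem le_rfl))
    · refine combSpace_mono ?_ le_rfl hv
      have := diffBound_succ hn w.length
      rw [List.length_cons]
      omega
    · intro Φ l hl s hs
      refine (hasDerivAt_uWord_cons i w Φ hl hs).congr_deriv ?_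
      simp only [LevelFamily.ds, basicForm, evalAt_zero, Pi.mul_apply, Pi.zero_apply, uEval]
      ring
    · intro Φ l hl s hs
      refine (hv1 (uWord (i :: w)) 0 (w.length + 1) (uWord_mem le_rfl)
        (isPrimitive_uWord_cons i w) Φ l hl s hs).congr_deriv ?_
      simp only [LevelFamily.dl, basicForm, evalAt_zero, Pi.mul_apply, Pi.zero_apply, uEval]
      ring

theorem HasDifferential.congr {R R' α α' β β' κ κ' : UFun H D} (h : HasDifferential R α β κ)
    (hR : R = R') (hα : α = α') (hβ : β = β') (hκ : κ = κ') : HasDifferential R' α' β' κ' := by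
  subst hR hα hβ hκ
  exact h

/-- The differential of the factor `p^a q^b` of a generator. -/
theorem exists_differential_line (hn : 1 ≤ n) (hH : H.totalDegree = n + 1)
    (hD : D.natDegree ≤ n ^ 2) (a b : ℕ) : ∃ κ : UFun H D,
      HasDifferential (uLine (Polynomial.X ^ a) * uQ ^ b : UFun H D) 0 0 κ ∧
      ∀ (m L : ℕ) (u : UFun H D), u ∈ combSpace H D n m L →
        κ * u ∈ combSpace H D n (a + b + m + 7 * n ^ 3) L := by
  refine ⟨_, ((hasDifferential_uLine (Polynomial.X ^ a)).mul
    (hasDifferential_uQ_pow b)).congr rfl (by simp) (by simp) rfl, fun m L u hu => ?_⟩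
  obtain ⟨h1, h2, h3, h4⟩ := le_cube hn
  have ha : (Polynomial.X ^ a : Polynomial ℝ).natDegree ≤ a := Polynomial.natDegree_X_pow_le a
  have ha' : (Polynomial.derivative (Polynomial.X ^ a : Polynomial ℝ)).natDegree ≤ a :=
    (Polynomial.natDegree_derivative_le _).trans (by omega)
  have hb' : (Polynomial.derivative (disc H D)).natDegree ≤ 3 * n ^ 3 :=
    (Polynomial.natDegree_derivative_le _).trans
      (by have := natDegree_disc_le hH hD; omega)
  rw [add_mul]
  refine add_mem ?_ ?_
  · have := uLine_mul_mem ha' (uSlope_mul_mem hH hD (uQ_pow_mul_mem b hu))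
    rw [← mul_assoc, ← mul_assoc] at this
    exact combSpace_mono (by omega) le_rfl this
  · have := uLine_mul_mem ha (uQ_pow_mul_mem (b + 1) (uLine_mul_mem hb' (uSlope_mul_mem hH hD hu)))
    rw [mul_smul_comm, smul_mul_assoc]
    refine Submodule.smul_mem _ _ ?_
    simp only [mul_assoc]
    exact combSpace_mono (by omega) le_rfl this

theorem exists_differential_of_mem (hP : PetrovSplitting n H) (hH : H.totalDegree = n + 1)
    (hn : 1 ≤ n) {a b : BiPoly ℝ} (hD : IsDiscriminant n H D a b) {m L : ℕ} {u : UFun H D}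
    (hu : u ∈ combSpace H D n m L) :
    ∃ α ∈ combSpace H D n (m + 2 * n) L, ∃ β ∈ combSpace H D n (m + 2 * n) L,
      ∃ κ ∈ combSpace H D n (m + (diffBound n L + 7 * n ^ 3)) L, HasDifferential u α β κ := by
  induction hu using Submodule.span_induction with
  | mem u hu =>
    obtain ⟨i, j, c, e, w, hm, hw, rfl⟩ := hu
    obtain ⟨α, hα, β, hβ, κ, hκ, hd⟩ := exists_differential_uWord hP hH hn hD w
    obtain ⟨κ', hd', hκ'⟩ := exists_differential_line (D := D) hn hH hD.natDegree_le i j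
    set f : BiPoly ℝ := X 0 ^ c * X 1 ^ e with hf
    have hfd : f.totalDegree ≤ c + e := by
      have h4 := totalDegree_mul (X 0 ^ c : BiPoly ℝ) (X 1 ^ e)
      rwa [totalDegree_X_pow, totalDegree_X_pow] at h4
    have hfd' : ∀ k, (pderiv k f).totalDegree ≤ c + e := fun k =>
      (totalDegree_pderiv_le k f).trans (by omega)
    set A : UFun H D := uLine (Polynomial.X ^ i) * uQ ^ j with hA
    have hAm : ∀ {m L : ℕ} {u : UFun H D}, u ∈ combSpace H D n m L →
        A * u ∈ combSpace H D n (m + j + i) L := by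
      intro m L u hu
      rw [hA, mul_assoc]
      exact uLine_mul_mem (Polynomial.natDegree_X_pow_le i) (uQ_pow_mul_mem j hu)
    have hwm : (uWord w : UFun H D) ∈ combSpace H D n 0 L := uWord_mem hw
    refine ⟨A * (uEval (pderiv 0 f) * uWord w) + A * (uEval f * α), add_mem ?_ ?_,
      A * (uEval (pderiv 1 f) * uWord w) + A * (uEval f * β), add_mem ?_ ?_,
      κ' * (uEval f * uWord w) + A * (uEval f * κ), add_mem ?_ ?_,
      ((hd'.mul (hasDifferential_uEval f)).mul hd).congr rfl ?_ ?_ ?_⟩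
    · exact combSpace_mono (by omega) le_rfl (hAm (uEval_mul_mem (hfd' 0) hwm))
    · exact combSpace_mono (by omega) hw (hAm (uEval_mul_mem hfd hα))
    · exact combSpace_mono (by omega) le_rfl (hAm (uEval_mul_mem (hfd' 1) hwm))
    · exact combSpace_mono (by omega) hw (hAm (uEval_mul_mem hfd hβ))
    · exact combSpace_mono (by omega) le_rfl (hκ' _ _ _ (uEval_mul_mem hfd hwm))
    · have := diffBound_mono (n := n) hw
      exact combSpace_mono (by omega) hw (hAm (uEval_mul_mem hfd hκ))
    · simp only [zero_mul, zero_add]; ring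
    · simp only [zero_mul, zero_add]; ring
    · simp only [mul_zero, add_zero]; ring
  | zero =>
    exact ⟨0, Submodule.zero_mem _, 0, Submodule.zero_mem _, 0, Submodule.zero_mem _,
      hasDifferential_const 0⟩
  | add u v _ _ hu hv =>
    obtain ⟨α, hα, β, hβ, κ, hκ, h⟩ := hu
    obtain ⟨α', hα', β', hβ', κ', hκ', h'⟩ := hv
    exact ⟨_, add_mem hα hα', _, add_mem hβ hβ', _, add_mem hκ hκ', h.add h'⟩
  | smul c u _ hu =>
    obtain ⟨α, hα, β, hβ, κ, hκ, h⟩ := hu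
    exact ⟨_, Submodule.smul_mem _ c hα, _, Submodule.smul_mem _ c hβ, _,
      Submodule.smul_mem _ c hκ, h.smul c⟩

/-- One step of the algorithm: `F` is the integral of `u θ` along the paths, and `v` is the
coefficient of `dH` in its differential, that is, `dF = u θ + v dH`. -/
structure IsStep (u F v : UFun H D) (θ : OneForm ℝ) : Prop where
  zero : ∀ (Φ : LevelFamily H D), ∀ l ∈ Φ.dom, F Φ l 0 = 0
  right : ∀ (Φ : LevelFamily H D), ∀ l ∈ Φ.dom, ∀ s ∈ Ioo (0 : ℝ) 1,
    HasDerivAt (F Φ l) (u Φ l s * Φ.ds θ l s) s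
  left : ∀ (Φ : LevelFamily H D), ∀ l ∈ Φ.dom, ∀ s ∈ Icc (0 : ℝ) 1,
    HasDerivAt (fun l => F Φ l s) (u Φ l s * Φ.dl θ l s + v Φ l s * Φ.tl l) l

theorem exists_step (hP : PetrovSplitting n H) (hH : H.totalDegree = n + 1)
    (hn : 1 ≤ n) {a b : BiPoly ℝ} (hD : IsDiscriminant n H D a b) {m L d : ℕ} {θ : OneForm ℝ}
    (h1 : θ.1.totalDegree ≤ d) (h2 : θ.2.totalDegree ≤ d) {u : UFun H D}
    (hu : u ∈ combSpace H D n m L) :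
    ∃ F ∈ combSpace H D n (m + d + 2 * n * L + 1) (L + 1),
      ∃ v ∈ combSpace H D n (m + d + (diffBound n L + 7 * n ^ 3) + 2 * n * L + 1) (L + 1),
        IsStep u F v θ := by
  obtain ⟨α, hα, β, hβ, κ, hκ, hd⟩ := exists_differential_of_mem hP hH hn hD hu
  obtain ⟨F, hF, hFp⟩ := exists_primitive_of_mem hP hH hu h1 h2
  obtain ⟨v, hv, hvd⟩ := exists_derivative_of_primitive hP hH hn hD
    ((le_diffBound n L).trans (Nat.le_add_right _ _)) hu hα hβ hκ hd h1 h2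
  exact ⟨F, hF, v, hv, hFp.zero, hFp.right, hvd F _ _ hF hFp⟩

/-- A bound for the degrees of the coefficients after `k` steps. -/
def stepBound (n d k : ℕ) : ℕ := k * d + 24 * n ^ 3 * k ^ 3

theorem stepBound_succ (hn : 1 ≤ n) (d k : ℕ) :
    stepBound n d k + d + (diffBound n k + 7 * n ^ 3) + 2 * n * k + 1 ≤ stepBound n d (k + 1) := by
  obtain ⟨h1, -, h3, -⟩ := le_cube hn
  have := Nat.mul_le_mul_right k h1
  have e : stepBound n d (k + 1) = stepBound n d k + d + 72 * (n ^ 3 * k ^ 2) +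
    72 * (n ^ 3 * k) + 24 * n ^ 3 := by simp only [stepBound]; ring
  have e2 : diffBound n k = 10 * (n ^ 3 * k ^ 2) + 20 * (n ^ 3 * k) + 10 * n ^ 3 := by
    simp only [diffBound]; ring
  rw [e, e2, mul_assoc 2 n k]
  omega

/-- The sequence `u₀ = 1`, `dF_{k+1} = u_k θ + u_{k+1} dH`. -/
theorem exists_stepSequence (hP : PetrovSplitting n H) (hH : H.totalDegree = n + 1)
    (hn : 1 ≤ n) {a b : BiPoly ℝ} (hD : IsDiscriminant n H D a b) {d : ℕ} {θ : OneForm ℝ}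
    (h1 : θ.1.totalDegree ≤ d) (h2 : θ.2.totalDegree ≤ d) :
    ∃ u F : ℕ → UFun H D, u 0 = 1 ∧ (∀ k, u k ∈ combSpace H D n (stepBound n d k) k) ∧
      (∀ k, F k ∈ combSpace H D n (stepBound n d k) k) ∧
      ∀ k, IsStep (u k) (F (k + 1)) (u (k + 1)) θ := by
  choose F hF v hv hFv using fun (k : ℕ) (u : combSpace H D n (stepBound n d k) k) =>
    exists_step hP hH hn hD h1 h2 u.2
  let U : (k : ℕ) → combSpace H D n (stepBound n d k) k := fun k =>
    Nat.rec ⟨1, one_mem_combSpace _ _⟩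
      (fun k u => ⟨v k u, combSpace_mono (stepBound_succ hn d k) le_rfl (hv k u)⟩) k
  refine ⟨fun k => (U k).1, fun k => Nat.casesOn k 0 fun k => F k (U k), rfl,
    fun k => (U k).2, fun k => ?_, fun k => hFv k (U k)⟩
  rcases k with _ | k
  · exact Submodule.zero_mem _
  · refine combSpace_mono ?_ le_rfl (hF k (U k))
    have := stepBound_succ hn d k
    omega

end Iteration

section Coefficients

variable {H : BiPoly ℝ} {D : Polynomial ℝ} {n : ℕ}

/-! ### The rational coefficients -/

theorem ratDegree_div_le (p q : Polynomial ℝ) :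
    ratDegree (algebraMap _ (RatFunc ℝ) p / algebraMap _ (RatFunc ℝ) q) ≤
      p.natDegree + q.natDegree := by
  by_cases hq : q = 0
  · simp [hq, ratDegree]
  by_cases hp : p = 0
  · simp [hp, ratDegree]
  exact add_le_add (Polynomial.natDegree_le_of_dvd (RatFunc.num_div_dvd p hq) hp)
    (Polynomial.natDegree_le_of_dvd (RatFunc.denom_div_dvd p q) hq)

theorem eval_denom_ne_zero (p : Polynomial ℝ) {q : Polynomial ℝ} {x : ℝ} (hx : q.eval x ≠ 0) :
    (algebraMap _ (RatFunc ℝ) p / algebraMap _ (RatFunc ℝ) q).denom.eval x ≠ 0 := by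
  obtain ⟨c, hc⟩ := RatFunc.denom_div_dvd p q
  intro h
  rw [hc, Polynomial.eval_mul, h, zero_mul] at hx
  exact hx rfl

theorem eval_div_algebraMap (p : Polynomial ℝ) {q : Polynomial ℝ} {x : ℝ} (hx : q.eval x ≠ 0) :
    (algebraMap _ (RatFunc ℝ) p / algebraMap _ (RatFunc ℝ) q).eval (RingHom.id ℝ) x =
      p.eval x / q.eval x := by
  have hq : q ≠ 0 := by rintro rfl; simp at hx
  set r := algebraMap _ (RatFunc ℝ) p / algebraMap _ (RatFunc ℝ) q with hr
  have hr' : r * algebraMap _ (RatFunc ℝ) q = algebraMap _ (RatFunc ℝ) p :=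
    div_mul_cancel₀ _ (RatFunc.algebraMap_ne_zero hq)
  have hd : r.denom.eval x ≠ 0 := eval_denom_ne_zero p hx
  have h2 := congrArg (RatFunc.eval (RingHom.id ℝ) x) hr'
  rw [RatFunc.eval_mul (f := RingHom.id ℝ) (a := x) (by simpa using hd) (by simp), RatFunc.eval_algebraMap,
    RatFunc.eval_algebraMap] at h2
  rw [eq_div_iff hx]
  simpa using h2

/-- A non-empty list of length at most `L`, as a word. -/
def listWord {L : ℕ} (i : Fin n × Fin n) (w : List (Fin n × Fin n)) (h : w.length < L) :
    Word n L := ⟨⟨w.length, h⟩, (i :: w).get⟩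

theorem basicIntegral_listWord {L : ℕ} (i : Fin n × Fin n) (w : List (Fin n × Fin n))
    (h : w.length < L) (Φ : LevelFamily H D) (l : ℝ) :
    basicIntegral (Φ.path l) (listWord i w h) = uWord (i :: w) Φ l 1 := by
  have : (List.ofFn fun k => basicForm ℝ ((i :: w).get k)) = (i :: w).map (basicForm ℝ) := by
    conv_rhs => rw [← List.ofFn_get (i :: w), List.map_ofFn]
    rfl
  rw [basicIntegral, uWord, iteratedIntegral, ← this]
  rfl

/-- On closed paths, which start and end on the line `x = 0`, the increment of a combination of
iterated integrals is a combination of integrals over nonempty words with coefficients in `p` and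
`q` only. The factor `disc^m` clears the denominators. -/
theorem exists_coefficients {m L δ : ℕ} (hδ : (disc H D).natDegree ≤ δ) {u : UFun H D}
    (hu : u ∈ combSpace H D n m L) :
    ∃ c : Word n L → Polynomial ℝ, (∀ w, (c w).natDegree ≤ m * (δ + 1)) ∧
      ∀ (Φ : LevelFamily H D), ∀ l ∈ Φ.dom, Φ.path l 1 = Φ.path l 0 →
        (u Φ l 1 - u Φ l 0) * (disc H D).eval (Φ.p l) ^ m =
          ∑ w, (c w).eval (Φ.p l) * basicIntegral (Φ.path l) w := by
  induction hu using Submodule.span_induction with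
  | mem u hu =>
    obtain ⟨a, b, c, e, w, hm, hw, rfl⟩ := hu
    have hzero : ∀ (Φ : LevelFamily H D), ∀ l ∈ Φ.dom, Φ.path l 1 = Φ.path l 0 →
        uWord w Φ l 1 = uWord w Φ l 0 ∨ c ≠ 0 →
        (uGen a b c e w Φ l 1 - uGen a b c e w Φ l 0) * (disc H D).eval (Φ.p l) ^ m = 0 := by
      intro Φ l hl h1 h2
      have : uGen a b c e w Φ l 1 = uGen a b c e w Φ l 0 := by
        simp only [uGen, uLine, uQ, uEval, Pi.mul_apply, Pi.pow_apply, h1]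
        rcases h2 with h2 | h2
        · rw [h2]
        · rw [Φ.path_zero hl]
          simp [evalAt, h2]
      rw [this, sub_self, zero_mul]
    rcases w with _ | ⟨i, w⟩
    · exact ⟨0, by simp, fun Φ l hl h1 => by rw [hzero Φ l hl h1 (Or.inl rfl)]; simp⟩
    · rcases Nat.eq_zero_or_pos c with rfl | hc
      · refine ⟨Pi.single (listWord i w hw) (Polynomial.X ^ (a + e) * disc H D ^ (m - b)),
          fun w' => ?_, fun Φ l hl h1 => ?_⟩
        · rw [Pi.single_apply]
          split_ifs
          · refine Polynomial.natDegree_mul_le.trans ?_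
            have h3 := Nat.mul_le_mul_left (m - b) hδ
            have h4 := (Polynomial.natDegree_pow_le (p := disc H D) (n := m - b)).trans h3
            have h5 := Polynomial.natDegree_X_pow_le (R := ℝ) (a + e)
            have h6 : (m - b) * δ ≤ m * δ := Nat.mul_le_mul_right _ (Nat.sub_le _ _)
            rw [mul_add, mul_one]
            omega
          · simp
        · rw [Finset.sum_eq_single (listWord i w hw) (fun w' _ hw' => by
            rw [Pi.single_eq_of_ne hw']; simp) (by simp), Pi.single_eq_same,
            basicIntegral_listWord]
          have hb : b ≤ m := by omega
          have h0 : (disc H D).eval (Φ.p l) ≠ 0 := Φ.good l hl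
          have hq : Φ.q l ^ b * (disc H D).eval (Φ.p l) ^ m =
              (disc H D).eval (Φ.p l) ^ (m - b) := by
            rw [LevelFamily.q, inv_pow, inv_mul_eq_iff_eq_mul₀ (pow_ne_zero _ h0), ← pow_add,
              Nat.add_sub_cancel' hb]
          simp only [uGen, uLine, uQ, uEval, Pi.mul_apply, Pi.pow_apply, uWord_cons_zero, mul_zero,
            sub_zero, h1, Φ.path_zero hl]
          simp only [Polynomial.eval_pow, Polynomial.eval_X, pow_zero, one_mul, evalAt, eval_X,
            Polynomial.eval_mul, map_pow, ← hq, pow_add, Matrix.cons_val_one,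
            Matrix.cons_val_fin_one]
          ring
      · exact ⟨0, by simp, fun Φ l hl h1 => by rw [hzero Φ l hl h1 (Or.inr hc.ne')]; simp⟩
  | zero => exact ⟨0, by simp, fun Φ l hl h1 => by simp⟩
  | add u v _ _ hu hv =>
    obtain ⟨c, hc, hc1⟩ := hu
    obtain ⟨c', hc', hc'1⟩ := hv
    refine ⟨c + c', fun w => (Polynomial.natDegree_add_le _ _).trans (max_le (hc w) (hc' w)),
      fun Φ l hl h1 => ?_⟩
    simp only [Pi.add_apply, Polynomial.eval_add, add_mul, Finset.sum_add_distrib]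
    rw [← hc1 Φ l hl h1, ← hc'1 Φ l hl h1]
    ring
  | smul r u _ hu =>
    obtain ⟨c, hc, hc1⟩ := hu
    refine ⟨r • c, fun w => (Polynomial.natDegree_smul_le _ _).trans (hc w), fun Φ l hl h1 => ?_⟩
    simp only [Pi.smul_apply, Polynomial.eval_smul, smul_eq_mul, mul_assoc, ← Finset.mul_sum]
    rw [← hc1 Φ l hl h1]
    ring

theorem exists_rational_coefficients {m L δ : ℕ} (hδ : (disc H D).natDegree ≤ δ) {u : UFun H D}
    (hu : u ∈ combSpace H D n m L) :
    ∃ h : Word n L → RatFunc ℝ, (∀ w, ratDegree (h w) ≤ m * (2 * δ + 1)) ∧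
      ∀ (Φ : LevelFamily H D), ∀ l ∈ Φ.dom, Φ.path l 1 = Φ.path l 0 →
        (∀ w, (h w).denom.eval (Φ.p l) ≠ 0) ∧ u Φ l 1 - u Φ l 0 =
          ∑ w, (h w).eval (RingHom.id ℝ) (Φ.p l) * basicIntegral (Φ.path l) w := by
  obtain ⟨c, hc, hc1⟩ := exists_coefficients hδ hu
  refine ⟨fun w => algebraMap _ (RatFunc ℝ) (c w) / algebraMap _ (RatFunc ℝ) (disc H D ^ m),
    fun w => (ratDegree_div_le _ _).trans ?_, fun Φ l hl h1 => ?_⟩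
  · have h2 := (Polynomial.natDegree_pow_le (p := disc H D) (n := m)).trans
      (Nat.mul_le_mul_left m hδ)
    refine (add_le_add (hc w) h2).trans (le_of_eq ?_)
    ring
  · have h0 : (disc H D ^ m).eval (Φ.p l) ≠ 0 := by
      rw [Polynomial.eval_pow]
      exact pow_ne_zero _ (Φ.good l hl)
    refine ⟨fun w => eval_denom_ne_zero _ h0, ?_⟩
    have h2 := hc1 Φ l hl h1
    rw [← Polynomial.eval_pow] at h2
    rw [eq_div_of_mul_eq h0 h2, Finset.sum_div]
    refine Finset.sum_congr rfl fun w _ => ?_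
    rw [eval_div_algebraMap _ h0, div_mul_eq_mul_div]

theorem degree_estimate {n d K : ℕ} (hn : 1 ≤ n) (hd : 1 ≤ d) (hK : 1 ≤ K) :
    (stepBound n d K + n ^ 2 * (n + 1) + 1) * (2 * (3 * n ^ 3) + 1) ≤
      2 ^ (11 * K) * d * n ^ 6 := by
  obtain ⟨h1, h2, h3, h4⟩ := le_cube hn
  obtain ⟨k1, k2, k3, -⟩ := le_cube hK
  have e1 : K * d ≤ n ^ 3 * (K ^ 3 * d) := by
    refine (Nat.mul_le_mul_right d k1).trans ?_
    exact Nat.le_mul_of_pos_left _ h3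
  have e2 : n ^ 3 * K ^ 3 ≤ n ^ 3 * (K ^ 3 * d) :=
    Nat.mul_le_mul_left _ (Nat.le_mul_of_pos_right _ hd)
  have e3 : n ^ 3 ≤ n ^ 3 * K ^ 3 := Nat.le_mul_of_pos_right _ k3
  have m1 : stepBound n d K + n ^ 2 * (n + 1) + 1 ≤ 28 * (n ^ 3 * (K ^ 3 * d)) := by
    rw [stepBound, mul_assoc 24]
    omega
  have m2 : 2 * (3 * n ^ 3) + 1 ≤ 7 * n ^ 3 := by omega
  refine (Nat.mul_le_mul m1 m2).trans ?_
  have hK3 : K ^ 3 ≤ 2 ^ (3 * K) := by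
    rw [mul_comm 3 K, pow_mul]
    exact Nat.pow_le_pow_left K.lt_two_pow_self.le 3
  have h8 : 2 ^ 8 ≤ 2 ^ (8 * K) := Nat.pow_le_pow_right (by norm_num) (by omega)
  have hp : 196 * K ^ 3 ≤ 2 ^ (11 * K) := by
    have : 2 ^ (11 * K) = 2 ^ (8 * K) * 2 ^ (3 * K) := by rw [← pow_add]; congr 1; ring
    rw [this]
    exact Nat.mul_le_mul ((by norm_num : 196 ≤ 2 ^ 8).trans h8) hK3
  calc 28 * (n ^ 3 * (K ^ 3 * d)) * (7 * n ^ 3) = 196 * K ^ 3 * (d * n ^ 6) := by ring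
    _ ≤ 2 ^ (11 * K) * (d * n ^ 6) := Nat.mul_le_mul_right _ hp
    _ = _ := by ring

/-- The functions `u_k`, `F_k` of the algorithm, and rational coefficients `h_w` in the
representation of `-F_K / H_y(0, p)` by iterated integrals. -/
theorem exists_algorithm (hP : PetrovSplitting n H) (hH : H.totalDegree = n + 1) (hn : 1 ≤ n)
    {a b : BiPoly ℝ} (hD : IsDiscriminant n H D a b) {d K : ℕ} (hd : 1 ≤ d) (hK : 1 ≤ K)
    {θ : OneForm ℝ} (h1 : θ.1.totalDegree ≤ d) (h2 : θ.2.totalDegree ≤ d) :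
    ∃ (u F : ℕ → UFun H D) (h : Word n K → RatFunc ℝ), u 0 = 1 ∧
      (∀ k, ∃ m L, u k ∈ combSpace H D n m L) ∧ (∀ k, ∃ m L, F k ∈ combSpace H D n m L) ∧
      (∀ k, IsStep (u k) (F (k + 1)) (u (k + 1)) θ) ∧
      (∀ w, ratDegree (h w) ≤ 2 ^ (11 * K) * d * n ^ 6) ∧
      ∀ (Φ : LevelFamily H D), ∀ l ∈ Φ.dom, Φ.path l 1 = Φ.path l 0 →
        (∀ w, (h w).denom.eval (Φ.p l) ≠ 0) ∧
        -(F K Φ l 1) = evalAt (0, Φ.p l) (pderiv 1 H) *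
          ∑ w, (h w).eval (RingHom.id ℝ) (Φ.p l) * basicIntegral (Φ.path l) w := by
  obtain ⟨u, F, hu0, hu, hF, hs⟩ := exists_stepSequence hP hH hn hD h1 h2
  have hδ : (disc H D).natDegree ≤ 3 * n ^ 3 := by
    have := natDegree_disc_le hH hD.natDegree_le
    obtain ⟨h1, h2, h3, h4⟩ := le_cube hn
    omega
  obtain ⟨h, hdeg, hh⟩ := exists_rational_coefficients hδ
    ((combSpace H D n _ K).neg_mem (uSlope_mul_mem hH hD.natDegree_le (hF K)))
  refine ⟨u, F, h, hu0, fun k => ⟨_, _, hu k⟩, fun k => ⟨_, _, hF k⟩, hs,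
    fun w => (hdeg w).trans (degree_estimate hn hd hK), fun Φ l hl h1 => ?_⟩
  obtain ⟨h2, h3⟩ := hh Φ l hl h1
  refine ⟨h2, ?_⟩
  rw [← h3]
  have h4 : F K Φ l 0 = 0 := by
    obtain ⟨k, rfl⟩ := Nat.exists_eq_add_of_le' hK
    exact (hs k).zero Φ l hl
  have h5 := Φ.q_mul hl
  simp only [Pi.neg_apply, Pi.mul_apply, h4, uSlope, uQ, uLine, Polynomial.eval_comp, eval_onLine]
  linear_combination (F K Φ l 1) * h5

end Coefficients

/-! ### Solving for the initial point along a tube -/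

/-- The tube lemma around the segment `{(0, 0)} × [0, 1]`. -/
theorem exists_tube {N : Set (ℝ × ℝ × ℝ)} (hN : IsOpen N)
    (h : ∀ s ∈ Icc (0 : ℝ) 1, ((0, 0, s) : ℝ × ℝ × ℝ) ∈ N) :
    ∃ ρ > 0, ∃ V : Set ℝ, IsOpen V ∧ Icc 0 1 ⊆ V ∧
      ∀ z ε s : ℝ, |z| < ρ → |ε| < ρ → s ∈ V → (z, ε, s) ∈ N := by
  have hc : Continuous fun q : (ℝ × ℝ) × ℝ => ((q.1.1, q.1.2, q.2) : ℝ × ℝ × ℝ) := by fun_prop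
  obtain ⟨u, V, hu, hV, h0, hI, hsub⟩ := generalized_tube_lemma (isCompact_singleton (x := (0, 0)))
    (isCompact_Icc (a := (0 : ℝ)) (b := 1)) (hN.preimage hc) (by
      rintro ⟨a, s⟩ ⟨ha, hs⟩
      rw [mem_singleton_iff] at ha
      subst ha
      exact h s hs)
  obtain ⟨ρ, hρ, hball⟩ := Metric.isOpen_iff.1 hu (0, 0) (h0 rfl)
  refine ⟨ρ, hρ, V, hV, hI, fun z ε s hz hε hs => ?_⟩
  have : ((z, ε), s) ∈ u ×ˢ V := ⟨hball ?_, hs⟩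
  · exact hsub this
  · rw [Metric.mem_ball, Prod.dist_eq, max_lt_iff, Real.dist_eq, Real.dist_eq]
    simpa using ⟨hz, hε⟩

/-- The inverse function theorem for `(z, w) ↦ (T(z, w), w)`, on an open set where this map is
injective and `∂T/∂z` does not vanish. -/
theorem exists_inverse_of_injOn {T : ℝ × ℝ × ℝ → ℝ} {U : Set (ℝ × ℝ × ℝ)} (hU : IsOpen U)
    (hT : ∀ q ∈ U, ContDiffAt ℝ 2 T q) (hT' : ∀ q ∈ U, fderiv ℝ T q (1, 0, 0) ≠ 0)
    (hinj : InjOn (fun q => (T q, q.2)) U) :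
    ∃ (Z : ℝ × ℝ × ℝ → ℝ) (W : Set (ℝ × ℝ × ℝ)), IsOpen W ∧
      (∀ w ∈ W, ContDiffAt ℝ 2 Z w ∧ (Z w, w.2) ∈ U ∧ T (Z w, w.2) = w.1) ∧
      ∀ q ∈ U, (T q, q.2) ∈ W ∧ Z (T q, q.2) = q.1 := by
  set G : ℝ × ℝ × ℝ → ℝ × ℝ × ℝ := fun q => (T q, q.2) with hG
  have hGs : ∀ q ∈ U, ContDiffAt ℝ 2 G q := fun q hq => (hT q hq).prodMk contDiffAt_snd
  have hder : ∀ q ∈ U, ∃ A : (ℝ × ℝ × ℝ) ≃L[ℝ] (ℝ × ℝ × ℝ),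
      HasStrictFDerivAt G (A : (ℝ × ℝ × ℝ) →L[ℝ] (ℝ × ℝ × ℝ)) q := by
    intro q hq
    have hs := (hGs q hq).hasStrictFDerivAt (by norm_num)
    have hfd : fderiv ℝ G q = (fderiv ℝ T q).prod (ContinuousLinearMap.snd ℝ ℝ (ℝ × ℝ)) :=
      ((((hT q hq).differentiableAt (by norm_num)).hasFDerivAt).prodMk hasFDerivAt_snd).fderiv
    have hi : Function.Injective ((fderiv ℝ G q : (ℝ × ℝ × ℝ) →ₗ[ℝ] (ℝ × ℝ × ℝ))) := by
      refine (injective_iff_map_eq_zero _).2 fun v hv => ?_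
      have hv' : (fderiv ℝ T q v, v.2) = 0 := by
        have := hv
        rw [ContinuousLinearMap.coe_coe, hfd] at this
        exact this
      obtain ⟨v1, v2⟩ := v
      rw [Prod.mk_eq_zero] at hv'
      obtain ⟨h1, h2⟩ := hv'
      simp only at h2
      subst h2
      have : ((v1, 0) : ℝ × ℝ × ℝ) = v1 • (1, 0, 0) := by ext <;> simp
      rw [this, map_smul, smul_eq_mul, mul_eq_zero] at h1
      rcases h1 with h1 | h1
      · rw [h1]; rfl
      · exact absurd h1 (hT' q hq)
    refine ⟨(LinearEquiv.ofInjectiveEndo _ hi).toContinuousLinearEquiv, ?_⟩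
    exact hs.congr_fderiv (ContinuousLinearMap.ext fun v => rfl)
  have hopen : IsOpenMap (U.domRestrict G) := by
    refine IsOpenMap.of_nhds_le fun x => ?_
    obtain ⟨A, hA⟩ := hder x x.2
    have : map (U.domRestrict G) (𝓝 x) = map G (map (Subtype.val : U → _) (𝓝 x)) := rfl
    rw [this, map_nhds_subtype_coe_eq_nhds x.2 (hU.mem_nhds x.2), hA.map_nhds_eq_of_equiv]
    rfl
  let e := OpenPartialHomeomorph.ofContinuousOpenRestrict (InjOn.toPartialEquiv G U hinj)
    (fun q hq => (hGs q hq).continuousAt.continuousWithinAt) hopen hU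
  have he : ∀ q, e q = G q := fun q => rfl
  have hes : e.source = U := rfl
  have hsymm : ∀ w ∈ e.target, e.symm w = ((e.symm w).1, w.2) ∧ T (e.symm w) = w.1 := by
    intro w hw
    have h := e.right_inv hw
    rw [he] at h
    have h1 := congrArg Prod.fst h
    have h2 := congrArg Prod.snd h
    exact ⟨Prod.ext rfl h2, h1⟩
  refine ⟨fun w => (e.symm w).1, e.target, e.open_target, fun w hw => ⟨?_, ?_, ?_⟩,
    fun q hq => ⟨e.map_source hq, ?_⟩⟩
  · have hm : e.symm w ∈ U := e.map_target hw
    obtain ⟨A, hA⟩ := hder _ hm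
    exact (e.contDiffAt_symm hw hA.hasFDerivAt (hGs _ hm)).fst
  · rw [← (hsymm w hw).1]
    exact e.map_target hw
  · rw [← (hsymm w hw).1]
    exact (hsymm w hw).2
  · have := e.left_inv hq
    rw [he] at this
    exact congrArg Prod.fst this

theorem analyticAt_evalAt {E : Type*} [NormedAddCommGroup E] [NormedSpace ℝ E] {g : E → ℝ × ℝ}
    {q : E} (hg : AnalyticAt ℝ g q) (f : BiPoly ℝ) : AnalyticAt ℝ (fun q => evalAt (g q) f) q := by
  have h : ∀ i : Fin 2, AnalyticAt ℝ (fun q => (![(g q).1, (g q).2] : Fin 2 → ℝ) i) q := by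
    intro i
    fin_cases i
    · exact analyticAt_fst.comp hg
    · exact analyticAt_snd.comp hg
  refine (AnalyticAt.aeval_mvPolynomial h f).congr (Eventually.of_forall fun q => ?_)
  simp only [evalAt, MvPolynomial.aeval_def, MvPolynomial.eval, Algebra.algebraMap_self]
  rfl

section Chart

variable {H : BiPoly ℝ} {ω : OneForm ℝ} {y₀ : ℝ} {δ : ℝ → ℝ × ℝ} {r : ℝ}
  {γ : ℝ → ℝ → ℝ → ℝ × ℝ}

theorem IsLeafFamily.analyticAt (h : IsLeafFamily H ω y₀ δ r γ) {z ε s : ℝ} (hz : |z| < r)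
    (hε : |ε| < r) (hs : s ∈ Icc (0 : ℝ) 1) :
    AnalyticAt ℝ (fun q : ℝ × ℝ × ℝ => γ q.1 q.2.1 q.2.2) (z, ε, s) :=
  h.analytic _ ⟨hz, hε, hs⟩

theorem IsLeafFamily.differentiableAt (h : IsLeafFamily H ω y₀ δ r γ) {z ε s : ℝ} (hz : |z| < r)
    (hε : |ε| < r) (hs : s ∈ Icc (0 : ℝ) 1) : DifferentiableAt ℝ (γ z ε) s :=
  (h.analyticAt hz hε hs).differentiableAt.comp (g := fun q : ℝ × ℝ × ℝ => γ q.1 q.2.1 q.2.2)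
    (f := fun s => (z, ε, s)) s (by fun_prop)

theorem hasDerivAt_evalAt_path {c : ℝ → ℝ × ℝ} {s : ℝ} (hc : DifferentiableAt ℝ c s)
    (f : BiPoly ℝ) : HasDerivAt (fun s => evalAt (c s) f) (pullback c (extD ℝ f) s) s :=
  hasDerivAt_evalAt f hc.hasDerivAt.fst hc.hasDerivAt.snd

/-- For `ε = 0` the leaves are the level curves of `H`. -/
theorem IsLeafFamily.level_zero (h : IsLeafFamily H ω y₀ δ r γ) {z s : ℝ} (hz : |z| < r)
    (hs : s ∈ Icc (0 : ℝ) 1) : evalAt (γ z 0 s) H = evalAt (0, y₀ + z) H := by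
  have h0 : |(0 : ℝ)| < r := by simpa using h.pos
  have hd : ∀ t ∈ Icc (0 : ℝ) 1, HasDerivAt (fun s => evalAt (γ z 0 s) H) 0 t := by
    intro t ht
    refine (hasDerivAt_evalAt_path (h.differentiableAt hz h0 ht) H).congr_deriv ?_
    have := h.leaf z 0 t hz h0 ht
    rwa [zero_mul, add_zero] at this
  have h1 := constant_of_has_deriv_right_zero
    (fun t ht => (hd t ht).continuousAt.continuousWithinAt)
    (fun t ht => (hd t (Ico_subset_Icc_self ht)).hasDerivWithinAt) s hs
  rw [h1, h.start z 0 hz h0]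

/-- A family of closed paths `Ψ t ε` in the level curves `{H = t}`, starting on the line `x = 0`
at a point which does not depend on `ε`. -/
structure IsLevelChart (H : BiPoly ℝ) (D : Polynomial ℝ) (ρ : ℝ) (Ψ : ℝ → ℝ → ℝ → ℝ × ℝ) :
    Prop where
  pos : 0 < ρ
  smooth : ∀ t ε s : ℝ, |t| < ρ → |ε| < ρ → s ∈ Icc (0 : ℝ) 1 →
    ContDiffAt ℝ 2 (fun q : ℝ × ℝ × ℝ => Ψ q.1 q.2.1 q.2.2) (t, ε, s)
  level : ∀ t ε s : ℝ, |t| < ρ → |ε| < ρ → s ∈ Icc (0 : ℝ) 1 → evalAt (Ψ t ε s) H = t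
  start : ∀ t ε : ℝ, |t| < ρ → |ε| < ρ → (Ψ t ε 0).1 = 0
  good : ∀ t ε : ℝ, |t| < ρ → |ε| < ρ → (disc H D).eval (Ψ t ε 0).2 ≠ 0
  init : ∀ t ε : ℝ, |t| < ρ → |ε| < ρ → Ψ t ε 0 = Ψ t 0 0
  closed : ∀ t ε : ℝ, |t| < ρ → |ε| < ρ → Ψ t ε 1 = Ψ t ε 0

/-- Near the cycle, the leaf `γ z ε` can be described by the moving value `t = H(γ z ε s)` and the
closed paths `Ψ t ε`: the point `Ψ t ε s` is the point `γ Z ε s` on the level `t`, where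
`Z = Z(t, ε, s)` solves `H(γ Z ε s) = t`. It is closed since `H` is injective on the line `x = 0`
near the initial point. -/
theorem exists_levelChart {D : Polynomial ℝ} (hD : D.coeff 0 ≠ 0) (hc : IsCycle H y₀ δ)
    (h : IsLeafFamily H ω y₀ δ r γ) :
    ∃ (ρ : ℝ) (Ψ : ℝ → ℝ → ℝ → ℝ × ℝ), IsLevelChart H D ρ Ψ ∧
      ∃ η > 0, η ≤ r ∧ η ≤ ρ / 2 ∧ ∀ z ε s : ℝ, |z| < η → |ε| < η → s ∈ Icc (0 : ℝ) 1 →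
        |evalAt (γ z ε s) H| < ρ / 2 ∧ Ψ (evalAt (γ z ε s) H) ε s = γ z ε s := by
  have hr := h.pos
  have h0r : |(0 : ℝ)| < r := by simpa using hr
  set c : ℝ := evalAt (0, y₀) (pderiv 1 H) with hcdef
  have hc0 : c ≠ 0 := hc.transversal
  have hδ0 : evalAt (0, y₀) H = 0 := by rw [← hc.start]; exact hc.level 0 ⟨le_rfl, zero_le_one⟩
  set g : ℝ × ℝ × ℝ → ℝ × ℝ := fun q => γ q.1 q.2.1 q.2.2 with hg
  set T : ℝ × ℝ × ℝ → ℝ := fun q => evalAt (g q) H with hT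
  have hgan : ∀ s ∈ Icc (0 : ℝ) 1, AnalyticAt ℝ g (0, 0, s) := fun s hs =>
    h.analyticAt h0r h0r hs
  have hTan : ∀ q, AnalyticAt ℝ g q → AnalyticAt ℝ T q := fun q hq => analyticAt_evalAt hq H
  have hT0 : ∀ s ∈ Icc (0 : ℝ) 1, T (0, 0, s) = 0 := by
    intro s hs
    have := h.level_zero h0r hs
    rw [add_zero, hδ0] at this
    exact this
  -- the open set where the families are analytic and the level is monotone in `z`
  set N : Set (ℝ × ℝ × ℝ) := {q | AnalyticAt ℝ g q} ∩
    (fun q => c * fderiv ℝ T q (1, 0, 0)) ⁻¹' Ioi 0 with hN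
  have hNo : IsOpen N := by
    refine ContinuousOn.isOpen_inter_preimage ?_ (isOpen_analyticAt ℝ g) isOpen_Ioi
    intro q hq
    have := (hTan q hq).fderiv.continuousAt
    exact (continuousAt_const.mul (this.clm_apply continuousAt_const)).continuousWithinAt
  have hline : ∀ q, AnalyticAt ℝ g q →
      HasDerivAt (fun z => T (z, q.2)) (fderiv ℝ T q (1, 0, 0)) q.1 := by
    intro q hq
    have h1 : HasDerivAt (fun z : ℝ => ((z, q.2) : ℝ × ℝ × ℝ)) (1, 0) q.1 :=
      (hasDerivAt_id q.1).prodMk (hasDerivAt_const q.1 q.2)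
    have h2 : HasFDerivAt T (fderiv ℝ T q) (q.1, q.2) := (hTan q hq).differentiableAt.hasFDerivAt
    exact h2.comp_hasDerivAt q.1 h1
  have hN0 : ∀ s ∈ Icc (0 : ℝ) 1, ((0, 0, s) : ℝ × ℝ × ℝ) ∈ N := by
    intro s hs
    refine ⟨hgan s hs, ?_⟩
    have h1 : HasDerivAt (fun z => T (z, 0, s)) (fderiv ℝ T (0, 0, s) (1, 0, 0)) 0 :=
      hline (0, 0, s) (hgan s hs)
    have h2 : HasDerivAt (fun z : ℝ => evalAt (0, y₀ + z) H) c 0 := by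
      have := hasDerivAt_evalAt (c := fun z => ((0, y₀ + z) : ℝ × ℝ)) (t := 0) H
        (hasDerivAt_const _ _) ((hasDerivAt_id (0 : ℝ)).const_add y₀)
      refine this.congr_deriv ?_
      simp [hcdef]
    have h3 : fderiv ℝ T (0, 0, s) (1, 0, 0) = c := by
      refine h1.unique (h2.congr_of_eventuallyEq ?_)
      have : ∀ᶠ z : ℝ in 𝓝 0, |z| < r :=
        (continuous_abs.tendsto' 0 0 abs_zero).eventually (gt_mem_nhds hr)
      filter_upwards [this] with z hz
      exact h.level_zero hz hs
    change 0 < c * _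
    rw [h3]
    exact mul_self_pos.2 hc0
  obtain ⟨ρ₁, hρ₁, V, hV, hIV, hsub⟩ := exists_tube hNo hN0
  set ρ₂ := min ρ₁ r with hρ₂
  have hρ₂0 : 0 < ρ₂ := lt_min hρ₁ hr
  set U : Set (ℝ × ℝ × ℝ) := {q | |q.1| < ρ₂ ∧ |q.2.1| < ρ₂ ∧ q.2.2 ∈ V} with hU
  have hUN : U ⊆ N := fun q hq => hsub q.1 q.2.1 q.2.2 (hq.1.trans_le (min_le_left _ _))
    (hq.2.1.trans_le (min_le_left _ _)) hq.2.2
  have hUo : IsOpen U := by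
    have h1 : Continuous fun q : ℝ × ℝ × ℝ => |q.1| := by fun_prop
    have h2 : Continuous fun q : ℝ × ℝ × ℝ => |q.2.1| := by fun_prop
    have h3 : Continuous fun q : ℝ × ℝ × ℝ => q.2.2 := by fun_prop
    exact (isOpen_lt h1 continuous_const).inter
      ((isOpen_lt h2 continuous_const).inter (hV.preimage h3))
  have hinj : InjOn (fun q => (T q, q.2)) U := by
    rintro ⟨z, w⟩ hq ⟨z', w'⟩ hq' heq
    obtain ⟨h1, h2⟩ := Prod.mk_inj.1 heq
    simp only at h2
    subst h2
    have hmem : ∀ z ∈ Ioo (-ρ₂) ρ₂, ((z, w) : ℝ × ℝ × ℝ) ∈ U := fun z hz =>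
      ⟨abs_lt.2 hz, hq.2⟩
    have hd : ∀ z ∈ Ioo (-ρ₂) ρ₂,
        HasDerivAt (fun z => c * T (z, w)) (c * fderiv ℝ T (z, w) (1, 0, 0)) z :=
      fun z hz => (hline (z, w) (hUN (hmem z hz)).1).const_mul c
    have hm : StrictMonoOn (fun z => c * T (z, w)) (Ioo (-ρ₂) ρ₂) := by
      refine strictMonoOn_of_deriv_pos (convex_Ioo _ _)
        (fun z hz => (hd z hz).continuousAt.continuousWithinAt) fun z hz => ?_
      rw [interior_Ioo] at hz
      rw [(hd z hz).deriv]
      exact (hUN (hmem z hz)).2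
    have : z = z' := hm.injOn (abs_lt.1 hq.1) (abs_lt.1 hq'.1) (by
      change c * T (z, w) = c * T (z', w)
      rw [h1])
    rw [this]
  have hTs : ∀ q ∈ U, ContDiffAt ℝ 2 T q := fun q hq => (hTan q (hUN hq).1).contDiffAt
  obtain ⟨Z, W, hW, hZ, hZ'⟩ := exists_inverse_of_injOn hUo hTs (fun q hq h0 => by
    have := (hUN hq).2
    rw [mem_preimage, h0, mul_zero] at this
    exact lt_irrefl (0 : ℝ) this) hinj
  -- the closed paths in the level curves
  set Ψ : ℝ → ℝ → ℝ → ℝ × ℝ := fun t ε s => γ (Z (t, ε, s)) ε s with hΨ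
  have hΨs : ∀ w ∈ W, ContDiffAt ℝ 2 (fun q : ℝ × ℝ × ℝ => Ψ q.1 q.2.1 q.2.2) w := by
    intro w hw
    have h1 : ContDiffAt ℝ 2 g (Z w, w.2) := (hUN (hZ w hw).2.1).1.contDiffAt
    exact h1.comp (f := fun w : ℝ × ℝ × ℝ => (Z w, w.2)) w ((hZ w hw).1.prodMk contDiffAt_snd)
  have h0U : ∀ s ∈ Icc (0 : ℝ) 1, ((0, 0, s) : ℝ × ℝ × ℝ) ∈ U := fun s hs =>
    ⟨by simpa using hρ₂0, by simpa using hρ₂0, hIV hs⟩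
  have h0W : ∀ s ∈ Icc (0 : ℝ) 1, ((0, 0, s) : ℝ × ℝ × ℝ) ∈ W ∧ Z (0, 0, s) = 0 := by
    intro s hs
    have h1 := hZ' (0, 0, s) (h0U s hs)
    rwa [hT0 s hs] at h1
  obtain ⟨ρ₃, hρ₃, V₃, -, hIV₃, hsub₃⟩ := exists_tube hW fun s hs => (h0W s hs).1
  have hI0 : (0 : ℝ) ∈ Icc (0 : ℝ) 1 := ⟨le_rfl, zero_le_one⟩
  have hI1 : (1 : ℝ) ∈ Icc (0 : ℝ) 1 := ⟨zero_le_one, le_rfl⟩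
  have hΨ0 : ∀ s ∈ Icc (0 : ℝ) 1, Ψ 0 0 s = δ s := by
    intro s hs
    rw [hΨ]
    simp only [(h0W s hs).2]
    exact h.central s hs
  have hcont : ∀ s ∈ Icc (0 : ℝ) 1,
      ContinuousAt (fun q : ℝ × ℝ => (Ψ q.1 q.2 s).2) (0, 0) := by
    intro s hs
    have h1 : ContinuousAt (fun q : ℝ × ℝ × ℝ => Ψ q.1 q.2.1 q.2.2) (0, 0, s) :=
      (hΨs _ (h0W s hs).1).continuousAt
    exact (h1.comp (f := fun q : ℝ × ℝ => (q.1, q.2, s)) (x := (0, 0)) (by fun_prop)).snd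
  have hev1 : ∀ᶠ q : ℝ × ℝ in 𝓝 (0, 0), |(Ψ q.1 q.2 1).2 - y₀| < ρ₂ := by
    have h1 : ContinuousAt (fun q : ℝ × ℝ => |(Ψ q.1 q.2 1).2 - y₀|) (0, 0) :=
      ((hcont 1 hI1).sub continuousAt_const).abs
    refine h1.eventually (gt_mem_nhds ?_)
    simp only [hΨ0 1 hI1, hc.closed, hc.start, sub_self, abs_zero]
    exact hρ₂0
  have hev2 : ∀ᶠ q : ℝ × ℝ in 𝓝 (0, 0), (disc H D).eval (Ψ q.1 q.2 0).2 ≠ 0 := by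
    have h1 : ContinuousAt (fun q : ℝ × ℝ => (disc H D).eval (Ψ q.1 q.2 0).2) (0, 0) :=
      (disc H D).continuous.continuousAt.comp (hcont 0 hI0)
    refine h1.eventually_ne ?_
    simp only [hΨ0 0 hI0, hc.start, disc, Polynomial.eval_mul, Polynomial.eval_comp, eval_onLine,
      hδ0]
    refine mul_ne_zero ?_ hc0
    rwa [← Polynomial.coeff_zero_eq_eval_zero]
  obtain ⟨ρ₄, hρ₄, hball⟩ := Metric.eventually_nhds_iff.1 (hev1.and hev2)
  set ρ := min ρ₂ (min ρ₃ ρ₄) with hρ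
  have hρ0 : 0 < ρ := lt_min hρ₂0 (lt_min hρ₃ hρ₄)
  have hρρ₂ : ρ ≤ ρ₂ := min_le_left _ _
  have hmemW : ∀ t ε s : ℝ, |t| < ρ → |ε| < ρ → s ∈ Icc (0 : ℝ) 1 → (t, ε, s) ∈ W :=
    fun t ε s ht hε hs => hsub₃ t ε s
      (ht.trans_le ((min_le_right _ _).trans (min_le_left _ _)))
      (hε.trans_le ((min_le_right _ _).trans (min_le_left _ _))) (hIV₃ hs)
  have hnear : ∀ t ε : ℝ, |t| < ρ → |ε| < ρ → |(Ψ t ε 1).2 - y₀| < ρ₂ ∧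
      (disc H D).eval (Ψ t ε 0).2 ≠ 0 := by
    intro t ε ht hε
    refine hball (y := (t, ε)) ?_
    rw [Prod.dist_eq, max_lt_iff, Real.dist_eq, Real.dist_eq]
    simpa using ⟨ht.trans_le ((min_le_right _ _).trans (min_le_right _ _)),
      hε.trans_le ((min_le_right _ _).trans (min_le_right _ _))⟩
  have hZr : ∀ t ε s : ℝ, |t| < ρ → |ε| < ρ → s ∈ Icc (0 : ℝ) 1 →
      |Z (t, ε, s)| < ρ₂ ∧ |Z (t, ε, s)| < r ∧ |ε| < r := fun t ε s ht hε hs =>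
    have h1 := (hZ _ (hmemW t ε s ht hε hs)).2.1.1
    ⟨h1, h1.trans_le (min_le_right _ _), (hε.trans_le hρρ₂).trans_le (min_le_right _ _)⟩
  have hlevel : ∀ t ε s : ℝ, |t| < ρ → |ε| < ρ → s ∈ Icc (0 : ℝ) 1 → evalAt (Ψ t ε s) H = t :=
    fun t ε s ht hε hs => (hZ _ (hmemW t ε s ht hε hs)).2.2
  -- the value of `H` determines the point of the line `x = 0` near the initial point
  have hline_inj : ∀ z z' : ℝ, |z| < ρ₂ → |z'| < ρ₂ →
      evalAt (0, y₀ + z) H = evalAt (0, y₀ + z') H → z = z' := by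
    intro z z' hz hz' he
    have h1 : ∀ z : ℝ, |z| < ρ₂ → T (z, 0, 0) = evalAt (0, y₀ + z) H := fun z hz =>
      h.level_zero (hz.trans_le (min_le_right _ _)) hI0
    have hU' : ∀ z : ℝ, |z| < ρ₂ → ((z, 0, 0) : ℝ × ℝ × ℝ) ∈ U := fun z hz =>
      ⟨hz, by simpa using hρ₂0, hIV hI0⟩
    have := hinj (hU' z hz) (hU' z' hz') (by
      change (T _, _) = (T _, _)
      rw [h1 z hz, h1 z' hz', he])
    exact congrArg Prod.fst this
  have hstart : ∀ t ε : ℝ, |t| < ρ → |ε| < ρ → Ψ t ε 0 = (0, y₀ + Z (t, ε, 0)) :=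
    fun t ε ht hε => h.start _ _ (hZr t ε 0 ht hε hI0).2.1 (hZr t ε 0 ht hε hI0).2.2
  have h0ρ : |(0 : ℝ)| < ρ := by simpa using hρ0
  refine ⟨ρ, Ψ, ⟨hρ0, fun t ε s ht hε hs => hΨs _ (hmemW t ε s ht hε hs), hlevel,
    fun t ε ht hε => by rw [hstart t ε ht hε], fun t ε ht hε => (hnear t ε ht hε).2,
    fun t ε ht hε => ?_, fun t ε ht hε => ?_⟩, ?_⟩
  · have h1 := hlevel t ε 0 ht hε hI0
    have h2 := hlevel t 0 0 ht h0ρ hI0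
    rw [hstart t ε ht hε] at h1 ⊢
    rw [hstart t 0 ht h0ρ] at h2 ⊢
    rw [hline_inj _ _ (hZr t ε 0 ht hε hI0).1 (hZr t 0 0 ht h0ρ hI0).1 (h1.trans h2.symm)]
  · have h1 := hlevel t ε 0 ht hε hI0
    have h2 := hlevel t ε 1 ht hε hI1
    have h3 : (Ψ t ε 1).1 = 0 := h.finish _ _ (hZr t ε 1 ht hε hI1).2.1 (hZr t ε 1 ht hε hI1).2.2
    have h4 : Ψ t ε 1 = (0, y₀ + ((Ψ t ε 1).2 - y₀)) := by
      rw [add_sub_cancel]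
      exact Prod.ext h3 rfl
    rw [hstart t ε ht hε] at h1 ⊢
    rw [h4] at h2 ⊢
    rw [hline_inj _ _ (hnear t ε ht hε).1 (hZr t ε 0 ht hε hI0).1 (h2.trans h1.symm)]
  · have hO : IsOpen (U ∩ T ⁻¹' {t | |t| < ρ / 2}) := by
      refine ContinuousOn.isOpen_inter_preimage ?_ hUo (isOpen_lt continuous_abs continuous_const)
      exact fun q hq => (hTs q hq).continuousAt.continuousWithinAt
    obtain ⟨ρ₅, hρ₅, V₅, -, hIV₅, hsub₅⟩ := exists_tube hO fun s hs =>
      ⟨h0U s hs, by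
        rw [mem_preimage, hT0 s hs, mem_ofPred_eq, abs_zero]
        exact half_pos hρ0⟩
    refine ⟨min ρ₅ (min r (ρ / 2)), lt_min hρ₅ (lt_min hr (half_pos hρ0)),
      (min_le_right _ _).trans (min_le_left _ _), (min_le_right _ _).trans (min_le_right _ _),
      fun z ε s hz hε hs => ?_⟩
    have h1 := hsub₅ z ε s (hz.trans_le (min_le_left _ _)) (hε.trans_le (min_le_left _ _)) (hIV₅ hs)
    refine ⟨h1.2, ?_⟩
    have h2 := (hZ' _ h1.1).2
    change γ (Z (T (z, ε, s), ε, s)) ε s = _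
    rw [h2]

end Chart

section Perturbation

variable {H : BiPoly ℝ} {D : Polynomial ℝ} {n : ℕ}

/-! ### Independence of the family and uniform bounds -/

/-- The value of a combination of iterated integrals only depends on the path. -/
theorem congr_of_mem {m L : ℕ} {u : UFun H D} (hu : u ∈ combSpace H D n m L)
    {Φ Φ' : LevelFamily H D} {l l' : ℝ} (h : Φ.path l = Φ'.path l') (s : ℝ) :
    u Φ l s = u Φ' l' s := by
  induction hu using Submodule.span_induction with
  | mem u hu =>
    obtain ⟨a, b, c, e, w, -, -, rfl⟩ := hu
    simp only [uGen, uLine, uQ, uEval, uWord, Pi.mul_apply, Pi.pow_apply, LevelFamily.q,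
      LevelFamily.p, h]
  | zero => rfl
  | add u v _ _ hu hv => simp only [Pi.add_apply, hu, hv]
  | smul c u _ hu => simp only [Pi.smul_apply, hu]

/-- The path with parameter `l` of the family `Φ` and its velocity are bounded by `B`. -/
structure LevelFamily.IsBoundedBy (Φ : LevelFamily H D) (l B : ℝ) : Prop where
  p : |Φ.p l| ≤ B
  q : |Φ.q l| ≤ B
  x : ∀ s ∈ Icc (0 : ℝ) 1, |(Φ.path l s).1| ≤ B
  y : ∀ s ∈ Icc (0 : ℝ) 1, |(Φ.path l s).2| ≤ B
  xs : ∀ s ∈ Icc (0 : ℝ) 1, |Φ.xs l s| ≤ B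

theorem abs_evalAt_monomial_le {B : ℝ} {v : ℝ × ℝ} (h1 : |v.1| ≤ B) (h2 : |v.2| ≤ B) (c e : ℕ) :
    |evalAt v (X 0 ^ c * X 1 ^ e)| ≤ B ^ c * B ^ e := by
  have : evalAt v (X 0 ^ c * X 1 ^ e) = v.1 ^ c * v.2 ^ e := by simp [evalAt]
  have hB : 0 ≤ B := (abs_nonneg _).trans h1
  rw [this, abs_mul, abs_pow, abs_pow]
  gcongr

theorem exists_bound_uWord (B : ℝ) (hB : 0 ≤ B) (w : List (Fin n × Fin n)) :
    ∃ B', 0 ≤ B' ∧ ∀ (Φ : LevelFamily H D), ∀ l ∈ Φ.dom, Φ.IsBoundedBy l B →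
      ∀ s ∈ Icc (0 : ℝ) 1, |uWord w Φ l s| ≤ B' := by
  induction w with
  | nil => exact ⟨1, zero_le_one, fun Φ l _ _ s _ => by simp [uWord_nil]⟩
  | cons i w ih =>
    obtain ⟨B', hB', h⟩ := ih
    refine ⟨B' * (B ^ (i.1 : ℕ) * B ^ ((i.2 : ℕ) + 1) * B), by positivity,
      fun Φ l hl hΦ s hs => ?_⟩
    rw [uWord_cons_eq i w Φ hl hs, ← Real.norm_eq_abs]
    refine (intervalIntegral.norm_integral_le_of_norm_le_const
      (C := B' * (B ^ (i.1 : ℕ) * B ^ ((i.2 : ℕ) + 1) * B)) fun t ht => ?_).trans ?_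
    · rw [uIoc_of_le hs.1] at ht
      have ht1 : t ∈ Icc (0 : ℝ) 1 := ⟨ht.1.le, ht.2.trans hs.2⟩
      have h1 := abs_evalAt_monomial_le (hΦ.x t ht1) (hΦ.y t ht1) i.1 (i.2 + 1)
      have h2 := hΦ.xs t ht1
      have h3 := h Φ l hl hΦ t ht1
      rw [Real.norm_eq_abs, abs_mul, LevelFamily.ds, basicForm, evalAt_zero, zero_mul, add_zero,
        abs_mul]
      gcongr
    · rw [sub_zero, abs_of_nonneg hs.1]
      exact mul_le_of_le_one_right (by positivity) hs.2

theorem exists_bound_of_mem {m L : ℕ} {u : UFun H D} (hu : u ∈ combSpace H D n m L) (B : ℝ)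
    (hB : 0 ≤ B) : ∃ B', 0 ≤ B' ∧ ∀ (Φ : LevelFamily H D), ∀ l ∈ Φ.dom, Φ.IsBoundedBy l B →
      ∀ s ∈ Icc (0 : ℝ) 1, |u Φ l s| ≤ B' := by
  induction hu using Submodule.span_induction with
  | mem u hu =>
    obtain ⟨a, b, c, e, w, -, -, rfl⟩ := hu
    obtain ⟨B', hB', h⟩ := exists_bound_uWord (H := H) (D := D) B hB w
    refine ⟨B ^ a * B ^ b * (B ^ c * B ^ e) * B', by positivity, fun Φ l hl hΦ s hs => ?_⟩
    have h1 := abs_evalAt_monomial_le (hΦ.x s hs) (hΦ.y s hs) c e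
    have h3 := h Φ l hl hΦ s hs
    have h4 := hΦ.p
    have h5 := hΦ.q
    simp only [uGen, uLine, uQ, uEval, Pi.mul_apply, Pi.pow_apply, Polynomial.eval_pow,
      Polynomial.eval_X, abs_mul, abs_pow]
    gcongr
  | zero => exact ⟨0, le_rfl, fun Φ l _ _ s _ => by simp⟩
  | add u v _ _ hu hv =>
    obtain ⟨B₁, h₁, h₁'⟩ := hu
    obtain ⟨B₂, h₂, h₂'⟩ := hv
    exact ⟨B₁ + B₂, add_nonneg h₁ h₂, fun Φ l hl hΦ s hs => (abs_add_le _ _).trans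
      (add_le_add (h₁' Φ l hl hΦ s hs) (h₂' Φ l hl hΦ s hs))⟩
  | smul c u _ hu =>
    obtain ⟨B₁, h₁, h₁'⟩ := hu
    refine ⟨|c| * B₁, by positivity, fun Φ l hl hΦ s hs => ?_⟩
    simp only [Pi.smul_apply, smul_eq_mul, abs_mul]
    exact mul_le_mul_of_nonneg_left (h₁' Φ l hl hΦ s hs) (abs_nonneg c)

/-! ### The two families of level curves -/

namespace IsLevelChart

variable {ρ : ℝ} {Ψ : ℝ → ℝ → ℝ → ℝ × ℝ}

theorem isOpen_abs_lt (ρ : ℝ) : IsOpen {t : ℝ | |t| < ρ} := isOpen_lt continuous_abs continuous_const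

/-- The paths with a fixed `ε`, parametrized by the value of `H`. -/
def byValue (h : IsLevelChart H D ρ Ψ) {ε : ℝ} (hε : |ε| < ρ) : LevelFamily H D where
  dom := {t | |t| < ρ}
  path t s := Ψ t ε s
  isOpen_dom := isOpen_abs_lt ρ
  smooth t ht s hs := (h.smooth t ε s ht hε hs).comp
    (f := fun q : ℝ × ℝ => ((q.1, ε, q.2) : ℝ × ℝ × ℝ)) (t, s)
    (contDiffAt_fst.prodMk (contDiffAt_const.prodMk contDiffAt_snd))
  start t ht := h.start t ε ht hε
  level t ht s hs := by rw [h.level t ε s ht hε hs, h.level t ε 0 ht hε ⟨le_rfl, zero_le_one⟩]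
  good t ht := h.good t ε ht hε

/-- The paths in a fixed level curve of `H`, parametrized by `ε`. -/
def byParameter (h : IsLevelChart H D ρ Ψ) {t : ℝ} (ht : |t| < ρ) : LevelFamily H D where
  dom := {ε | |ε| < ρ}
  path ε s := Ψ t ε s
  isOpen_dom := isOpen_abs_lt ρ
  smooth ε hε s hs := (h.smooth t ε s ht hε hs).comp
    (f := fun q : ℝ × ℝ => ((t, q.1, q.2) : ℝ × ℝ × ℝ)) (ε, s)
    (contDiffAt_const.prodMk (contDiffAt_fst.prodMk contDiffAt_snd))
  start ε hε := h.start t ε ht hε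
  level ε hε s hs := by rw [h.level t ε s ht hε hs, h.level t ε 0 ht hε ⟨le_rfl, zero_le_one⟩]
  good ε hε := h.good t ε ht hε

theorem tl_byValue (h : IsLevelChart H D ρ Ψ) {ε : ℝ} (hε : |ε| < ρ) {t : ℝ} (ht : |t| < ρ) :
    (h.byValue hε).tl t = 1 := by
  have ht' : t ∈ (h.byValue hε).dom := ht
  rw [← (h.byValue hε).dl_extD_eq ht' LevelFamily.zero_mem]
  refine ((h.byValue hε).hasDerivAt_evalAt_left ht' LevelFamily.zero_mem H).unique
    ((hasDerivAt_id t).congr_of_eventuallyEq ?_)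
  filter_upwards [(isOpen_abs_lt ρ).mem_nhds ht] with t' ht'
  exact h.level t' ε 0 ht' hε LevelFamily.zero_mem

/-- The integrals over the closed paths do not depend on `ε`: at a fixed level and with fixed
endpoints, the differential `u θ + v dH` of `F` vanishes at the end of the path. -/
theorem period_eq (h : IsLevelChart H D ρ Ψ) {θ : OneForm ℝ} {u F v : UFun H D} {m L : ℕ}
    (hF : F ∈ combSpace H D n m L) (hs : IsStep u F v θ) {t ε : ℝ} (ht : |t| < ρ) (hε : |ε| < ρ)
    (h0 : |(0 : ℝ)| < ρ) : F (h.byValue hε) t 1 = F (h.byValue h0) t 1 := by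
  have h1 : (1 : ℝ) ∈ Icc (0 : ℝ) 1 := ⟨zero_le_one, le_rfl⟩
  set Φ := h.byParameter ht with hΦ
  have e1 : F (h.byValue hε) t 1 = F Φ ε 1 :=
    congr_of_mem hF (Φ := h.byValue hε) (Φ' := Φ) (l := t) (l' := ε) rfl 1
  have e2 : F (h.byValue h0) t 1 = F Φ 0 1 :=
    congr_of_mem hF (Φ := h.byValue h0) (Φ' := Φ) (l := t) (l' := 0) rfl 1
  have hcst : ∀ ε ∈ Φ.dom, ∀ ε' ∈ Φ.dom, Φ.path ε 1 = Φ.path ε' 1 ∧ Φ.p ε = Φ.p ε' := by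
    intro ε hε ε' hε'
    have a1 : Ψ t ε 0 = Ψ t ε' 0 := (h.init t ε ht hε).trans (h.init t ε' ht hε').symm
    refine ⟨?_, congrArg Prod.snd a1⟩
    change Ψ t ε 1 = Ψ t ε' 1
    rw [h.closed t ε ht hε, h.closed t ε' ht hε', a1]
  have hd : ∀ ε ∈ Φ.dom, HasDerivAt (fun ε => F Φ ε 1) 0 ε := by
    intro ε hε
    have hnhds := Φ.isOpen_dom.mem_nhds hε
    have hx : Φ.xl ε 1 = 0 := by
      refine (Φ.mixed_x.deriv_left ε hε 1 h1).unique
        ((hasDerivAt_const ε (Φ.x ε 1)).congr_of_eventuallyEq ?_)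
      filter_upwards [hnhds] with ε' hε'
      exact congrArg Prod.fst (hcst ε' hε' ε hε).1
    have hy : Φ.yl ε 1 = 0 := by
      refine (Φ.mixed_y.deriv_left ε hε 1 h1).unique
        ((hasDerivAt_const ε (Φ.y ε 1)).congr_of_eventuallyEq ?_)
      filter_upwards [hnhds] with ε' hε'
      exact congrArg Prod.snd (hcst ε' hε' ε hε).1
    have ht0 : Φ.tl ε = 0 := by
      rw [← Φ.dl_extD_eq hε h1, hx, hy]
      ring
    refine (hs.left Φ ε hε 1 h1).congr_deriv ?_
    rw [LevelFamily.dl, hx, hy, ht0]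
    ring
  have hconv : Convex ℝ Φ.dom := by
    have : Φ.dom = Ioo (-ρ) ρ := by ext x; exact abs_lt (a := x)
    rw [this]
    exact convex_Ioo _ _
  have := hconv.norm_image_sub_le_of_norm_hasDerivWithin_le (C := 0)
    (fun ε hε => (hd ε hε).hasDerivWithinAt) (by simp) (x := 0) (y := ε) h0 hε
  rw [zero_mul, norm_le_zero_iff, sub_eq_zero] at this
  rw [e1, e2, this]

theorem xs_byValue (h : IsLevelChart H D ρ Ψ) {ε : ℝ} (hε : |ε| < ρ) {t s : ℝ} (ht : |t| < ρ)
    (hs : s ∈ Icc (0 : ℝ) 1) : (h.byValue hε).xs t s =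
      (fderiv ℝ (fun q : ℝ × ℝ × ℝ => Ψ q.1 q.2.1 q.2.2) (t, ε, s) (0, 0, 1)).1 := by
  refine ((h.byValue hε).mixed_x.deriv_right t ht s hs).unique ?_
  have h1 := ((h.smooth t ε s ht hε hs).differentiableAt (by norm_num)).hasFDerivAt
  have h2 : HasDerivAt (fun s : ℝ => ((t, ε, s) : ℝ × ℝ × ℝ)) (0, 0, 1) s :=
    (hasDerivAt_const s t).prodMk ((hasDerivAt_const s ε).prodMk (hasDerivAt_id s))
  have h3 : HasDerivAt (fun s => Ψ t ε s)
      (fderiv ℝ (fun q : ℝ × ℝ × ℝ => Ψ q.1 q.2.1 q.2.2) (t, ε, s) (0, 0, 1)) s :=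
    HasFDerivAt.comp_hasDerivAt (l := fun q : ℝ × ℝ × ℝ => Ψ q.1 q.2.1 q.2.2) s h1 h2
  exact h3.fst

theorem exists_isBoundedBy (h : IsLevelChart H D ρ Ψ) : ∃ B, 0 ≤ B ∧
    ∀ (t ε : ℝ) (hε : |ε| < ρ), |t| ≤ ρ / 2 → |ε| ≤ ρ / 2 → (h.byValue hε).IsBoundedBy t B := by
  have hρ := h.pos
  set G : ℝ × ℝ × ℝ → ℝ × ℝ := fun q => Ψ q.1 q.2.1 q.2.2 with hG
  set K : Set (ℝ × ℝ × ℝ) := Icc (-(ρ / 2)) (ρ / 2) ×ˢ Icc (-(ρ / 2)) (ρ / 2) ×ˢ Icc 0 1 with hK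
  have hKc : IsCompact K := isCompact_Icc.prod (isCompact_Icc.prod isCompact_Icc)
  have hKρ : ∀ q ∈ K, |q.1| < ρ ∧ |q.2.1| < ρ ∧ q.2.2 ∈ Icc (0 : ℝ) 1 := fun q hq =>
    ⟨(abs_le.2 hq.1).trans_lt (by linarith), (abs_le.2 hq.2.1).trans_lt (by linarith), hq.2.2⟩
  have hGs : ∀ q ∈ K, ContDiffAt ℝ 2 G q := fun q hq =>
    h.smooth _ _ _ (hKρ q hq).1 (hKρ q hq).2.1 (hKρ q hq).2.2
  have hI0 := LevelFamily.zero_mem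
  obtain ⟨B₁, hB₁⟩ := hKc.exists_bound_of_continuousOn (f := G)
    fun q hq => (hGs q hq).continuousAt.continuousWithinAt
  obtain ⟨B₂, hB₂⟩ := hKc.exists_bound_of_continuousOn (f := fun q => fderiv ℝ G q (0, 0, 1))
    fun q hq => ((((hGs q hq).fderiv_right (m := 1) (by norm_num)).continuousAt).clm_apply
      continuousAt_const).continuousWithinAt
  have hmem0 : ∀ q ∈ K, ((q.1, q.2.1, 0) : ℝ × ℝ × ℝ) ∈ K := fun q hq => ⟨hq.1, hq.2.1, hI0⟩
  obtain ⟨B₃, hB₃⟩ := hKc.exists_bound_of_continuousOn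
    (f := fun q => ((disc H D).eval (G (q.1, q.2.1, 0)).2)⁻¹) (by
      intro q hq
      have h1 : ContinuousAt (fun q : ℝ × ℝ × ℝ => G (q.1, q.2.1, 0)) q :=
        (hGs _ (hmem0 q hq)).continuousAt.comp
          (f := fun q : ℝ × ℝ × ℝ => ((q.1, q.2.1, 0) : ℝ × ℝ × ℝ)) (by fun_prop)
      have h2 : ContinuousAt (fun q : ℝ × ℝ × ℝ => (disc H D).eval (G (q.1, q.2.1, 0)).2) q :=
        (disc H D).continuous.continuousAt.comp h1.snd
      exact (h2.inv₀ (h.good _ _ (hKρ q hq).1 (hKρ q hq).2.1)).continuousWithinAt)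
  refine ⟨max 0 (max B₁ (max B₂ B₃)), le_max_left _ _, fun t ε hε ht hε' => ?_⟩
  have hm : ∀ s ∈ Icc (0 : ℝ) 1, ((t, ε, s) : ℝ × ℝ × ℝ) ∈ K := fun s hs =>
    ⟨abs_le.1 ht, abs_le.1 hε', hs⟩
  have le1 : B₁ ≤ max 0 (max B₁ (max B₂ B₃)) := by simp
  have le2 : B₂ ≤ max 0 (max B₁ (max B₂ B₃)) := by simp
  have le3 : B₃ ≤ max 0 (max B₁ (max B₂ B₃)) := by simp
  exact
    { p := ((norm_snd_le (G (t, ε, 0))).trans (hB₁ _ (hm 0 hI0))).trans le1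
      q := (hB₃ _ (hm 0 hI0)).trans le3
      x := fun s hs => ((norm_fst_le (G (t, ε, s))).trans (hB₁ _ (hm s hs))).trans le1
      y := fun s hs => ((norm_snd_le (G (t, ε, s))).trans (hB₁ _ (hm s hs))).trans le1
      xs := fun s hs => by
        rw [h.xs_byValue hε (ht.trans_lt (by linarith)) hs]
        exact ((norm_fst_le _).trans (hB₂ _ (hm s hs))).trans le2 }

end IsLevelChart

end Perturbation

section Leaf

variable {H : BiPoly ℝ} {D : Polynomial ℝ} {n : ℕ}

/-! ### Derivatives along the leaves -/

theorem continuousOn_dl (θ : OneForm ℝ) (Φ : LevelFamily H D) :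
    ContinuousOn (fun z : ℝ × ℝ => Φ.dl θ z.1 z.2) (Φ.dom ×ˢ Icc 0 1) :=
  ((continuousOn_uEval θ.1 Φ).mul Φ.mixed_x.cont_left).add
    ((continuousOn_uEval θ.2 Φ).mul Φ.mixed_y.cont_left)

theorem fderiv_apply_pair (A : ℝ × ℝ →L[ℝ] ℝ) (a : ℝ) : A (a, 1) = A (1, 0) * a + A (0, 1) := by
  have : ((a, 1) : ℝ × ℝ) = a • (1, 0) + (0, 1) := by ext <;> simp
  rw [this, map_add, map_smul, smul_eq_mul, mul_comm]

theorem hasDerivAt_pair {τ : ℝ → ℝ} {a s : ℝ} (hτ : HasDerivAt τ a s) :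
    HasDerivAt (fun s => ((τ s, s) : ℝ × ℝ)) (a, 1) s :=
  hτ.prodMk (hasDerivAt_id s)

/-- The chain rule for a moving point whose level `τ s` varies. -/
theorem IsStep.hasDerivAt_along {u F v : UFun H D} {θ : OneForm ℝ} (h : IsStep u F v θ)
    {m L m' L' : ℕ} (hu : u ∈ combSpace H D n m L) (hv : v ∈ combSpace H D n m' L')
    (Φ : LevelFamily H D) {τ : ℝ → ℝ} {a s : ℝ} (hs : s ∈ Ioo (0 : ℝ) 1) (hl : τ s ∈ Φ.dom)
    (hτ : HasDerivAt τ a s) :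
    HasDerivAt (fun s => F Φ (τ s) s)
      ((u Φ (τ s) s * Φ.dl θ (τ s) s + v Φ (τ s) s * Φ.tl (τ s)) * a +
        u Φ (τ s) s * Φ.ds θ (τ s) s) s := by
  set g₁ : ℝ → ℝ → ℝ := fun l s => u Φ l s * Φ.dl θ l s + v Φ l s * Φ.tl l with hg₁
  set g₂ : ℝ → ℝ → ℝ := fun l s => u Φ l s * Φ.ds θ l s with hg₂
  have hO : Φ.dom ×ˢ Ioo (0 : ℝ) 1 ∈ 𝓝 (τ s, s) :=
    (Φ.isOpen_dom.prod isOpen_Ioo).mem_nhds ⟨hl, hs⟩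
  have hO' : Φ.dom ×ˢ Icc (0 : ℝ) 1 ∈ 𝓝 (τ s, s) :=
    mem_of_superset hO (prod_mono le_rfl Ioo_subset_Icc_self)
  have htl : ContinuousOn (fun z : ℝ × ℝ => Φ.tl z.1) (Φ.dom ×ˢ Icc 0 1) :=
    (continuousOn_tl Φ).comp continuousOn_fst fun z hz => hz.1
  have hc₁ : ContinuousAt (fun z : ℝ × ℝ => g₁ z.1 z.2) (τ s, s) :=
    (((continuousOn_of_mem hu Φ).mul (continuousOn_dl θ Φ)).add
      ((continuousOn_of_mem hv Φ).mul htl)).continuousAt hO'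
  have hc₂ : ContinuousAt (fun z : ℝ × ℝ => g₂ z.1 z.2) (τ s, s) :=
    ((continuousOn_of_mem hu Φ).mul (continuousOn_ds θ Φ)).continuousAt hO'
  have key := hasStrictFDerivAt_uncurry_coprod (u := (τ s, s)) (f := fun l s => F Φ l s)
    (f₁ := fun l s => g₁ l s • ContinuousLinearMap.id ℝ ℝ)
    (f₂ := fun l s => g₂ l s • ContinuousLinearMap.id ℝ ℝ)
    (by
      filter_upwards [hO] with z hz
      exact (h.left Φ z.1 hz.1 z.2 (Ioo_subset_Icc_self hz.2)).hasFDerivAt.congr_fderiv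
        (by ext; simp [Function.HasUncurry.uncurry, hg₁]))
    (by
      filter_upwards [hO] with z hz
      exact (h.right Φ z.1 hz.1 z.2 hz.2).hasFDerivAt.congr_fderiv
        (by ext; simp [Function.HasUncurry.uncurry, hg₂]))
    (hc₁.smul continuousAt_const) (hc₂.smul continuousAt_const)
  refine (HasFDerivAt.comp_hasDerivAt (f := fun s => (τ s, s)) s key.hasFDerivAt
    (hasDerivAt_pair hτ)).congr_deriv ?_
  simp [Function.HasUncurry.uncurry, hg₁, hg₂]

variable {ω : OneForm ℝ} {y₀ : ℝ} {δ : ℝ → ℝ × ℝ} {r : ℝ} {γ : ℝ → ℝ → ℝ → ℝ × ℝ}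

theorem IsLeafFamily.exists_bound_pullback (h : IsLeafFamily H ω y₀ δ r γ) {η : ℝ} (hη : 0 < η)
    (hr : η ≤ r) {z : ℝ} (hz : |z| < η) (θ : OneForm ℝ) :
    ∃ B, 0 ≤ B ∧ ∀ ε s, |ε| ≤ η / 2 → s ∈ Icc (0 : ℝ) 1 → |pullback (γ z ε) θ s| ≤ B := by
  set g : ℝ × ℝ × ℝ → ℝ × ℝ := fun q => γ q.1 q.2.1 q.2.2 with hg
  set K : Set (ℝ × ℝ) := Icc (-(η / 2)) (η / 2) ×ˢ Icc 0 1 with hK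
  have hKc : IsCompact K := isCompact_Icc.prod isCompact_Icc
  have hι : Continuous fun q : ℝ × ℝ => ((z, q.1, q.2) : ℝ × ℝ × ℝ) := by fun_prop
  have han : ∀ q ∈ K, AnalyticAt ℝ g (z, q.1, q.2) := fun q hq =>
    h.analyticAt (hz.trans_le hr) ((abs_le.2 hq.1).trans_lt (by linarith)) hq.2
  have hv : ContinuousOn (fun q : ℝ × ℝ => fderiv ℝ g (z, q.1, q.2) (0, 0, 1)) K := by
    intro q hq
    have h1 : ContinuousAt (fun q : ℝ × ℝ => fderiv ℝ g (z, q.1, q.2)) q :=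
      ContinuousAt.comp (g := fderiv ℝ g) (f := fun q : ℝ × ℝ => ((z, q.1, q.2) : ℝ × ℝ × ℝ))
        (han q hq).fderiv.continuousAt hι.continuousAt
    exact (h1.clm_apply continuousAt_const).continuousWithinAt
  have hp : ContinuousOn (fun q : ℝ × ℝ => g (z, q.1, q.2)) K := fun q hq =>
    (ContinuousAt.comp (g := g) (f := fun q : ℝ × ℝ => ((z, q.1, q.2) : ℝ × ℝ × ℝ))
      (han q hq).continuousAt hι.continuousAt).continuousWithinAt
  set f : ℝ × ℝ → ℝ := fun q =>
    evalAt (g (z, q.1, q.2)) θ.1 * (fderiv ℝ g (z, q.1, q.2) (0, 0, 1)).1 +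
      evalAt (g (z, q.1, q.2)) θ.2 * (fderiv ℝ g (z, q.1, q.2) (0, 0, 1)).2 with hf
  have hfc : ContinuousOn f K :=
    (((continuous_evalAt θ.1).comp_continuousOn hp).mul hv.fst).add
      (((continuous_evalAt θ.2).comp_continuousOn hp).mul hv.snd)
  obtain ⟨B, hB⟩ := hKc.exists_bound_of_continuousOn hfc
  refine ⟨max 0 B, le_max_left _ _, fun ε s hε hs => le_trans ?_ (le_max_right _ _)⟩
  have hm : ((ε, s) : ℝ × ℝ) ∈ K := ⟨abs_le.1 hε, hs⟩
  have hd : HasDerivAt (γ z ε) (fderiv ℝ g (z, ε, s) (0, 0, 1)) s := by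
    have h1 : HasFDerivAt g (fderiv ℝ g (z, ε, s)) (z, ε, s) :=
      (han _ hm).differentiableAt.hasFDerivAt
    have h2 : HasDerivAt (fun s : ℝ => ((z, ε, s) : ℝ × ℝ × ℝ)) (0, 0, 1) s :=
      (hasDerivAt_const s z).prodMk ((hasDerivAt_const s ε).prodMk (hasDerivAt_id s))
    exact HasFDerivAt.comp_hasDerivAt (l := g) s h1 h2
  have h3 : pullback (γ z ε) θ s = f (ε, s) := by
    rw [pullback, hd.deriv]
  rw [h3]
  exact hB _ hm

/-- The function `H + ∑ ε^k F_k` is constant along the leaves, up to terms of order `ε^(K+1)`: on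
`dH + ε ω = 0` the differentials `ε^k (u_{k-1} ω + u_k dH)` telescope to `-ε^(K+1) u_K ω`. -/
theorem leaf_estimate {ρ η : ℝ} {Ψ : ℝ → ℝ → ℝ → ℝ × ℝ} (hΨ : IsLevelChart H D ρ Ψ)
    (h : IsLeafFamily H ω y₀ δ r γ) (hη : 0 < η) (hηr : η ≤ r) (hηρ : η ≤ ρ / 2)
    (hleaf : ∀ z ε s : ℝ, |z| < η → |ε| < η → s ∈ Icc (0 : ℝ) 1 →
      |evalAt (γ z ε s) H| < ρ / 2 ∧ Ψ (evalAt (γ z ε s) H) ε s = γ z ε s)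
    {u F : ℕ → UFun H D} (hu0 : u 0 = 1) (hu : ∀ k, ∃ m L, u k ∈ combSpace H D n m L)
    (hF : ∀ k, ∃ m L, F k ∈ combSpace H D n m L)
    (hstep : ∀ k, IsStep (u k) (F (k + 1)) (u (k + 1)) ω) (K : ℕ) {z : ℝ} (hz : |z| < η)
    (h0 : |(0 : ℝ)| < ρ) :
    ∃ B, ∀ ε, |ε| ≤ η / 2 → |evalAt (γ z ε 1) H +
      ∑ k ∈ Finset.range K, ε ^ (k + 1) * F (k + 1) (hΨ.byValue h0) (evalAt (γ z ε 1) H) 1 -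
      evalAt (γ z ε 0) H| ≤ B * |ε| ^ (K + 1) := by
  have hρ := hΨ.pos
  obtain ⟨B₀, hB₀, hbd⟩ := hΨ.exists_isBoundedBy
  obtain ⟨mK, LK, huK⟩ := hu K
  obtain ⟨B₁, hB₁, hbdu⟩ := exists_bound_of_mem huK B₀ hB₀
  obtain ⟨B₂, hB₂, hbdw⟩ := h.exists_bound_pullback hη hηr hz ω
  refine ⟨B₁ * B₂, fun ε hε => ?_⟩
  have hεη : |ε| < η := hε.trans_lt (by linarith)
  have hερ : |ε| < ρ := hεη.trans_le (by linarith)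
  set Φ := hΨ.byValue hερ with hΦ
  set τ : ℝ → ℝ := fun s => evalAt (γ z ε s) H with hτ
  set w : ℝ → ℝ := fun s => pullback (γ z ε) ω s with hw
  have hdom : ∀ s ∈ Icc (0 : ℝ) 1, τ s ∈ Φ.dom := fun s hs =>
    (hleaf z ε s hz hεη hs).1.trans (by linarith)
  have hdiff : ∀ s ∈ Icc (0 : ℝ) 1, DifferentiableAt ℝ (γ z ε) s := fun s hs =>
    h.differentiableAt (hz.trans_le hηr) (hεη.trans_le hηr) hs
  have hτd : ∀ s ∈ Icc (0 : ℝ) 1, HasDerivAt τ (-ε * w s) s := by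
    intro s hs
    refine (hasDerivAt_evalAt_path (hdiff s hs) H).congr_deriv ?_
    have := h.leaf z ε s (hz.trans_le hηr) (hεη.trans_le hηr) hs
    simp only [hw]
    linarith
  -- the velocity of the leaf, split into the change of level and the motion in the level
  have hvel : ∀ s ∈ Ioo (0 : ℝ) 1, Φ.dl ω (τ s) s * (-ε * w s) + Φ.ds ω (τ s) s = w s := by
    intro s hs
    have hs' := Ioo_subset_Icc_self hs
    have hpath : ∀ᶠ t in 𝓝 s, Φ.path (τ t) t = γ z ε t := by
      filter_upwards [isOpen_Ioo.mem_nhds hs] with t ht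
      exact (hleaf z ε t hz hεη (Ioo_subset_Icc_self ht)).2
    have hsm := Φ.smooth (τ s) (hdom s hs') s hs'
    have hx : (deriv (γ z ε) s).1 = Φ.xl (τ s) s * (-ε * w s) + Φ.xs (τ s) s := by
      have h1 := HasFDerivAt.comp_hasDerivAt (f := fun s => (τ s, s)) s
        (hsm.fst.differentiableAt (by norm_num)).hasFDerivAt (hasDerivAt_pair (hτd s hs'))
      rw [fderiv_apply_pair] at h1
      have h2 : HasDerivAt (fun s => (γ z ε s).1) (deriv (γ z ε) s).1 s :=
        (hdiff s hs').hasDerivAt.fst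
      refine h2.unique (h1.congr_of_eventuallyEq ?_)
      filter_upwards [hpath] with t ht
      exact congrArg Prod.fst ht.symm
    have hy : (deriv (γ z ε) s).2 = Φ.yl (τ s) s * (-ε * w s) + Φ.ys (τ s) s := by
      have h1 := HasFDerivAt.comp_hasDerivAt (f := fun s => (τ s, s)) s
        (hsm.snd.differentiableAt (by norm_num)).hasFDerivAt (hasDerivAt_pair (hτd s hs'))
      rw [fderiv_apply_pair] at h1
      have h2 : HasDerivAt (fun s => (γ z ε s).2) (deriv (γ z ε) s).2 s :=
        (hdiff s hs').hasDerivAt.snd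
      refine h2.unique (h1.congr_of_eventuallyEq ?_)
      filter_upwards [hpath] with t ht
      exact congrArg Prod.snd ht.symm
    have e : w s = evalAt (Φ.path (τ s) s) ω.1 * (deriv (γ z ε) s).1 +
        evalAt (Φ.path (τ s) s) ω.2 * (deriv (γ z ε) s).2 := by
      rw [hpath.self_of_nhds]
      rfl
    rw [hx, hy] at e
    rw [LevelFamily.dl, LevelFamily.ds]
    linear_combination -e
  set A : ℝ → ℝ := fun s => τ s + ∑ k ∈ Finset.range K, ε ^ (k + 1) * F (k + 1) Φ (τ s) s with hA
  have hAd : ∀ s ∈ Ioo (0 : ℝ) 1, HasDerivAt A (-(ε ^ (K + 1) * (u K Φ (τ s) s * w s))) s := by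
    intro s hs
    have hs' := Ioo_subset_Icc_self hs
    have hk : ∀ k ∈ Finset.range K, HasDerivAt (fun s => ε ^ (k + 1) * F (k + 1) Φ (τ s) s)
        (ε ^ (k + 1) * (u k Φ (τ s) s * w s) - ε ^ (k + 2) * (u (k + 1) Φ (τ s) s * w s)) s := by
      intro k _
      obtain ⟨m, L, hm⟩ := hu k
      obtain ⟨m', L', hm'⟩ := hu (k + 1)
      refine (((hstep k).hasDerivAt_along hm hm' Φ hs (hdom s hs') (hτd s hs')).const_mul
        (ε ^ (k + 1))).congr_deriv ?_
      rw [hΨ.tl_byValue hερ (hdom s hs')]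
      linear_combination (ε ^ (k + 1) * u k Φ (τ s) s) * hvel s hs
    refine ((hτd s hs').add (HasDerivAt.fun_sum hk)).congr_deriv ?_
    rw [Finset.sum_range_sub' (fun k => ε ^ (k + 1) * (u k Φ (τ s) s * w s)), hu0]
    simp only [Pi.one_apply]
    ring
  have hAc : ContinuousOn A (Icc 0 1) := by
    have hτc : ContinuousOn τ (Icc 0 1) := fun s hs => (hτd s hs).continuousAt.continuousWithinAt
    refine hτc.add (continuousOn_finsetSum _ fun k _ => continuousOn_const.mul ?_)
    obtain ⟨m, L, hm⟩ := hF (k + 1)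
    exact (continuousOn_of_mem hm Φ).comp (f := fun s => (τ s, s)) (hτc.prodMk continuousOn_id)
      fun s hs => ⟨hdom s hs, hs⟩
  -- the derivative of `A` is of order `ε^(K+1)`, hence so is its increment
  obtain ⟨ξ, hξ, hslope⟩ := exists_hasDerivAt_eq_slope A _ zero_lt_one hAc hAd
  have hξ' := Ioo_subset_Icc_self hξ
  have hI0 := LevelFamily.zero_mem
  have hI1 : (1 : ℝ) ∈ Icc (0 : ℝ) 1 := ⟨zero_le_one, le_rfl⟩
  have hA0 : A 0 = τ 0 := by
    simp only [hA]
    rw [Finset.sum_eq_zero fun k _ => by rw [(hstep k).zero Φ (τ 0) (hdom 0 hI0), mul_zero],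
      add_zero]
  have hA1 : A 1 = τ 1 +
      ∑ k ∈ Finset.range K, ε ^ (k + 1) * F (k + 1) (hΨ.byValue h0) (τ 1) 1 := by
    simp only [hA]
    congr 1
    refine Finset.sum_congr rfl fun k _ => ?_
    obtain ⟨m, L, hm⟩ := hF (k + 1)
    rw [hΦ, hΨ.period_eq hm (hstep k) (hdom 1 hI1) hερ h0]
  have heq : τ 1 + ∑ k ∈ Finset.range K, ε ^ (k + 1) * F (k + 1) (hΨ.byValue h0) (τ 1) 1 - τ 0 =
      -(ε ^ (K + 1) * (u K Φ (τ ξ) ξ * w ξ)) := by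
    rw [← hA1, ← hA0, hslope]
    ring
  change |τ 1 + _ - τ 0| ≤ _
  rw [heq, abs_neg, abs_mul, abs_mul, abs_pow, mul_comm]
  have b1 : |u K Φ (τ ξ) ξ| ≤ B₁ := hbdu Φ (τ ξ) (hdom ξ hξ')
    (hbd _ _ hερ (hleaf z ε ξ hz hεη hξ').1.le (hεη.le.trans hηρ)) ξ hξ'
  have b2 : |w ξ| ≤ B₂ := hbdw ε ξ hε hξ'
  gcongr

end Leaf

section Expansion

/-! ### Comparison of the expansions in `ε` -/

theorem tendsto_pow_succ_zero (K : ℕ) :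
    Tendsto (fun ε : ℝ => ε ^ (K + 1)) (𝓝[≠] 0) (𝓝 0) := by
  have : Continuous fun ε : ℝ => ε ^ (K + 1) := by fun_prop
  exact (this.tendsto' 0 0 (by simp)).mono_left nhdsWithin_le_nhds

theorem coeff_eq_zero_of_isLittleO {K : ℕ} {c : ℕ → ℝ}
    (h : (fun ε : ℝ => ∑ k ∈ Finset.range (K + 1), c k * ε ^ k) =o[𝓝[≠] 0] fun ε => ε ^ K) :
    ∀ k ≤ K, c k = 0 := by
  induction K generalizing c with
  | zero =>
    intro k hk
    rw [Nat.le_zero.1 hk]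
    simp only [zero_add, Finset.range_one, Finset.sum_singleton, pow_zero, mul_one] at h
    exact tendsto_nhds_unique tendsto_const_nhds ((Asymptotics.isLittleO_one_iff ℝ).1 h)
  | succ K ih =>
    have h0 : c 0 = 0 := by
      have h1 := h.trans_tendsto (tendsto_pow_succ_zero K)
      have h2 : Continuous fun ε : ℝ => ∑ k ∈ Finset.range (K + 1 + 1), c k * ε ^ k := by fun_prop
      have h3 := (h2.tendsto 0).mono_left (nhdsWithin_le_nhds (s := {(0 : ℝ)}ᶜ))
      rw [Finset.sum_range_succ'] at h3
      simp only [ne_eq, Nat.add_eq_zero_iff, one_ne_zero, and_false, not_false_eq_true, zero_pow,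
        mul_zero, Finset.sum_const_zero, pow_zero, mul_one, zero_add] at h3
      exact tendsto_nhds_unique h3 h1
    have h4 : (fun ε : ℝ => ∑ k ∈ Finset.range (K + 1), c (k + 1) * ε ^ k) =o[𝓝[≠] 0]
        fun ε => ε ^ K := by
      refine ((Asymptotics.isBigO_refl (fun ε : ℝ => ε⁻¹) _).mul_isLittleO h).congr' ?_ ?_
      · filter_upwards [self_mem_nhdsWithin] with ε hε
        rw [Finset.sum_range_succ', h0, zero_mul, add_zero, Finset.mul_sum]
        refine Finset.sum_congr rfl fun k _ => ?_
        have hε' : ε ≠ 0 := hε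
        field_simp
        ring
      · filter_upwards [self_mem_nhdsWithin] with ε hε
        have hε' : ε ≠ 0 := hε
        field_simp
        ring
    intro k hk
    rcases k with _ | k
    · exact h0
    · exact ih h4 k (by omega)

theorem isBigO_sub_taylor {f : ℝ → ℝ} (hf : AnalyticAt ℝ f 0) (N : ℕ) :
    (fun ε => f ε - ∑ k ∈ Finset.range N, iteratedDeriv k f 0 / (k.factorial : ℝ) * ε ^ k)
      =O[𝓝 0] fun ε => ε ^ N := by
  have h := hf.hasFPowerSeriesAt.isBigO_sub_partialSum_pow N
  simp only [zero_add, ← norm_pow] at h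
  refine h.of_norm_right.congr_left fun ε => ?_
  simp only [FormalMultilinearSeries.partialSum, FormalMultilinearSeries.ofScalars_apply_eq,
    smul_eq_mul]

/-- If `f(Δ) + ∑ ε^k f_k(f(Δ))` equals `f(z)` up to `O(ε^(K+1))`, and `Δ = z + M ε^K + …`, then
`f'(z) M + f_K(f(z)) = 0`. -/
theorem first_coefficient_eq {K : ℕ} (hK : 1 ≤ K) {Δ f : ℝ → ℝ} {φ φ' : ℕ → ℝ → ℝ} {z M c B η : ℝ}
    (hη : 0 < η) (hΔ0 : Tendsto Δ (𝓝 0) (𝓝 z))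
    (hΔ : (fun ε => Δ ε - z - M * ε ^ K) =O[𝓝 0] fun ε => ε ^ (K + 1))
    (hf : HasDerivAt f c z) (hφ : ∀ k, HasDerivAt (φ k) (φ' k (f z)) (f z))
    (hest : ∀ ε, |ε| ≤ η → |f (Δ ε) + ∑ k ∈ Finset.range K, ε ^ (k + 1) * φ (k + 1) (f (Δ ε)) -
      f z| ≤ B * |ε| ^ (K + 1)) : c * M + φ K (f z) = 0 := by
  have hle : 𝓝[≠] (0 : ℝ) ≤ 𝓝 0 := nhdsWithin_le_nhds
  have hpow : (fun ε : ℝ => ε ^ (K + 1)) =o[𝓝[≠] 0] fun ε => ε ^ K :=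
    (Asymptotics.isLittleO_pow_pow (Nat.lt_succ_self K)).mono hle
  have h1 : (fun ε => Δ ε - z - M * ε ^ K) =o[𝓝[≠] 0] fun ε => ε ^ K :=
    (hΔ.mono hle).trans_isLittleO hpow
  have h2 : (fun ε => Δ ε - z) =O[𝓝[≠] 0] fun ε => ε ^ K := by
    refine (h1.isBigO.add ((Asymptotics.isBigO_refl _ _).const_mul_left M)).congr_left fun ε => ?_
    ring
  have hΔt : Tendsto Δ (𝓝[≠] 0) (𝓝 z) := hΔ0.mono_left hle
  have h3 : (fun ε => f (Δ ε) - f z - c * (Δ ε - z)) =o[𝓝[≠] 0] fun ε => ε ^ K := by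
    refine ((hf.isLittleO.comp_tendsto hΔt).trans_isBigO h2).congr_left fun ε => ?_
    simp only [Function.comp_apply, smul_eq_mul]
    ring
  have h4 : (fun ε => f (Δ ε) - f z) =O[𝓝[≠] 0] fun ε => ε ^ K := by
    refine (h3.isBigO.add (h2.const_mul_left c)).congr_left fun ε => ?_
    ring
  have hft : Tendsto (fun ε => f (Δ ε)) (𝓝[≠] 0) (𝓝 (f z)) :=
    (hf.continuousAt.tendsto).comp hΔt
  have h5 : ∀ k, (fun ε => ε ^ (k + 1) * (φ (k + 1) (f (Δ ε)) - φ (k + 1) (f z))) =o[𝓝[≠] 0]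
      fun ε => ε ^ K := by
    intro k
    have a1 := ((hφ (k + 1)).isBigO_sub.comp_tendsto hft).trans h4
    have a2 : (fun ε : ℝ => ε ^ (k + 1)) =o[𝓝[≠] 0] fun _ => (1 : ℝ) :=
      (Asymptotics.isLittleO_one_iff ℝ).2 (tendsto_pow_succ_zero k)
    simpa using a2.mul_isBigO a1
  have h6 : (fun ε => f (Δ ε) + ∑ k ∈ Finset.range K, ε ^ (k + 1) * φ (k + 1) (f (Δ ε)) - f z)
      =o[𝓝[≠] 0] fun ε => ε ^ K := by
    refine Asymptotics.IsBigO.trans_isLittleO (Asymptotics.IsBigO.of_bound B ?_) hpow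
    have : ∀ᶠ ε : ℝ in 𝓝 0, |ε| ≤ η :=
      (continuous_abs.tendsto' 0 0 abs_zero).eventually (ge_mem_nhds hη)
    filter_upwards [hle this] with ε hε
    rw [norm_pow]
    exact hest ε hε
  have h7 : (fun ε => c * M * ε ^ K + ∑ k ∈ Finset.range K, ε ^ (k + 1) * φ (k + 1) (f z))
      =o[𝓝[≠] 0] fun ε => ε ^ K := by
    refine (((h6.sub (Asymptotics.IsLittleO.sum (s := Finset.range K) fun k _ => h5 k)).sub
      h3).sub (h1.const_mul_left c)).congr_left fun ε => ?_
    simp only [mul_sub, Finset.sum_apply, Finset.sum_sub_distrib]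
    ring
  have h8 := coeff_eq_zero_of_isLittleO (K := K)
    (c := fun k => (if k = K then c * M else 0) + (if k = 0 then 0 else φ k (f z))) (by
      refine h7.congr_left fun ε => ?_
      simp only [add_mul, Finset.sum_add_distrib, ite_mul, zero_mul]
      rw [Finset.sum_ite_eq' (Finset.range (K + 1)) K, if_pos (Finset.self_mem_range_succ K),
        Finset.sum_range_succ']
      simp only [Nat.add_eq_zero_iff, one_ne_zero, and_false, if_false, if_true, add_zero]
      congr 1
      exact Finset.sum_congr rfl fun k _ => mul_comm _ _) K le_rfl
  have hK0 : K ≠ 0 := by omega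
  simpa [hK0] using h8

theorem iteratedIntegralTo_congr {c c' : ℝ → ℝ × ℝ} (h : EqOn c c' (Icc 0 1))
    (l : List (OneForm ℝ)) : ∀ s ∈ Icc (0 : ℝ) 1,
      iteratedIntegralTo c l s = iteratedIntegralTo c' l s := by
  induction l with
  | nil => exact fun s _ => rfl
  | cons θ l ih =>
    intro s hs
    refine intervalIntegral.integral_congr_uIoo fun t ht => ?_
    rw [uIoo_of_le hs.1] at ht
    have ht1 : t ∈ Ioo (0 : ℝ) 1 := ⟨ht.1, ht.2.trans_le hs.2⟩
    have he : c =ᶠ[𝓝 t] c' := by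
      filter_upwards [isOpen_Ioo.mem_nhds ht1] with x hx
      exact h (Ioo_subset_Icc_self hx)
    simp only [ih t (Ioo_subset_Icc_self ht1), pullback, he.deriv_eq, he.self_of_nhds]

theorem basicIntegral_congr {n K : ℕ} {c c' : ℝ → ℝ × ℝ} (h : EqOn c c' (Icc 0 1))
    (w : Word n K) : basicIntegral c w = basicIntegral c' w :=
  iteratedIntegralTo_congr h _ 1 ⟨zero_le_one, le_rfl⟩

end Expansion

/-! ### The first nonvanishing Melnikov function -/

section FirstNonzero

variable {H : BiPoly ℝ} {D : Polynomial ℝ} {n : ℕ} {ω : OneForm ℝ} {y₀ : ℝ} {δ : ℝ → ℝ × ℝ} {r : ℝ}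
  {γ : ℝ → ℝ → ℝ → ℝ × ℝ}

/-- The first nonvanishing Melnikov function satisfies `H_y(0, p) M_K = -F_K`, where `F_K` is
evaluated at the end of the cycle `γ z 0`. -/
theorem melnikov_eq (hD : D.coeff 0 ≠ 0) (hc : IsCycle H y₀ δ)
    (h : IsLeafFamily H ω y₀ δ r γ) {u F : ℕ → UFun H D} (hu0 : u 0 = 1)
    (hu : ∀ k, ∃ m L, u k ∈ combSpace H D n m L) (hF : ∀ k, ∃ m L, F k ∈ combSpace H D n m L)
    (hstep : ∀ k, IsStep (u k) (F (k + 1)) (u (k + 1)) ω) {K : ℕ}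
    (hM : IsFirstNonzero (holonomy y₀ γ) K) :
    ∀ᶠ z in 𝓝 (0 : ℝ), ∃ (Φ : LevelFamily H D) (l : ℝ), l ∈ Φ.dom ∧ Φ.p l = y₀ + z ∧
      Φ.path l 1 = Φ.path l 0 ∧ EqOn (Φ.path l) (γ z 0) (Icc 0 1) ∧
      evalAt (0, y₀ + z) (pderiv 1 H) * melnikov (holonomy y₀ γ) K z = -(F K Φ l 1) := by
  obtain ⟨hK, hM0, -⟩ := hM
  obtain ⟨ρ, Ψ, hΨ, η, hη, hηr, hηρ, hleaf⟩ := exists_levelChart hD hc h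
  have hρ := hΨ.pos
  have h0ρ : |(0 : ℝ)| < ρ := by simpa using hρ
  have h0η : |(0 : ℝ)| < η := by simpa using hη
  have hr := h.pos
  have h0r : |(0 : ℝ)| < r := by simpa using hr
  have hI0 := LevelFamily.zero_mem
  have hI1 : (1 : ℝ) ∈ Icc (0 : ℝ) 1 := ⟨zero_le_one, le_rfl⟩
  have hev1 : ∀ᶠ z in 𝓝 (0 : ℝ), ∀ j ∈ Finset.Ico 1 K, melnikov (holonomy y₀ γ) j z = 0 :=
    (eventually_all_finset _).2 fun j hj =>
      hM0 j (Finset.mem_Ico.1 hj).1 (Finset.mem_Ico.1 hj).2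
  have hev2 : ∀ᶠ z : ℝ in 𝓝 0, |z| < η :=
    (continuous_abs.tendsto' 0 0 abs_zero).eventually (gt_mem_nhds hη)
  filter_upwards [hev1, hev2] with z hz1 hz
  have hzr := hz.trans_le hηr
  set t : ℝ := evalAt (0, y₀ + z) H with ht
  have hlev : ∀ s ∈ Icc (0 : ℝ) 1, evalAt (γ z 0 s) H = t := fun s hs => h.level_zero hzr hs
  have htρ : |t| < ρ := by
    have := (hleaf z 0 0 hz h0η hI0).1
    rw [hlev 0 hI0] at this
    linarith
  have hpath : ∀ s ∈ Icc (0 : ℝ) 1, Ψ t 0 s = γ z 0 s := by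
    intro s hs
    have := (hleaf z 0 s hz h0η hs).2
    rwa [hlev s hs] at this
  have hcl : Ψ t 0 1 = Ψ t 0 0 := hΨ.closed t 0 htρ h0ρ
  have hp : Ψ t 0 0 = (0, y₀ + z) := by rw [hpath 0 hI0, h.start z 0 hzr h0r]
  refine ⟨hΨ.byValue h0ρ, t, htρ, congrArg Prod.snd hp, hcl, hpath, ?_⟩
  obtain ⟨B, hB⟩ := leaf_estimate hΨ h hη hηr hηρ hleaf hu0 hu hF hstep K hz h0ρ
  set f : ℝ → ℝ := fun y => evalAt (0, y₀ + y) H with hf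
  set φ : ℕ → ℝ → ℝ := fun k t => F k (hΨ.byValue h0ρ) t 1 with hφ
  have hfd : HasDerivAt f (evalAt (0, y₀ + z) (pderiv 1 H)) z := by
    refine (hasDerivAt_evalAt (c := fun z => ((0, y₀ + z) : ℝ × ℝ)) (t := z) H
      (hasDerivAt_const _ _) ((hasDerivAt_id z).const_add y₀)).congr_deriv ?_
    ring
  have hend : ∀ ε, |ε| < η → evalAt (γ z ε 1) H = f (holonomy y₀ γ z ε) := by
    intro ε hε
    simp only [hf, holonomy, add_sub_cancel]
    rw [← h.finish z ε hzr (hε.trans_le hηr)]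
  have hΔz : holonomy y₀ γ z 0 = z := by
    rw [holonomy, ← hpath 1 hI1, hcl, hp]
    ring
  have hΔa : AnalyticAt ℝ (holonomy y₀ γ z) 0 := by
    have h1 := h.analyticAt hzr h0r hI1
    have h2 : AnalyticAt ℝ (fun ε : ℝ => ((z, ε, 1) : ℝ × ℝ × ℝ)) 0 :=
      analyticAt_const.prod (analyticAt_id.prod analyticAt_const)
    have h3 : AnalyticAt ℝ (fun ε => γ z ε 1) 0 :=
      AnalyticAt.comp (g := fun q : ℝ × ℝ × ℝ => γ q.1 q.2.1 q.2.2)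
        (f := fun ε : ℝ => ((z, ε, 1) : ℝ × ℝ × ℝ)) h1 h2
    exact (analyticAt_snd.comp h3).sub analyticAt_const
  have hΔ : (fun ε => holonomy y₀ γ z ε - z - melnikov (holonomy y₀ γ) K z * ε ^ K) =O[𝓝 0]
      fun ε => ε ^ (K + 1) := by
    refine (isBigO_sub_taylor hΔa (K + 1)).congr_left fun ε => ?_
    have e : ∑ k ∈ Finset.range (K + 1),
        iteratedDeriv k (holonomy y₀ γ z) 0 / (k.factorial : ℝ) * ε ^ k =
        ∑ k ∈ Finset.range (K + 1), melnikov (holonomy y₀ γ) k z * ε ^ k := rfl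
    have e0 : melnikov (holonomy y₀ γ) 0 z = z := by
      simp only [melnikov, iteratedDeriv_zero, hΔz, Nat.factorial_zero, Nat.cast_one, div_one]
    rw [e, Finset.sum_range_succ, Finset.sum_eq_single 0, e0, pow_zero, mul_one, sub_sub]
    · intro j hj hj0
      rw [hz1 j (Finset.mem_Ico.2 ⟨Nat.one_le_iff_ne_zero.2 hj0, Finset.mem_range.1 hj⟩), zero_mul]
    · intro h0
      exact absurd (Finset.mem_range.2 hK) h0
  have hφd : ∀ k, ∃ a, HasDerivAt (φ (k + 1)) a t := fun k =>
    ⟨_, (hstep k).left (hΨ.byValue h0ρ) t htρ 1 hI1⟩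
  choose a ha using hφd
  -- `F 0` plays no role and need not be differentiable
  have key := first_coefficient_eq hK (f := f) (φ := fun k => if k = 0 then 0 else φ k)
    (φ' := fun k _ => if k = 0 then 0 else a (k - 1)) (M := melnikov (holonomy y₀ γ) K z)
    (B := B) (half_pos hη) (hΔa.continuousAt.tendsto.trans (by rw [hΔz])) hΔ hfd
    (by
      intro k
      rcases k with _ | k
      · exact hasDerivAt_const _ _
      · exact ha k)
    (by
      intro ε hε
      have := hB ε hε
      rw [hend ε (hε.trans_lt (by linarith)), h.start z ε hzr
        ((hε.trans_lt (by linarith)).trans_le hηr)] at this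
      exact this)
  have hK0 : K ≠ 0 := by omega
  simp only [hK0, if_false] at key
  exact eq_neg_of_add_eq_zero_left key

end FirstNonzero

end Melnikov

end

theorem mainTheorem7 :
    ∃ C : ℕ, ∀ (n d K : ℕ) (H : Melnikov.BiPoly ℝ) (ω : Melnikov.OneForm ℝ),
      1 ≤ n → n < d →
      H.totalDegree = n + 1 →
      Melnikov.IsPetrovBasis n (MvPolynomial.map (algebraMap ℝ ℂ) H) →
      Melnikov.IsSmoothCurve (MvPolynomial.map (algebraMap ℝ ℂ) H) →
      ω.1.totalDegree ≤ d → ω.2.totalDegree ≤ d →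
      ∃ h : Melnikov.Word n K → RatFunc ℝ,
        (∀ w, Melnikov.ratDegree (h w) ≤ 2 ^ (C * K) * d * n ^ 6) ∧
        ∀ (y₀ : ℝ) (δ : ℝ → ℝ × ℝ) (r : ℝ) (γ : ℝ → ℝ → ℝ → ℝ × ℝ),
          Melnikov.IsCycle H y₀ δ →
          Melnikov.IsLeafFamily H ω y₀ δ r γ →
          Melnikov.IsFirstNonzero (Melnikov.holonomy y₀ γ) K →
          ∀ᶠ z in 𝓝 (0 : ℝ),
            (∀ w, (h w).denom.eval (y₀ + z) ≠ 0) ∧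
            Melnikov.melnikov (Melnikov.holonomy y₀ γ) K z =
              ∑ w : Melnikov.Word n K,
                (h w).eval (RingHom.id ℝ) (y₀ + z) * Melnikov.basicIntegral (γ z 0) w := by
  refine ⟨11, fun n d K H ω hn hnd hH hP hS hω1 hω2 => ?_⟩
  -- for `K = 0` there are no words, and no function is the first nonvanishing one
  rcases Nat.eq_zero_or_pos K with rfl | hK
  · exact ⟨fun w => w.1.elim0, fun w => w.1.elim0, fun y₀ δ r γ _ _ hM => absurd hM.1 (by simp)⟩
  have hP' := hP.splitting.descend
  obtain ⟨D, a, b, hD1, hD0, ha, hb, hD⟩ := hP'.exists_discriminant hH hS.exists_bezout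
  obtain ⟨u, F, h, hu0, hu, hF, hstep, hdeg, hh⟩ :=
    Melnikov.exists_algorithm hP' hH hn ⟨hD1, ha, hb, hD⟩ (by omega : 1 ≤ d) hK hω1 hω2
  refine ⟨h, hdeg, fun y₀ δ r γ hc hγ hM => ?_⟩
  filter_upwards [Melnikov.melnikov_eq hD0 hc hγ hu0 hu hF hstep hM] with z hz
  obtain ⟨Φ, l, hl, hp, hcl, hpath, hmel⟩ := hz
  obtain ⟨h1, h2⟩ := hh Φ l hl hcl
  have hq := Φ.q_mul hl
  rw [hp] at h1 h2 hq
  refine ⟨h1, ?_⟩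
  have hne : Melnikov.evalAt (0, y₀ + z) (MvPolynomial.pderiv 1 H) ≠ 0 := by
    intro h0
    rw [h0, mul_zero, mul_zero] at hq
    exact zero_ne_one hq
  rw [mul_left_cancel₀ hne (hmel.trans h2)]
  exact Finset.sum_congr rfl fun w _ => by rw [Melnikov.basicIntegral_congr hpath]
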